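/- **Hirota quadratic equations of the extended multicomponent Toda hierarchy (EMTH).** *Setting.* Fix $N\ge 0$ and a real $\epsilon\neq0$. The times are $t_{jk},\bar t_{jk}$ ($j\ge0$, $1\le k\le N$) and $s_j$ ($j\ge0$); $s_0$ and $x$ are real variables, all other times are formal variables. Functions are formal power series in the formal times whose coefficients are smooth complex functions of $s_0$ (for tau-functions), resp. of $(x,s_0)$. Let $\Lambda=e^{\epsilon\partial_x}$, $\partial=\partial_x$, $c_0=0$, $c_j=\sum_{i=1}^j\frac1i$. A pair $$S=I+\sum_{n\ge1}w_n\Lambda^{-n},\qquad \bar S=\sum_{n\ge0}\bar w_n\Lambda^{n}$$ of invertible $N\times N$ matrix difference operators, with inverses $S^{-1}=\sum_{n\ge0}\Lambda^{-n}v_n$, $\bar S^{-1}=\sum_{n\ge0}\Lambda^n\bar v_n$, is a pair of dressing operators of the EMTH if $\mathcal L:=S\Lambda S^{-1}=\bar S\Lambda^{-1}\bar S^{-1}$ and $$\epsilon\partial_pS=-(A_p)_-S,\qquad \epsilon\partial_p\bar S=(A_p)_+\bar S$$ for every time $p$. Here $A_{t_{jk}}=SE_{kk}\Lambda^jS^{-1}$,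 $A_{\bar t_{jk}}=\bar SE_{kk}\Lambda^{-j}\bar S^{-1}$, $A_{s_j}=\frac{2\mathcal L^j}{j!}(\log\mathcal L-c_j)$ with $\log\mathcal L=\frac12(S\epsilon\partial S^{-1}-\bar S\epsilon\partial\bar S^{-1})$; $(\cdot)_-$ collects the negative powers of $\Lambda$ and $(\cdot)_+$ the other ones. *Tau-functions.* Let $\tau$ be a function with $1/\tau$ defined (its constant term in the formal times vanishes nowhere). Let $\tau_M=(\tau_{ik})$, $\tau_M^*=(\tau^*_{ik})$, $\bar\tau_M=(\bar\tau_{ik})$, $\bar\tau_M^*=(\bar\tau^*_{ik})$ be $N\times N$ matrices of functions of $s_0,t,\bar t,s$ with $\tau_{ii}=\tau^*_{ii}=\tau$ for all $i$. (The case $\tau_M^*=\tau_M$, $\bar\tau_M^*=\bar\tau_M$ is included.) They are *matrix tau-functions of the EMTH* if there are dressing operators $S,\bar S$ as above whose symbols are $$\sum_n (w_n)_{ik}\lambda^{-n}=\lambda^{\delta_{ik}-1}\frac{\tau_{ik}(s_0+x-\frac\epsilon2,\,t-[\lambda^{-1}]_k,\,\bar t,\,s)}{\tau(s_0+x-\frac\epsilon2,t,\bar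 t,s)},\quad \sum_n (v_n)_{ik}\lambda^{-n}=\lambda^{\delta_{ik}-1}\frac{\tau^*_{ik}(s_0+x+\frac\epsilon2,\,t+[\lambda^{-1}]_i,\,\bar t,\,s)}{\tau(s_0+x+\frac\epsilon2,t,\bar t,s)},$$ $$\sum_n (\bar w_n)_{ik}\lambda^{n}=\frac{\bar\tau_{ik}(s_0+x+\frac\epsilon2,\,t,\,\bar t+[\lambda]_k,\,s)}{\tau(s_0+x-\frac\epsilon2,t,\bar t,s)},\quad \sum_n (\bar v_n)_{ik}\lambda^{n}=\frac{\bar\tau^*_{ik}(s_0+x-\frac\epsilon2,\,t,\,\bar t-[\lambda]_i,\,s)}{\tau(s_0+x+\frac\epsilon2,t,\bar t,s)},$$ where $t\pm[z]_k$ replaces $t_{jk}$ by $t_{jk}\pm\epsilon z^j/j$ for all $j\ge1$, and similarly for $\bar t$. *Vertex operators.* With $[z]_{\partial,k}=\epsilon\sum_{j\ge1}\frac{z^j}{j}\partial_{t_{jk}}$ and $[z]_{\bar\partial,k}=\epsilon\sum_{j\ge1}\frac{z^j}{j}\partial_{\bar t_{jk}}$, put $\Gamma^{\pm a}=\sum_kE_{kk}\Gamma^{\pm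 a}_k$ and $\Gamma^{\pm b}=\sum_kE_{kk}\Gamma_k^{\pm b}$, where $$\Gamma_k^{\pm a}=\exp\Big(\pm\tfrac1\epsilon\sum_{j\ge0}\big(t_{jk}\lambda^j+s_j\tfrac{\lambda^j}{j!}(\log\lambda-c_j)\big)\Big)\exp\big(\mp\tfrac\epsilon2\partial_{s_0}\mp[\lambda^{-1}]_{\partial,k}\big),$$ $$\Gamma_k^{\pm b}=\exp\Big(\pm\tfrac1\epsilon\sum_{j\ge0}\big(\bar t_{jk}\lambda^{-j}-s_j\tfrac{\lambda^{-j}}{j!}(\log\lambda+c_j)\big)\Big)\exp\big(\mp\tfrac\epsilon2\partial_{s_0}\mp[\lambda]_{\bar\partial,k}\big).$$ In the first tensor factor the $E_{kk}$ multiply the matrix it is applied to from the right ($\Gamma_k$ acts on column $k$), in the second one from the left ($\Gamma_k$ acts on row $k$). The off-diagonal entries of $\tau_M$ and $\tau_M^*$ enter with the factor $\lambda^{-1}$ that they carry in the symbols. Put $$\Gamma_a^{\delta\#}\otimes\Gamma_a^\delta=e^{x\partial_{s_0}}\exp\Big(\sum_{j>0}\tfrac{\lambda^j}{\epsilon\,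 j!}(\epsilon\partial_x)(s_j-s_j')\Big)e^{x\partial_{s_0'}},\quad \Gamma_b^{\delta\#}\otimes\Gamma_b^\delta=e^{x\partial_{s_0}}\exp\Big(\sum_{j>0}\tfrac{\lambda^{-j}}{\epsilon\, j!}(\epsilon\partial_x)(s_j-s_j')\Big)e^{x\partial_{s_0'}},$$ where the first tensor factor (in the times $t,\bar t,s$, shifted by $s_0\mapsto s_0+x$) stands to the left of the exponential in $\partial_x$ and the second one (in independent times $t',\bar t',s'$, shifted by $s'_0\mapsto s_0'+x$) to its right, and all products are products of matrices of differential operators in $x$. Each coefficient of the resulting series in the formal times is a Laurent series in $\lambda^{-1}$ (for $a$) or in $\lambda$ (for $b$) whose coefficients may depend on $\log\lambda$. **Theorem.** The matrices $\tau_M,\tau_M^*,\bar\tau_M,\bar\tau_M^*$ are matrix tau-functions of the EMTH if and only if, for every $l\in\mathbb Z$ and every $r\in\mathbb N=\{0,1,2,\dots\}$, the expression $$\lambda^{r-1}\big(\Gamma_a^{\delta\#}\otimes\Gamma_a^\delta\big)\big(\Gamma^a\otimes\Gamma^{-a}\big)(\tau_M\otimes\tau_M^*)-\lambda^{-r-1}\big(\Gamma_b^{\delta\#}\otimes\Gamma_b^\delta\big)\big(\Gamma^{-b}\otimes\Gamma^{b}\big)(\bar\tau_M\otimes\bar\tau_M^*)$$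 computed at $s_0-s_0'=l\epsilon$ is a single-valued Laurent series in $\lambda$ (it has no monodromy in $\log\lambda$) and its residue, the coefficient of $\lambda^{-1}$, is zero. -/

import Mathlib

open scoped ContDiff

noncomputable section

namespace EMTH

/-! ## Coefficient functions and operators on them -/

/-- The `ℂ`-algebra of smooth complex functions on a real normed space. -/
def Smooth (E : Type) [NormedAddCommGroup E] [NormedSpace ℝ E] : Subalgebra ℂ (E → ℂ) where
  carrier := {f | ContDiff ℝ ∞ f}
  mul_mem' {f g} hf hg := by
    have hf' : ContDiff ℝ ∞ f := hf
    have hg' : ContDiff ℝ ∞ g := hg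
    exact hf'.mul hg'
  add_mem' {f g} hf hg := by
    have hf' : ContDiff ℝ ∞ f := hf
    have hg' : ContDiff ℝ ∞ g := hg
    exact hf'.add hg'
  algebraMap_mem' c := by
    have h : ContDiff ℝ ∞ (fun _ : E => c) := contDiff_const
    exact h

theorem contDiff_of_smooth {E : Type} [NormedAddCommGroup E] [NormedSpace ℝ E] (f : Smooth E) :
    ContDiff ℝ ∞ (f : E → ℂ) := f.2

/-- Smooth functions of `s₀`. -/
abbrev Fun1 : Type := Smooth ℝ

/-- Smooth functions of the pair `(x, s₀)`. -/
abbrev Fun2 : Type := Smooth (ℝ × ℝ)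

/-- Linear operators on functions of `(x, s₀)`. Multiplication operators, the shift `Λ`, the
derivative `∂ = ∂_x` and the derivative `∂_{s₀}` all live here. -/
def Oper : Type := Module.End ℂ Fun2

instance : Ring Oper := inferInstanceAs (Ring (Module.End ℂ Fun2))

instance : Algebra ℂ Oper := inferInstanceAs (Algebra ℂ (Module.End ℂ Fun2))

/-- A linear map, regarded as an element of the ring of operators. -/
def Oper.of (A : Module.End ℂ Fun2) : Oper := A

/-- The operator of multiplication by a function. -/
def mulOp (f : Fun2) : Oper := .of (LinearMap.mulLeft ℂ f)

/-- Directional derivative of a smooth function of `(x, s₀)`. -/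
def dirDeriv (v : ℝ × ℝ) : Module.End ℂ Fun2 where
  toFun f := ⟨fun p => fderiv ℝ (f : ℝ × ℝ → ℂ) p v, by
    have h : ContDiff ℝ ∞ (fun p => fderiv ℝ (f : ℝ × ℝ → ℂ) p v) :=
      ((contDiff_of_smooth f).fderiv_right (m := ∞) (by simp)).clm_apply contDiff_const
    exact h⟩
  map_add' f g := by
    ext p
    change fderiv ℝ ((f : ℝ × ℝ → ℂ) + (g : ℝ × ℝ → ℂ)) p v = _
    rw [fderiv_add ((contDiff_of_smooth f).differentiable (by simp) p)
      ((contDiff_of_smooth g).differentiable (by simp) p)]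
    rfl
  map_smul' c f := by
    ext p
    change fderiv ℝ (c • (f : ℝ × ℝ → ℂ)) p v = _
    rw [fderiv_const_smul ((contDiff_of_smooth f).differentiable (by simp) p)]
    rfl

/-- `∂ = ∂_x`. -/
def dX : Oper := .of (dirDeriv (1, 0))

/-- `∂_{s₀}`. -/
def dS0 : Oper := .of (dirDeriv (0, 1))

/-- The translation `f(x, s₀) ↦ f(x + a, s₀)`. -/
def translate (a : ℝ) : Module.End ℂ Fun2 where
  toFun f := ⟨fun p => (f : ℝ × ℝ → ℂ) (p.1 + a, p.2), by
    have h : ContDiff ℝ ∞ (fun p : ℝ × ℝ => (f : ℝ × ℝ → ℂ) (p.1 + a, p.2)) :=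
      (contDiff_of_smooth f).comp ((contDiff_fst.add contDiff_const).prodMk contDiff_snd)
    exact h⟩
  map_add' _ _ := rfl
  map_smul' _ _ := rfl

/-- The shift operator `Λ^{a/ε}`, that is the translation by `a` in `x`. -/
def shiftBy (a : ℝ) : Oper := .of (translate a)

/-- The function `(x, s₀) ↦ f(s₀ + x + a)` made from a function `f` of `s₀`; it is
`exp(x ∂_{s₀}) exp(a ∂_{s₀}) f`. -/
def pull (a : ℝ) (f : Fun1) : Fun2 :=
  ⟨fun p => (f : ℝ → ℂ) (p.2 + p.1 + a), by
    have h : ContDiff ℝ ∞ (fun p : ℝ × ℝ => (f : ℝ → ℂ) (p.2 + p.1 + a)) :=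
      (contDiff_of_smooth f).comp ((contDiff_snd.add contDiff_fst).add contDiff_const)
    exact h⟩

/-- The function `(x, s₀) ↦ exp(c (s₀ + x + a))`. -/
def expFun (c : ℂ) (a : ℝ) : Fun2 :=
  ⟨fun p => Complex.exp (c * ((p.2 + p.1 + a : ℝ) : ℂ)), by
    have h : ContDiff ℝ ∞ (fun p : ℝ × ℝ => Complex.exp (c * ((p.2 + p.1 + a : ℝ) : ℂ))) :=
      (contDiff_const.mul (Complex.ofRealCLM.contDiff.comp
        ((contDiff_snd.add contDiff_fst).add contDiff_const))).cexp
    exact h⟩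

/-! ## Formal power series in the times -/

/-- The formal times: `t_{jk}` and `t̄_{jk}` for `j ≥ 0`, `1 ≤ k ≤ N`, and `s_j` for `j ≥ 1`.
The remaining time `s₀` is a real variable. -/
inductive Time (N : ℕ) : Type
  | t (j : ℕ) (k : Fin N)
  | tbar (j : ℕ) (k : Fin N)
  | s (j : ℕ+)

/-- Formal power series in the times whose coefficients are functions of `s₀`. -/
abbrev Tau (N : ℕ) : Type := MvPowerSeries (Time N) Fun1

/-- Formal power series in the times whose coefficients are functions of `(x, s₀)`. -/
abbrev Coef (N : ℕ) : Type := MvPowerSeries (Time N) Fun2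

/-- The partial derivative of a formal power series with respect to the variable `i`. -/
def pDeriv {σ M : Type} [AddCommGroup M] [Module ℂ M] (i : σ) :
    MvPowerSeries σ M →ₗ[ℂ] MvPowerSeries σ M where
  toFun f := fun α => ((α i : ℂ) + 1) • f (α + Finsupp.single i 1)
  map_add' f g := funext fun _ => smul_add _ (f _) (g _)
  map_smul' c f := funext fun _ => smul_comm _ c (f _)

/-- `exp F = ∑_n F ^ n / n!` for a formal power series `F` without constant term: the powers
`F ^ n` with `n > |α|` have no coefficient at `α`. -/
def expSeries {σ A : Type} [Ring A] [Algebra ℂ A] (F : MvPowerSeries σ A) : MvPowerSeries σ A :=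
  fun α => ∑ n ∈ Finset.range (α.degree + 1),
    ((n.factorial : ℂ)⁻¹) • MvPowerSeries.coeff α (F ^ n)

/-- The (infinite) linear form `∑_i c_i · i` in the formal times. -/
def linForm {σ A : Type} [AddCommMonoid A] (c : σ → A) : MvPowerSeries σ A :=
  fun α => if α.degree = 1 then α.sum fun i n => n • c i else 0

/-! ## Difference operators

An operator `∑_{i ≤ m} X_i Λ^i` is recorded as the Laurent series `∑_i (X_i Λ^i) X^{-i}` of its
homogeneous terms, `X` marking the powers of `Λ⁻¹`. An operator `∑_{i ≥ m} X_i Λ^i` is recorded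
likewise as `∑_i (X_i Λ^i) X^i`. The sign `u` says what `X` marks: `Λ^u`, with `u = -1` for the
first kind and `u = 1` for the second. The product of such operators is then the product of
matrices of formal series. -/

/-- Entries: formal in the times, Laurent series in the marker, operators as coefficients. -/
abbrev OpSeries (N : ℕ) : Type := MvPowerSeries (Time N) (LaurentSeries Oper)

/-- Matrix difference operators. -/
abbrev Op (N : ℕ) : Type := Matrix (Fin N) (Fin N) (OpSeries N)

/-- Matrices over formal power series in the times with coefficients in `M`. -/
abbrev TMat (N : ℕ) (M : Type) : Type := Matrix (Fin N) (Fin N) (MvPowerSeries (Time N) M)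

variable {N : ℕ}

/-- The operator whose homogeneous terms are `c 0, c 1, c 2, …` (powers `X^0, X^1, …`). -/
def ofTerms (c : ℕ → TMat N Oper) : Op N :=
  fun i j α => HahnSeries.ofPowerSeries ℤ Oper
    (PowerSeries.mk fun n => MvPowerSeries.coeff α (c n i j))

/-- The homogeneous term at `Λ^m` of an operator with marker `Λ^u`. -/
def term (u : ℤ) (F : Op N) (m : ℤ) : TMat N Oper :=
  fun i j α => (MvPowerSeries.coeff α (F i j)).coeff (u * m)

/-- The operator `∑_{n ≥ 0} w_n Λ^{u n}` (left symbol `w`). -/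
def leftOp (ε : ℝ) (u : ℤ) (w : ℕ → TMat N Fun2) : Op N :=
  ofTerms fun n i j α => mulOp (MvPowerSeries.coeff α (w n i j)) * shiftBy ((u * n : ℤ) * ε)

/-- The operator `∑_{n ≥ 0} Λ^{u n} w_n` (right symbol `w`). -/
def rightOp (ε : ℝ) (u : ℤ) (w : ℕ → TMat N Fun2) : Op N :=
  ofTerms fun n i j α => shiftBy ((u * n : ℤ) * ε) * mulOp (MvPowerSeries.coeff α (w n i j))

/-- `Λ^j` as an operator with marker `Λ^u`, for `u = ±1`. -/
def shiftOp (ε : ℝ) (u j : ℤ) : Op N :=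
  Matrix.diagonal fun _ =>
    MvPowerSeries.C (HahnSeries.single (u * j) (shiftBy ((j : ℝ) * ε)))

/-- An operator not containing `Λ` or the formal times, as a scalar matrix operator. -/
def scalarOp (A : Oper) : Op N :=
  Matrix.diagonal fun _ => MvPowerSeries.C (HahnSeries.single 0 A)

/-- The matrix unit `E_{kk}`. -/
def unitE (k : Fin N) : Op N := Matrix.single k k 1

/-- The negative part `∑_{m < 0}` of a formal sum of homogeneous terms, with marker `Λ⁻¹`. -/
def negPart (c : ℤ → TMat N Oper) : Op N :=
  ofTerms fun n => if n = 0 then 0 else c (-(n : ℤ))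

/-- The nonnegative part `∑_{m ≥ 0}` of a formal sum of homogeneous terms, with marker `Λ`. -/
def posPart (c : ℤ → TMat N Oper) : Op N :=
  ofTerms fun n => c n

/-- Derivative of the coefficients of an operator with respect to a formal time. -/
def dTime (i : Time N) (F : Op N) : Op N := fun a b => pDeriv i (F a b)

/-- Derivative of the coefficients of an operator with respect to `s₀`. -/
def dTimeS0 (F : Op N) : Op N := scalarOp dS0 * F - F * scalarOp dS0

/-! ## The extended multicomponent Toda hierarchy -/

/-- `B_{jk} = S E_{kk} Λ^j S⁻¹`. -/
def opB (ε : ℝ) (S Sinv : Op N) (j : ℕ) (k : Fin N) : ℤ → TMat N Oper :=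
  term (-1) (S * unitE k * shiftOp ε (-1) j * Sinv)

/-- `B̄_{jk} = S̄ E_{kk} Λ^{-j} S̄⁻¹`. -/
def opBbar (ε : ℝ) (Sb Sbinv : Op N) (j : ℕ) (k : Fin N) : ℤ → TMat N Oper :=
  term 1 (Sb * unitE k * shiftOp ε 1 (-j) * Sbinv)

/-- `log₊ L = S ε∂ S⁻¹`. -/
def logPlus (ε : ℝ) (S Sinv : Op N) : Op N := S * ((ε : ℂ) • scalarOp dX) * Sinv

/-- `log₋ L = - S̄ ε∂ S̄⁻¹`. -/
def logMinus (ε : ℝ) (Sb Sbinv : Op N) : Op N := -(Sb * ((ε : ℂ) • scalarOp dX) * Sbinv)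

/-- `D_j = (2 L^j / j!) (log L - c_j)` with `log L = (log₊ L + log₋ L) / 2` and
`c_j = 1 + 1/2 + ⋯ + 1/j`, that is
`D_j = (L^j / j!) (log₊ L - c_j) + (L^j / j!) (log₋ L - c_j)`. In the first summand
`L = S Λ S⁻¹` is used, in the second one `L = S̄ Λ⁻¹ S̄⁻¹`. -/
def opD (ε : ℝ) (S Sinv Sb Sbinv : Op N) (j : ℕ) : ℤ → TMat N Oper := fun m =>
  ((j.factorial : ℂ)⁻¹) •
    (term (-1) ((S * shiftOp ε (-1) 1 * Sinv) ^ j *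
        (logPlus ε S Sinv - ((harmonic j : ℚ) : ℂ) • (1 : Op N))) m
      + term 1 ((Sb * shiftOp ε 1 (-1) * Sbinv) ^ j *
        (logMinus ε Sb Sbinv - ((harmonic j : ℚ) : ℂ) • (1 : Op N))) m)

/-- `S`, `S̄` (with inverses `Sinv`, `Sbinv`) are dressing operators of the extended
multicomponent Toda hierarchy: they define the same Lax operator and satisfy the Sato equations
with respect to all times. -/
structure IsDressing (ε : ℝ) (S Sinv Sb Sbinv : Op N) : Prop where
  mul_inv : S * Sinv = 1
  inv_mul : Sinv * S = 1
  bar_mul_inv : Sb * Sbinv = 1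
  bar_inv_mul : Sbinv * Sb = 1
  /-- `L = S Λ S⁻¹ = S̄ Λ⁻¹ S̄⁻¹`. -/
  lax : term (-1) (S * shiftOp ε (-1) 1 * Sinv) = term 1 (Sb * shiftOp ε 1 (-1) * Sbinv)
  flow_t : ∀ (j : ℕ) (k : Fin N),
    (ε : ℂ) • dTime (Time.t j k) S = -(negPart (opB ε S Sinv j k) * S)
  flow_t_bar : ∀ (j : ℕ) (k : Fin N),
    (ε : ℂ) • dTime (Time.t j k) Sb = posPart (opB ε S Sinv j k) * Sb
  flow_tbar : ∀ (j : ℕ) (k : Fin N),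
    (ε : ℂ) • dTime (Time.tbar j k) S = -(negPart (opBbar ε Sb Sbinv j k) * S)
  flow_tbar_bar : ∀ (j : ℕ) (k : Fin N),
    (ε : ℂ) • dTime (Time.tbar j k) Sb = posPart (opBbar ε Sb Sbinv j k) * Sb
  flow_s : ∀ j : ℕ+,
    (ε : ℂ) • dTime (Time.s j) S = -(negPart (opD ε S Sinv Sb Sbinv j) * S)
  flow_s_bar : ∀ j : ℕ+,
    (ε : ℂ) • dTime (Time.s j) Sb = posPart (opD ε S Sinv Sb Sbinv j) * Sb
  flow_s0 : (ε : ℂ) • dTimeS0 S = -(negPart (opD ε S Sinv Sb Sbinv 0) * S)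
  flow_s0_bar : (ε : ℂ) • dTimeS0 Sb = posPart (opD ε S Sinv Sb Sbinv 0) * Sb

/-! ## Tau-functions -/

/-- The two halves of the construction: near `λ = ∞` with the times `t`, and near `λ = 0` with
the times `t̄`. -/
inductive Side : Type
  | a
  | b

/-- The times attached to a side. -/
def Side.time : Side → ℕ → Fin N → Time N
  | .a => Time.t
  | .b => Time.tbar

/-- The local parameter `z` of a side is `λ^{locExp}`: `λ⁻¹` on side `a` and `λ` on side `b`. -/
def Side.locExp : Side → ℤ
  | .a => -1
  | .b => 1

/-- `[z]_{∂,k} = ε ∑_{j ≥ 1} (z^j / j) ∂_{t_{jk}}` (with `t̄` in place of `t` on side `b`). -/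
def bracket (ε : ℝ) (d : Side) (k : Fin N) : PowerSeries (Module.End ℂ (Tau N)) :=
  PowerSeries.mk fun j =>
    if j = 0 then 0 else ((ε : ℂ) / j) • (pDeriv (d.time j k) : Module.End ℂ (Tau N))

/-- `exp(η [z]_{∂,k}) f = f(…, t_{jk} + η ε z^j / j, …)`, a power series in `z`. -/
def miwa (ε : ℝ) (d : Side) (η : ℂ) (k : Fin N) (f : Tau N) : PowerSeries (Tau N) :=
  PowerSeries.mk fun n => PowerSeries.coeff n (expSeries (η • bracket ε d k)) f

/-- The weight of the entry `(i, j)`: on side `a` off-diagonal entries carry a factor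
`z = λ⁻¹`. -/
def weight (d : Side) (i j : Fin N) : PowerSeries (Tau N) :=
  match d with
  | .a => if i = j then 1 else PowerSeries.X
  | .b => 1

/-- The matrix of tau-functions, column `k` being shifted in the `k`-th times. -/
def shiftCol (ε : ℝ) (d : Side) (η : ℂ) (M : Matrix (Fin N) (Fin N) (Tau N)) :
    Matrix (Fin N) (Fin N) (PowerSeries (Tau N)) :=
  fun i k => weight d i k * miwa ε d η k (M i k)

/-- The matrix of tau-functions, row `k` being shifted in the `k`-th times. -/
def shiftRow (ε : ℝ) (d : Side) (η : ℂ) (M : Matrix (Fin N) (Fin N) (Tau N)) :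
    Matrix (Fin N) (Fin N) (PowerSeries (Tau N)) :=
  fun k j => weight d k j * miwa ε d η k (M k j)

/-- The coefficientwise replacement of `f(s₀)` by `f(s₀ + x + a)`. -/
def pullT (a : ℝ) (f : Tau N) : Coef N := fun α => pull a (MvPowerSeries.coeff α f)

/-- The symbol `∑ w_n z^n` is the quotient `P(s₀ + x + a) / τ(s₀ + x + b)`. -/
def IsQuotient (w : ℕ → TMat N Fun2) (P : Matrix (Fin N) (Fin N) (PowerSeries (Tau N))) (a : ℝ)
    (τ : Tau N) (b : ℝ) : Prop :=
  ∀ n i j, w n i j * pullT b τ = pullT a (PowerSeries.coeff n (P i j))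

/-- `τ_M, τ̄_M` together with the matrices `τ_M^*, τ̄_M^*` that serve for the inverse symbols
are matrix tau-functions of the hierarchy: there are dressing operators
`S = ∑ w_n Λ^{-n}`, `S̄ = ∑ w̄_n Λ^n` with inverses `S⁻¹ = ∑ Λ^{-n} v_n`, `S̄⁻¹ = ∑ Λ^n v̄_n`
whose symbols are given by the four quotient formulas. -/
def IsMatrixTau (ε : ℝ) (τ : Tau N) (τM τMs τbM τbMs : Matrix (Fin N) (Fin N) (Tau N)) : Prop :=
  ∃ w v wb vb : ℕ → TMat N Fun2,
    w 0 = 1 ∧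
    IsDressing ε (leftOp ε (-1) w) (rightOp ε (-1) v) (leftOp ε 1 wb) (rightOp ε 1 vb) ∧
    IsQuotient w (shiftCol ε .a (-1) τM) (-(ε / 2)) τ (-(ε / 2)) ∧
    IsQuotient v (shiftRow ε .a 1 τMs) (ε / 2) τ (ε / 2) ∧
    IsQuotient wb (shiftCol ε .b 1 τbM) (ε / 2) τ (-(ε / 2)) ∧
    IsQuotient vb (shiftRow ε .b (-1) τbMs) (-(ε / 2)) τ (ε / 2)

/-! ## Vertex operators

All expressions depend on the value `ℓ` of `log λ`. They are formal series in the times whose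
coefficients are Laurent series in the local parameter `z` (`λ⁻¹` or `λ`) with operators in `x`
as coefficients. -/

/-- The branch of `log z⁻¹`: `log λ` on side `a` and `- log λ` on side `b`. -/
def Side.logInv (d : Side) (ℓ : ℂ) : ℂ := -(d.locExp : ℂ) * ℓ

/-- The formal part
`(1/ε) (∑_{j ≥ 0} t_{jk} z^{-j} + ∑_{j ≥ 1} s_j (z^{-j} / j!) (log z⁻¹ - c_j))`
of the exponent of the `k`-th diagonal entry (with `t̄` in place of `t` on side `b`). -/
def exponent (ε : ℝ) (d : Side) (ℓ : ℂ) (k : Fin N) : OpSeries N :=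
  linForm fun i => match d, i with
    | .a, .t j k' => if k' = k then HahnSeries.single (-(j : ℤ)) ((ε : ℂ)⁻¹ • (1 : Oper)) else 0
    | .b, .tbar j k' => if k' = k then HahnSeries.single (-(j : ℤ)) ((ε : ℂ)⁻¹ • (1 : Oper)) else 0
    | _, .s j => HahnSeries.single (-(j : ℤ))
        (((ε : ℂ)⁻¹ * ((j : ℕ).factorial : ℂ)⁻¹ * (d.logInv ℓ - ((harmonic j : ℚ) : ℂ))) •
          (1 : Oper))
    | _, _ => 0

/-- The exponent `∑_{j ≥ 1} (z^{-j} / (ε j!)) (ε ∂_x) s_j` of the operators `Γ^δ`. -/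
def deltaExponent (ε : ℝ) : OpSeries N :=
  linForm fun i => match i with
    | .s j => HahnSeries.single (-(j : ℤ))
        (((ε : ℂ)⁻¹ * ((j : ℕ).factorial : ℂ)⁻¹) • ((ε : ℂ) • dX))
    | _ => 0

/-- Multiplication by a function of `(x, s₀)`, as a constant series. -/
def mulSeries (f : Fun2) : OpSeries N := MvPowerSeries.C (HahnSeries.single 0 (mulOp f))

/-- A power series in `z` of functions of `s₀` and the times, turned into multiplication operators
after `s₀ ↦ s₀ + x + a`. -/
def mulPull (a : ℝ) (F : PowerSeries (Tau N)) : OpSeries N :=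
  fun α => HahnSeries.ofPowerSeries ℤ Oper
    (PowerSeries.mk fun n => mulOp (pull a (MvPowerSeries.coeff α (PowerSeries.coeff n F))))

/-- `exp(x∂_{s₀})` applied to the entry `(i, k)` of `Γ^{η·} M` at `s₀ + a`, where `Γ^{η·}` acts in
the times of index `k` and `F = exp(-η [z]_{∂,k}) M_{ik}`: the product of
`exp(η (1/ε) s₀ log z⁻¹)`, of the exponential of the formal part of the exponent, and of
`exp(-η (ε/2) ∂_{s₀}) F`. -/
def vertexEntry (ε : ℝ) (d : Side) (η : ℝ) (ℓ : ℂ) (a : ℝ) (k : Fin N)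
    (F : PowerSeries (Tau N)) : OpSeries N :=
  mulSeries (expFun ((η : ℂ) * (ε : ℂ)⁻¹ * d.logInv ℓ) a) *
    expSeries ((η : ℂ) • exponent ε d ℓ k) * mulPull (a - η * (ε / 2)) F

/-- `Γ^{δ#} Γ^{η·} M` in the first tensor factor. Here the diagonal matrices `E_{kk}` multiply
`M` from the right, so that they act on columns, and `exp(∑ (z^{-j}/(εj!)) (ε∂_x) s_j)` stands to
the right. -/
def vertexFirst (ε : ℝ) (d : Side) (η : ℝ) (ℓ : ℂ) (M : Matrix (Fin N) (Fin N) (Tau N)) : Op N :=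
  fun i k => vertexEntry ε d η ℓ 0 k (shiftCol ε d (-η) M i k) * expSeries (deltaExponent ε)

/-- `Γ^δ Γ^{η·} M` in the second tensor factor, at `s₀' = s₀ + a`. Here the diagonal matrices
`E_{kk}` multiply `M` from the left, so that they act on rows, and
`exp(-∑ (z^{-j}/(εj!)) (ε∂_x) s_j)` stands to the left. -/
def vertexSecond (ε : ℝ) (d : Side) (η : ℝ) (ℓ : ℂ) (a : ℝ) (M : Matrix (Fin N) (Fin N) (Tau N)) :
    Op N :=
  fun k j => expSeries (-deltaExponent ε) * vertexEntry ε d η ℓ a k (shiftRow ε d (-η) M k j)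

/-- Functions of two independent sets of times: the coefficient at each pair of monomials. -/
abbrev Bi (N : ℕ) : Type :=
  (Time N →₀ ℕ) → (Time N →₀ ℕ) → Matrix (Fin N) (Fin N) Oper

/-- The coefficient of `λ^n` in `P ⊗ Q`, the product of `P` taken at the times `t, t̄, s` and of
`Q` taken at independent times `t', t̄', s'`. -/
def tensorCoeff (d : Side) (P Q : Op N) (n : ℤ) : Bi N := fun α β i j =>
  HahnSeries.coeff
    ((P.map (MvPowerSeries.coeff α) * Q.map (MvPowerSeries.coeff β)) i j) (d.locExp * n)

/-- The coefficient of `λ^n` in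
`λ^{r-1} (Γ_a^{δ#} ⊗ Γ_a^δ)(Γ^a ⊗ Γ^{-a})(τ_M ⊗ τ_M^*)
  - λ^{-r-1} (Γ_b^{δ#} ⊗ Γ_b^δ)(Γ^{-b} ⊗ Γ^b)(τ̄_M ⊗ τ̄_M^*)`
at `s₀ - s₀' = lε`, where `ℓ` is the value of `log λ`. -/
def hirotaExpr (ε : ℝ) (τM τMs τbM τbMs : Matrix (Fin N) (Fin N) (Tau N)) (l : ℤ) (r : ℕ)
    (ℓ : ℂ) (n : ℤ) : Bi N :=
  tensorCoeff .a (vertexFirst ε .a 1 ℓ τM) (vertexSecond ε .a (-1) ℓ (-(l * ε)) τMs)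
      (n - (r - 1)) -
    tensorCoeff .b (vertexFirst ε .b (-1) ℓ τbM) (vertexSecond ε .b 1 ℓ (-(l * ε)) τbMs)
      (n - (-r - 1))

/-- The expression `∑_n Φ_n(log λ) λ^n` is single-valued, equal to the Laurent series
`∑_n c_n λ^n`: for some integer `m`, one has `Φ_n(ℓ) = e^{mℓ} c_{n+m}` for every value `ℓ` of
`log λ`. -/
def IsLaurentExpansion {M : Type} [AddCommGroup M] [Module ℂ M] (Φ : ℂ → ℤ → M) (c : ℤ → M) :
    Prop :=
  ∃ m : ℤ, ∀ (ℓ : ℂ) (n : ℤ), Φ ℓ n = Complex.exp ((m : ℂ) * ℓ) • c (n + m)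

/-- The Hirota quadratic equations: for all `l ∈ ℤ`, `r ∈ ℕ` the expression at `s₀ - s₀' = lε` is
single-valued and its residue (the coefficient of `λ⁻¹`) vanishes. -/
def HirotaQuadratic (ε : ℝ) (τM τMs τbM τbMs : Matrix (Fin N) (Fin N) (Tau N)) : Prop :=
  ∀ (l : ℤ) (r : ℕ), ∃ c : ℤ → Bi N,
    IsLaurentExpansion (hirotaExpr ε τM τMs τbM τbMs l r) c ∧ c (-1) = 0

end EMTH

end

/-!
The Hirota quadratic equations are the bilinear equations
`W(t) Λ^r W(t')⁻¹ = W̄(t) Λ^{-r} W̄(t')⁻¹`, `r ≥ 0`, for the wave operators `W = S exp Ξ` and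
`W̄ = S̄ exp Ξ̄`, written coefficient by coefficient in `Λ`. Here `ε ∂_p Ξ` and `ε ∂_p Ξ̄` are the
operators `E_{kk} Λ^j`, `- E_{kk} Λ^{-j}`, `(Λ^j / j!) (ε∂ - c_j)` and `(Λ^{-j} / j!) (ε∂ + c_j)`.

*From symbols to operators.* Conjugation by `λ^{(s₀ + x)/ε}` replaces `∂` by `∂ - log λ / ε`, which
cancels the logarithms in the exponents of the vertex operators. Each tensor factor is therefore the
symbol of a wave operator times a power `λ^{±(s₀ + x)/ε}` (`vertexFirst_apply`,
`vertexSecond_apply`), and at `s₀ - s₀' = lε` these powers multiply to `λ^l`, so that the expression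
is single-valued and its residue is one coefficient of the product of symbols
(`tensorCoeff_vertex`, `isLaurentExpansion_iff`). As all functions depend on `s₀ + x` only, the
shift `s₀' = s₀ - lε` is the effect of moving `Λ^{-l}` past the right factor, and the residue is the
difference of the coefficients of `Λ^{-l}` in the two sides of the bilinear equation
(`coeff_mul_shift_mul`, `hirotaQuadratic_iff`). The factors `1/τ` of the symbols are the same on
both sides, on the left as well as on the right, and can be put in or taken away.

*From the hierarchy to the bilinear equations.* With `A_p = X - Y`, where `X = S (ε ∂_p Ξ) S⁻¹` is
bounded from above and `Y = S̄ (ε ∂_p Ξ̄) S̄⁻¹` from below in powers of `Λ` (`flowGen_eq`), the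
Sato equations say that `W` and `W̄` satisfy the same linear equation, with the operator
`X - (A_p)_- = Y + (A_p)_+`, which is a Laurent polynomial in `Λ`. Hence the bilinear equations hold
as soon as they hold at `t = t' = 0`, where they are powers of the Lax equation
(`bilinear_of_flows`).

*From the bilinear equations to the hierarchy.* At `t = t'`, the equation with `r = 0` equates
`I + (negative powers)` and a series in nonnegative powers, so both are `I` and the candidates for
the inverses are inverse (`OpMatch.eq_one`, `rightOp_mul_leftOp`). The equation with `r = 1` is the
Lax equation, and the derivative of the one with `r = 0`, split into negative and nonnegative
powers, gives the Sato equations (`eq_parts_of_opMatch`, `isDressing_of_bilinear`). The flow of `s₀`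
holds because `∂_{s₀} = ∂_x` on all coefficients (`flow_s0_of_dTimeS0`).
-/

open scoped ContDiff

noncomputable section

namespace EMTH

/-! ### Formal differential calculus in the times -/

section Formal

set_option linter.unusedSectionVars false

open MvPowerSeries

variable {σ A : Type} [Ring A] [Algebra ℂ A]

theorem coeff_pDeriv (i : σ) (f : MvPowerSeries σ A) (α : σ →₀ ℕ) :
    coeff α (pDeriv i f) = ((α i : ℂ) + 1) • coeff (α + Finsupp.single i 1) f := rfl

theorem coeff_complex_smul (z : ℂ) (f : MvPowerSeries σ A) (α : σ →₀ ℕ) :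
    coeff α (z • f) = z • coeff α f := rfl

/-- Every multi-index is reached from `0` by raising one exponent at a time. -/
theorem finsupp_induction_single_one {P : (σ →₀ ℕ) → Prop} (h0 : P 0)
    (hs : ∀ α i, P α → P (α + Finsupp.single i 1)) (α : σ →₀ ℕ) : P α := by
  classical
  induction α using Finsupp.induction with
  | zero => exact h0
  | single_add a b f _ _ ih =>
    clear * - ih hs
    induction b with
    | zero => simpa using ih
    | succ n ihn =>
      rw [Finsupp.single_add, add_right_comm]
      exact hs _ _ ihn

theorem natCast_add_one_ne_zero (n : ℕ) : (n : ℂ) + 1 ≠ 0 := by exact_mod_cast n.succ_ne_zero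

theorem natCast_add_one_smul_cancel {M : Type} [AddCommGroup M] [Module ℂ M] (n : ℕ) {x y : M}
    (h : ((n : ℂ) + 1) • x = ((n : ℂ) + 1) • y) : x = y :=
  smul_right_injective M (natCast_add_one_ne_zero n) h

theorem sum_antidiagonal_prod_swap {M : Type} [AddCommMonoid M] [DecidableEq σ] (α : σ →₀ ℕ)
    (h : (σ →₀ ℕ) × (σ →₀ ℕ) → M) :
    ∑ p ∈ Finset.HasAntidiagonal.antidiagonal α, h p.swap =
      ∑ p ∈ Finset.HasAntidiagonal.antidiagonal α, h p :=
  Finset.sum_equiv (Equiv.prodComm _ _)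
    (fun p => by simp [Finset.HasAntidiagonal.mem_antidiagonal, add_comm]) fun _ _ => rfl

theorem sum_antidiagonal_smul_fst {M : Type} [AddCommGroup M] [Module ℂ M] [DecidableEq σ]
    (α : σ →₀ ℕ) (i : σ) (h : (σ →₀ ℕ) × (σ →₀ ℕ) → M) :
    ∑ p ∈ Finset.HasAntidiagonal.antidiagonal (α + (Finsupp.single i 1 : σ →₀ ℕ)),
      (p.1 i : ℂ) • h p =
      ∑ p ∈ Finset.HasAntidiagonal.antidiagonal α, ((p.1 i : ℂ) + 1) • h (p.1 + Finsupp.single i 1, p.2) := by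
  symm
  refine Finset.sum_of_injOn (fun p => (p.1 + Finsupp.single i 1, p.2)) ?_ ?_ ?_ ?_
  · rintro ⟨a, b⟩ _ ⟨a', b'⟩ _ hab
    simpa using hab
  · rintro ⟨a, b⟩ hab
    simp only [Finset.mem_coe,
      Finset.HasAntidiagonal.mem_antidiagonal] at hab ⊢
    rw [← hab, add_right_comm]
  · rintro ⟨a, b⟩ hab hni
    rw [Finset.HasAntidiagonal.mem_antidiagonal] at hab
    by_cases ha : a i = 0
    · simp [ha]
    · exfalso
      apply hni
      have hle : Finsupp.single i 1 ≤ a := by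
        rw [Finsupp.single_le_iff]; omega
      refine ⟨(a - Finsupp.single i 1, b), ?_, ?_⟩
      · simp only [Finset.mem_coe, Finset.HasAntidiagonal.mem_antidiagonal]
        apply add_right_cancel (b := Finsupp.single i 1)
        rw [add_right_comm, tsub_add_cancel_of_le hle]
        exact hab
      · simp [tsub_add_cancel_of_le hle]
  · rintro ⟨a, b⟩ _
    simp

theorem sum_antidiagonal_smul_snd {M : Type} [AddCommGroup M] [Module ℂ M] [DecidableEq σ]
    (α : σ →₀ ℕ) (i : σ) (h : (σ →₀ ℕ) × (σ →₀ ℕ) → M) :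
    ∑ p ∈ Finset.HasAntidiagonal.antidiagonal (α + (Finsupp.single i 1 : σ →₀ ℕ)),
      (p.2 i : ℂ) • h p =
      ∑ p ∈ Finset.HasAntidiagonal.antidiagonal α, ((p.2 i : ℂ) + 1) • h (p.1, p.2 + Finsupp.single i 1) := by
  rw [← sum_antidiagonal_prod_swap,
    ← sum_antidiagonal_prod_swap α fun p => ((p.2 i : ℂ) + 1) • h _]
  exact sum_antidiagonal_smul_fst α i fun p => h p.swap

theorem sum_antidiagonal_add_single {M : Type} [AddCommGroup M] [Module ℂ M] [DecidableEq σ]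
    (α : σ →₀ ℕ) (i : σ) (h : (σ →₀ ℕ) × (σ →₀ ℕ) → M) :
    ((α i : ℂ) + 1) • ∑ p ∈ Finset.HasAntidiagonal.antidiagonal (α + Finsupp.single i 1), h p =
      ∑ p ∈ Finset.HasAntidiagonal.antidiagonal α, ((p.1 i : ℂ) + 1) • h (p.1 + Finsupp.single i 1, p.2) +
      ∑ p ∈ Finset.HasAntidiagonal.antidiagonal α, ((p.2 i : ℂ) + 1) • h (p.1, p.2 + Finsupp.single i 1) := by
  rw [← sum_antidiagonal_smul_fst, ← sum_antidiagonal_smul_snd, ← Finset.sum_add_distrib,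
    Finset.smul_sum]
  refine Finset.sum_congr rfl fun p hp => ?_
  rw [Finset.HasAntidiagonal.mem_antidiagonal] at hp
  have : α i + 1 = p.1 i + p.2 i := by
    have := DFunLike.congr_fun hp i
    simpa using this.symm
  rw [← add_smul]
  congr 1
  exact_mod_cast this

theorem pDeriv_mul (i : σ) (f g : MvPowerSeries σ A) :
    pDeriv i (f * g) = pDeriv i f * g + f * pDeriv i g := by
  classical
  ext α
  rw [map_add, coeff_pDeriv, coeff_mul, coeff_mul, coeff_mul, sum_antidiagonal_add_single]
  simp only [coeff_pDeriv, smul_mul_assoc, mul_smul_comm]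

theorem pDeriv_C (i : σ) (a : A) : pDeriv i (C a : MvPowerSeries σ A) = 0 := by
  classical
  ext α
  rw [coeff_pDeriv, coeff_C, if_neg, smul_zero, map_zero]
  intro h
  have := DFunLike.congr_fun h i
  simp at this

theorem pDeriv_one (i : σ) : pDeriv i (1 : MvPowerSeries σ A) = 0 := pDeriv_C i 1

/-- The power rule needs `f` to commute with its derivative. -/
theorem pDeriv_pow (i : σ) (f : MvPowerSeries σ A) (h : Commute (pDeriv i f) f) (n : ℕ) :
    pDeriv i (f ^ (n + 1)) = ((n : ℂ) + 1) • (pDeriv i f * f ^ n) := by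
  induction n with
  | zero => simp
  | succ n ih =>
    rw [pow_succ, pDeriv_mul, ih, smul_mul_assoc, mul_assoc, ← pow_succ,
      ← (h.pow_right (n + 1)).eq, Nat.cast_succ, add_smul ((n : ℂ) + 1) 1, one_smul]

theorem coeff_pow_of_degree_lt {f : MvPowerSeries σ A} (hf : constantCoeff f = 0) {n : ℕ}
    {α : σ →₀ ℕ} (h : α.degree < n) : coeff α (f ^ n) = 0 :=
  coeff_of_lt_order (lt_of_lt_of_le (by exact_mod_cast h)
    (le_order_pow_of_constantCoeff_eq_zero n hf))

theorem coeff_expSeries (f : MvPowerSeries σ A) (α : σ →₀ ℕ) :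
    coeff α (expSeries f) = ∑ n ∈ Finset.range (α.degree + 1),
      ((n.factorial : ℂ)⁻¹) • coeff α (f ^ n) := rfl

/-- The truncation in the definition of `expSeries` may be taken at any later place. -/
theorem coeff_expSeries_of_le {f : MvPowerSeries σ A} (hf : constantCoeff f = 0) {α : σ →₀ ℕ}
    {m : ℕ} (hm : α.degree + 1 ≤ m) :
    coeff α (expSeries f) = ∑ n ∈ Finset.range m, ((n.factorial : ℂ)⁻¹) • coeff α (f ^ n) := by
  rw [coeff_expSeries]
  refine Finset.sum_subset (Finset.range_mono hm) fun n _ hn => ?_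
  rw [coeff_pow_of_degree_lt hf, smul_zero]
  simpa using hn

theorem coeff_zero_expSeries (f : MvPowerSeries σ A) : coeff 0 (expSeries f) = 1 := by
  rw [coeff_expSeries]
  simp

theorem pDeriv_expSeries (i : σ) {f : MvPowerSeries σ A} (hf : constantCoeff f = 0)
    (h : Commute (pDeriv i f) f) : pDeriv i (expSeries f) = pDeriv i f * expSeries f := by
  classical
  ext α
  have hdeg : (α + Finsupp.single i 1).degree = α.degree + 1 := by
    rw [map_add, Finsupp.degree_single]
  rw [coeff_pDeriv, coeff_expSeries, hdeg, Finset.sum_range_succ', smul_add, Finset.smul_sum]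
  have h0 : coeff (α + Finsupp.single i 1) (f ^ 0) = 0 := by
    have := congrArg (coeff α) (pDeriv_one (A := A) i)
    rw [coeff_pDeriv, map_zero] at this
    rw [pow_zero]
    exact natCast_add_one_smul_cancel (α i) (by rw [this, smul_zero])
  rw [h0, smul_zero, smul_zero, add_zero, coeff_mul]
  have hR : ∀ p ∈ Finset.HasAntidiagonal.antidiagonal α, coeff p.1 (pDeriv i f) * coeff p.2 (expSeries f) =
      ∑ n ∈ Finset.range (α.degree + 1), ((n.factorial : ℂ)⁻¹) •
        (coeff p.1 (pDeriv i f) * coeff p.2 (f ^ n)) := by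
    intro p hp
    rw [Finset.HasAntidiagonal.mem_antidiagonal] at hp
    have hle : p.2.degree + 1 ≤ α.degree + 1 := by
      rw [← hp, map_add]; omega
    rw [coeff_expSeries_of_le hf hle, Finset.mul_sum]
    simp only [mul_smul_comm]
  rw [Finset.sum_congr rfl hR, Finset.sum_comm]
  refine Finset.sum_congr rfl fun n _ => ?_
  rw [← Finset.smul_sum, ← coeff_mul, smul_comm, ← coeff_pDeriv, pDeriv_pow i f h,
    coeff_complex_smul, smul_smul]
  congr 1
  rw [Nat.factorial_succ]
  have := natCast_add_one_ne_zero n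
  push_cast
  field_simp

/-- Two series with the same constant term that solve the same linear system
`∂_i f = c_i f` agree. -/
theorem ext_of_pDeriv {f g : MvPowerSeries σ A} (c : σ → A) (h0 : coeff 0 f = coeff 0 g)
    (hf : ∀ i, pDeriv i f = C (c i) * f) (hg : ∀ i, pDeriv i g = C (c i) * g) : f = g := by
  ext α
  induction α using finsupp_induction_single_one with
  | h0 => exact h0
  | hs α i ih =>
    apply natCast_add_one_smul_cancel (α i)
    rw [← coeff_pDeriv, ← coeff_pDeriv, hf, hg, coeff_C_mul, coeff_C_mul, ih]

theorem coeff_linForm (c : σ → A) (α : σ →₀ ℕ) :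
    coeff α (linForm c) = if α.degree = 1 then α.sum fun i n => n • c i else 0 := rfl

theorem constantCoeff_linForm (c : σ → A) : constantCoeff (linForm c) = 0 := by
  rw [← coeff_zero_eq_constantCoeff_apply, coeff_linForm]
  simp

theorem pDeriv_linForm (i : σ) (c : σ → A) : pDeriv i (linForm c) = C (c i) := by
  classical
  ext α
  rw [coeff_pDeriv, coeff_linForm, coeff_C, map_add, Finsupp.degree_single]
  by_cases h : α = 0
  · subst h
    simp
  · have : α.degree ≠ 0 := by rwa [Ne, Finsupp.degree_eq_zero_iff]
    rw [if_neg (by omega), if_neg h, smul_zero]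

theorem linForm_smul (z : ℂ) (c : σ → A) : linForm (z • c) = z • linForm c := by
  ext α
  change coeff α (linForm (z • c)) = z • coeff α (linForm c)
  rw [coeff_linForm, coeff_linForm]
  split_ifs
  · rw [Finsupp.smul_sum]
    simp only [Pi.smul_apply, smul_comm z]
  · simp

theorem linForm_neg (c : σ → A) : linForm (-c) = -linForm c := by
  rw [← neg_one_smul ℂ c, linForm_smul, neg_one_smul]

theorem commute_C_linForm {a : A} {c : σ → A} (h : ∀ i, Commute a (c i)) :
    Commute (C a) (linForm c) := by
  ext α
  rw [coeff_C_mul, coeff_mul_C, coeff_linForm]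
  split_ifs
  · exact Commute.sum_right _ _ _ fun i _ => (h i).smul_right _
  · simp

/-- The exponential of a linear form in the times. -/
def linExp (c : σ → A) : MvPowerSeries σ A := expSeries (linForm c)

theorem coeff_zero_linExp (c : σ → A) : coeff 0 (linExp c) = 1 := coeff_zero_expSeries _

theorem pDeriv_linExp {c : σ → A} (h : ∀ i j, Commute (c i) (c j)) (i : σ) :
    pDeriv i (linExp c) = C (c i) * linExp c := by
  rw [linExp, pDeriv_expSeries i (constantCoeff_linForm c), pDeriv_linForm]
  rw [pDeriv_linForm]
  exact commute_C_linForm (h i)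

theorem coeff_linExp_add_single {c : σ → A} (h : ∀ i j, Commute (c i) (c j)) (i : σ)
    (α : σ →₀ ℕ) : ((α i : ℂ) + 1) • coeff (α + Finsupp.single i 1) (linExp c) =
      c i * coeff α (linExp c) := by
  rw [← coeff_pDeriv, pDeriv_linExp h, coeff_C_mul]

theorem linExp_zero : linExp (0 : σ → A) = 1 := by
  refine ext_of_pDeriv 0 ?_ (fun i => ?_) (fun i => ?_)
  · rw [coeff_zero_linExp, coeff_zero_one]
  · exact pDeriv_linExp (fun i j => Commute.zero_left _) i
  · simp [pDeriv_one]

/-- Intertwining: if `x c_i = c'_i x` for all `i`, then `x` carries `exp (∑ c_i i)` to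
`exp (∑ c'_i i)`. -/
theorem mul_coeff_linExp {c c' : σ → A} (h : ∀ i j, Commute (c i) (c j))
    (h' : ∀ i j, Commute (c' i) (c' j)) {x : A} (hx : ∀ i, x * c i = c' i * x) (α : σ →₀ ℕ) :
    x * coeff α (linExp c) = coeff α (linExp c') * x := by
  induction α using finsupp_induction_single_one with
  | h0 => simp only [coeff_zero_linExp, mul_one, one_mul]
  | hs α i ih =>
    apply natCast_add_one_smul_cancel (α i)
    rw [← mul_smul_comm, ← smul_mul_assoc, coeff_linExp_add_single h,
      coeff_linExp_add_single h', ← mul_assoc, hx, mul_assoc, ih, mul_assoc]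

theorem C_mul_linExp {c c' : σ → A} (h : ∀ i j, Commute (c i) (c j))
    (h' : ∀ i j, Commute (c' i) (c' j)) {x : A} (hx : ∀ i, x * c i = c' i * x) :
    C x * linExp c = linExp c' * C x := by
  ext α
  rw [coeff_C_mul, coeff_mul_C, mul_coeff_linExp h h' hx]

theorem commute_coeff_linExp {c : σ → A} (h : ∀ i j, Commute (c i) (c j)) {x : A}
    (hx : ∀ i, Commute x (c i)) (α : σ →₀ ℕ) : Commute x (coeff α (linExp c)) :=
  mul_coeff_linExp h h hx α

theorem commute_linExp {c : σ → A} (h : ∀ i j, Commute (c i) (c j)) {f : MvPowerSeries σ A}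
    (hf : ∀ α i, Commute (coeff α f) (c i)) : Commute f (linExp c) := by
  classical
  ext α
  rw [coeff_mul, coeff_mul, ← sum_antidiagonal_prod_swap]
  exact Finset.sum_congr rfl fun p _ => commute_coeff_linExp h (hf _) _

theorem linExp_add {c d : σ → A} (hc : ∀ i j, Commute (c i) (c j))
    (hd : ∀ i j, Commute (d i) (d j)) (hcd : ∀ i j, Commute (c i) (d j)) :
    linExp (c + d) = linExp c * linExp d := by
  refine ext_of_pDeriv (c + d) ?_ (fun i => ?_) (fun i => ?_)
  · have h := map_mul (constantCoeff (σ := σ) (R := A)) (linExp c) (linExp d)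
    simp only [← coeff_zero_eq_constantCoeff_apply, coeff_zero_linExp, mul_one] at h
    rw [coeff_zero_linExp, h]
  · refine pDeriv_linExp (fun i j => ?_) i
    exact ((hc i j).add_left (hcd j i).symm).add_right ((hcd i j).add_left (hd i j))
  · have hC : Commute (C (d i)) (linExp c) := commute_linExp hc fun α j => by
      classical
      rw [coeff_C]
      split_ifs
      · exact (hcd j i).symm
      · exact Commute.zero_left _
    rw [pDeriv_mul, pDeriv_linExp hc, pDeriv_linExp hd, Pi.add_apply, map_add, add_mul,
      mul_assoc, ← mul_assoc (linExp c), ← hC.eq, mul_assoc]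

theorem linExp_mul_linExp_neg {c : σ → A} (hc : ∀ i j, Commute (c i) (c j)) :
    linExp c * linExp (-c) = 1 := by
  rw [← linExp_add (d := -c) hc (fun i j => (hc i j).neg_left.neg_right)
    (fun i j => (hc i j).neg_right), add_neg_cancel, linExp_zero]

end Formal

/-! ### Laurent series over a noncommutative ring -/

section Laurent

variable {R : Type} [Ring R]

theorem support_coeff_mul_coeff_subset (x y : LaurentSeries R) (a : ℤ) :
    (Function.support fun n => x.coeff n * y.coeff (a - n)) ⊆
      ((Finset.antidiagonal x.isPWO_support y.isPWO_support a).image Prod.fst : Finset ℤ) := by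
  intro n hn
  rw [Function.mem_support] at hn
  simp only [Finset.coe_image, Set.mem_image, Finset.mem_coe]
  refine ⟨(n, a - n), Finset.mem_antidiagonal.2 ⟨?_, ?_, by simp⟩, rfl⟩
  · exact fun h => hn (by rw [h, zero_mul])
  · exact fun h => hn (by rw [h, mul_zero])

theorem coeff_mul_eq_finsum (x y : LaurentSeries R) (a : ℤ) :
    (x * y).coeff a = ∑ᶠ n, x.coeff n * y.coeff (a - n) := by
  rw [HahnSeries.coeff_mul,
    finsum_eq_sum_of_support_subset _ (support_coeff_mul_coeff_subset x y a)]
  have hD : ∀ p ∈ Finset.antidiagonal x.isPWO_support y.isPWO_support a, p.2 = a - p.1 :=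
    fun p hp => by
      have : p.1 + p.2 = a := (Finset.mem_antidiagonal.1 hp).2.2
      omega
  rw [Finset.sum_image]
  · exact Finset.sum_congr rfl fun p hp => by rw [hD p hp]
  · intro p hp q hq h
    exact Prod.ext h (by rw [hD p hp, hD q hq, h])

theorem finite_support_coeff_mul_coeff (x y : LaurentSeries R) (a : ℤ) :
    (Function.support fun n => x.coeff n * y.coeff (a - n)).Finite :=
  (Finset.finite_toSet _).subset (support_coeff_mul_coeff_subset x y a)

/-- The Laurent series `a` in `Λ⁻¹` and `b` in `Λ` have the same coefficient at each power of
`Λ`; both are then expansions of one Laurent polynomial. -/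
def LaurentMatch (a b : LaurentSeries R) : Prop := ∀ m, a.coeff (-m) = b.coeff m

namespace LaurentMatch

variable {a b c d : LaurentSeries R}

theorem zero : LaurentMatch (0 : LaurentSeries R) 0 := fun _ => rfl

theorem add (h : LaurentMatch a b) (h' : LaurentMatch c d) : LaurentMatch (a + c) (b + d) :=
  fun m => congrArg₂ (· + ·) (h m) (h' m)

theorem mul (h : LaurentMatch a b) (h' : LaurentMatch c d) : LaurentMatch (a * c) (b * d) := by
  intro m
  rw [coeff_mul_eq_finsum, coeff_mul_eq_finsum, ← finsum_comp_equiv (Equiv.neg ℤ)]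
  refine finsum_congr fun n => ?_
  rw [Equiv.neg_apply, h, ← h', neg_sub_neg, neg_sub]

theorem sum {ι : Type} (s : Finset ι) {f g : ι → LaurentSeries R}
    (h : ∀ i ∈ s, LaurentMatch (f i) (g i)) :
    LaurentMatch (∑ i ∈ s, f i) (∑ i ∈ s, g i) := by
  classical
  induction s using Finset.induction_on with
  | empty => simpa using zero
  | insert i s hi ih =>
    rw [Finset.sum_insert hi, Finset.sum_insert hi]
    exact (h i (Finset.mem_insert_self i s)).add
      (ih fun j hj => h j (Finset.mem_insert_of_mem hj))

theorem smul [Algebra ℂ R] (z : ℂ) (h : LaurentMatch a b) : LaurentMatch (z • a) (z • b) :=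
  fun m => congrArg (z • ·) (h m)

theorem single_zero (x : R) : LaurentMatch (HahnSeries.single 0 x) (HahnSeries.single 0 x) := by
  intro m
  rw [HahnSeries.coeff_single, HahnSeries.coeff_single]
  simp

end LaurentMatch

theorem coeff_mul_of_lt {x y : LaurentSeries R} {k l : ℤ} (hx : ∀ n < k, x.coeff n = 0)
    (hy : ∀ n < l, y.coeff n = 0) {n : ℤ} (hn : n < k + l) : (x * y).coeff n = 0 := by
  rw [coeff_mul_eq_finsum]
  refine finsum_eq_zero_of_forall_eq_zero fun m => ?_
  by_cases h : m < k
  · rw [hx m h, zero_mul]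
  · rw [hy _ (by omega), mul_zero]

theorem coeff_mul_add_of_lt {x y : LaurentSeries R} {k l : ℤ} (hx : ∀ n < k, x.coeff n = 0)
    (hy : ∀ n < l, y.coeff n = 0) : (x * y).coeff (k + l) = x.coeff k * y.coeff l := by
  rw [coeff_mul_eq_finsum, finsum_eq_single _ k, add_sub_cancel_left]
  intro m hm
  rcases lt_or_gt_of_ne hm with h | h
  · rw [hx m h, zero_mul]
  · rw [hy _ (by omega), mul_zero]

theorem exists_coeff_lt_eq_zero (x : LaurentSeries R) : ∃ k : ℤ, ∀ n < k, x.coeff n = 0 :=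
  ⟨x.order, fun _ h => HahnSeries.coeff_eq_zero_of_lt_order h⟩

end Laurent

/-! ### Matrix difference operators coefficientwise -/

section OpBasics

open MvPowerSeries

variable {N : ℕ}

/-- The coefficient of a matrix difference operator at a monomial in the times. -/
def coeffMat (α : Time N →₀ ℕ) (F : Op N) : Matrix (Fin N) (Fin N) (LaurentSeries Oper) :=
  F.map (coeff α)

theorem coeffMat_apply (α : Time N →₀ ℕ) (F : Op N) (i j : Fin N) :
    coeffMat α F i j = coeff α (F i j) := rfl

theorem Op.ext_coeffMat {F G : Op N} (h : ∀ α, coeffMat α F = coeffMat α G) : F = G := by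
  ext i j α : 3
  exact congrArg HahnSeries.coeff (congrFun (congrFun (h α) i) j)

theorem coeffMat_mul [DecidableEq (Time N)] (α : Time N →₀ ℕ) (F G : Op N) :
    coeffMat α (F * G) = ∑ p ∈ Finset.HasAntidiagonal.antidiagonal α,
      coeffMat p.1 F * coeffMat p.2 G := by
  ext1 i j
  rw [coeffMat_apply, Matrix.mul_apply, map_sum, Matrix.sum_apply]
  simp only [coeff_mul, Matrix.mul_apply, coeffMat_apply]
  rw [Finset.sum_comm]

theorem coeffMat_zero_mul (F G : Op N) :
    coeffMat 0 (F * G) = coeffMat 0 F * coeffMat 0 G := by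
  classical
  rw [coeffMat_mul, Finset.sum_eq_single_of_mem (0, 0)]
  · simp
  · rintro ⟨a, b⟩ hab hne
    exfalso
    rw [Finset.HasAntidiagonal.mem_antidiagonal] at hab
    simp only [add_eq_zero] at hab
    exact hne (by rw [hab.1, hab.2])

theorem coeffMat_dTime (i : Time N) (α : Time N →₀ ℕ) (F : Op N) :
    coeffMat α (dTime i F) = ((α i : ℂ) + 1) • coeffMat (α + Finsupp.single i 1) F := rfl

theorem dTime_mul (i : Time N) (F G : Op N) :
    dTime i (F * G) = dTime i F * G + F * dTime i G := by
  ext1 a b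
  change pDeriv i ((F * G) a b) = (dTime i F * G) a b + (F * dTime i G) a b
  rw [Matrix.mul_apply, Matrix.mul_apply, Matrix.mul_apply, map_sum, ← Finset.sum_add_distrib]
  exact Finset.sum_congr rfl fun _ _ => pDeriv_mul _ _ _

theorem dTime_one (i : Time N) : dTime i (1 : Op N) = 0 := by
  ext1 a b
  change pDeriv i ((1 : Op N) a b) = 0
  rw [Matrix.one_apply]
  split_ifs
  · exact pDeriv_one i
  · exact map_zero _

/-- Matrix version of `LaurentMatch`. -/
def MatrixMatch (a b : Matrix (Fin N) (Fin N) (LaurentSeries Oper)) : Prop :=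
  ∀ i j, LaurentMatch (a i j) (b i j)

namespace MatrixMatch

variable {a b c d : Matrix (Fin N) (Fin N) (LaurentSeries Oper)}

theorem mul (h : MatrixMatch a b) (h' : MatrixMatch c d) : MatrixMatch (a * c) (b * d) :=
  fun i j => by
    rw [Matrix.mul_apply, Matrix.mul_apply]
    exact .sum _ fun k _ => (h i k).mul (h' k j)

theorem smul (z : ℂ) (h : MatrixMatch a b) : MatrixMatch (z • a) (z • b) :=
  fun i j => (h i j).smul z

theorem of_smul {z : ℂ} (hz : z ≠ 0) (h : MatrixMatch (z • a) (z • b)) : MatrixMatch a b := by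
  have := h.smul z⁻¹
  rwa [inv_smul_smul₀ hz, inv_smul_smul₀ hz] at this

theorem sum {ι : Type} (s : Finset ι)
    {f g : ι → Matrix (Fin N) (Fin N) (LaurentSeries Oper)}
    (h : ∀ i ∈ s, MatrixMatch (f i) (g i)) : MatrixMatch (∑ i ∈ s, f i) (∑ i ∈ s, g i) :=
  fun a b => by
    rw [Matrix.sum_apply, Matrix.sum_apply]
    exact .sum s fun i hi => h i hi a b

end MatrixMatch

/-- Two difference operators, the first one recorded in powers of `Λ⁻¹` and the second one in
powers of `Λ`, have the same homogeneous terms. -/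
def OpMatch (F G : Op N) : Prop := term (-1) F = term 1 G

theorem opMatch_iff {F G : Op N} :
    OpMatch F G ↔ ∀ α, MatrixMatch (coeffMat α F) (coeffMat α G) := by
  constructor
  · intro h α i j m
    have := congrArg (coeff α) (congrFun (congrFun (congrFun h m) i) j)
    change (coeff α (F i j)).coeff (-1 * m) = (coeff α (G i j)).coeff (1 * m) at this
    rwa [neg_one_mul, one_mul] at this
  · intro h
    ext m i j α : 4
    change (coeff α (F i j)).coeff (-1 * m) = (coeff α (G i j)).coeff (1 * m)
    rw [neg_one_mul, one_mul]
    exact h α i j m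

namespace OpMatch

variable {F G F' G' : Op N}

theorem coeff_eq (h : OpMatch F G) (i j : Fin N) (α : Time N →₀ ℕ) (m : ℤ) :
    (coeff α (F i j)).coeff (-m) = (coeff α (G i j)).coeff m := opMatch_iff.1 h α i j m

theorem smul (z : ℂ) (h : OpMatch F G) : OpMatch (z • F) (z • G) :=
  opMatch_iff.2 fun α => (opMatch_iff.1 h α).smul z

theorem neg (h : OpMatch F G) : OpMatch (-F) (-G) := by
  have := h.smul (-1)
  rwa [neg_one_smul, neg_one_smul] at this

theorem mul (h : OpMatch F G) (h' : OpMatch F' G') : OpMatch (F * F') (G * G') := by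
  classical
  refine opMatch_iff.2 fun α => ?_
  rw [coeffMat_mul, coeffMat_mul]
  exact .sum _ fun p _ => (opMatch_iff.1 h _).mul (opMatch_iff.1 h' _)

theorem one : OpMatch (1 : Op N) 1 := by
  classical
  change term (-1) (1 : Op N) = term 1 (1 : Op N)
  ext m i j α : 4
  change (coeff α ((1 : Op N) i j)).coeff (-1 * m) = (coeff α ((1 : Op N) i j)).coeff (1 * m)
  rw [Matrix.one_apply]
  split_ifs
  · rw [coeff_one]
    split_ifs
    · rw [HahnSeries.coeff_one, HahnSeries.coeff_one]
      simp
    · rfl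
  · rfl

theorem pow (h : OpMatch F G) (n : ℕ) : OpMatch (F ^ n) (G ^ n) := by
  induction n with
  | zero => simpa using one
  | succ n ih => rw [pow_succ, pow_succ]; exact ih.mul h

end OpMatch

/-- The operator contains no power of the marker below `k`. -/
def OrderGE (k : ℤ) (F : Op N) : Prop :=
  ∀ i j α, ∀ n < k, (coeff α (F i j)).coeff n = 0

theorem OrderGE.mul {k l : ℤ} {F G : Op N} (hF : OrderGE k F) (hG : OrderGE l G) :
    OrderGE (k + l) (F * G) := by
  classical
  intro i j α n hn
  rw [Matrix.mul_apply, map_sum, HahnSeries.coeff_sum]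
  refine Finset.sum_eq_zero fun m _ => ?_
  rw [coeff_mul, HahnSeries.coeff_sum]
  exact Finset.sum_eq_zero fun p _ => coeff_mul_of_lt (hF _ _ _) (hG _ _ _) hn

theorem term_zero_mul {u : ℤ} {F G : Op N} (hF : OrderGE 0 F) (hG : OrderGE 0 G) :
    term u (F * G) 0 = term u F 0 * term u G 0 := by
  classical
  ext i j α : 3
  change (coeff α ((F * G) i j)).coeff (u * 0) = coeff α ((term u F 0 * term u G 0) i j)
  rw [Matrix.mul_apply, Matrix.mul_apply, map_sum, map_sum, HahnSeries.coeff_sum, mul_zero]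
  refine Finset.sum_congr rfl fun m _ => ?_
  rw [coeff_mul, coeff_mul, HahnSeries.coeff_sum]
  refine Finset.sum_congr rfl fun p _ => ?_
  have := coeff_mul_add_of_lt (hF i m p.1) (hG m j p.2)
  rw [add_zero] at this
  rw [this]
  change _ = (coeff p.1 (F i m)).coeff (u * 0) * (coeff p.2 (G m j)).coeff (u * 0)
  rw [mul_zero]

theorem term_zero_one (u : ℤ) : term u (1 : Op N) 0 = 1 := by
  classical
  ext i j α : 3
  change (coeff α ((1 : Op N) i j)).coeff (u * 0) = coeff α ((1 : TMat N Oper) i j)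
  rw [Matrix.one_apply, Matrix.one_apply, mul_zero]
  split_ifs
  · rw [coeff_one, coeff_one]
    split_ifs
    · exact HahnSeries.coeff_single_same _ _
    · rfl
  · rfl

theorem orderGE_one : OrderGE 0 (1 : Op N) := by
  classical
  intro i j α n hn
  rw [Matrix.one_apply]
  split_ifs
  · rw [coeff_one]
    split_ifs
    · exact HahnSeries.coeff_single_of_ne (by omega)
    · rfl
  · rfl

/-- An operator without positive powers of `Λ` that matches one without negative powers reduces to
its term at `Λ^0`; if that term is `1`, both operators are `1`. -/
theorem OpMatch.eq_one {F G : Op N} (h : OpMatch F G) (hF : OrderGE 0 F) (hG : OrderGE 0 G)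
    (h0 : term 1 F 0 = 1) : F = 1 ∧ G = 1 := by
  have key : ∀ H : Op N, (∀ i j α, ∀ n ≠ 0, (coeff α (H i j)).coeff n = 0) →
      term 1 H 0 = 1 → H = 1 := by
    intro H hH hH0
    ext i j α n
    by_cases hn : n = 0
    · have h1 := congrArg (coeff α) (congrFun (congrFun (hH0.trans (term_zero_one 1).symm) i) j)
      subst hn
      exact h1
    · rw [hH i j α n hn]
      rcases lt_or_gt_of_ne hn with h' | h'
      · rw [orderGE_one i j α n h']
      · have := OpMatch.one.coeff_eq i j α (-n)
        rw [neg_neg] at this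
        rw [this, orderGE_one i j α (-n) (by omega)]
  refine ⟨key F (fun i j α n hn => ?_) h0, key G (fun i j α n hn => ?_) ?_⟩
  · rcases lt_or_gt_of_ne hn with h' | h'
    · exact hF i j α n h'
    · have := h.coeff_eq i j α (-n)
      rw [neg_neg] at this
      rw [this, hG i j α (-n) (by omega)]
  · rcases lt_or_gt_of_ne hn with h' | h'
    · exact hG i j α n h'
    · rw [← h.coeff_eq, hF i j α (-n) (by omega)]
  · rw [← h0]
    ext i j α : 3
    have := h.coeff_eq i j α 0
    rw [neg_zero] at this
    exact this.symm

/-- An operator without negative powers of the marker whose leading coefficient at zero times is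
invertible is not a right zero divisor. -/
theorem eq_zero_of_mul_eq_zero {E T : Op N} (hT : OrderGE 0 T)
    (x : Matrix (Fin N) (Fin N) Oper) (hx : (term 1 T 0).map (coeff 0) * x = 1)
    (h : E * T = 0) : E = 0 := by
  classical
  -- In one variable: the lowest coefficient of `e` is multiplied by the leading coefficient of `T`.
  have hlevel : ∀ e : Matrix (Fin N) (Fin N) (LaurentSeries Oper), e * coeffMat 0 T = 0 →
      e = 0 := by
    intro e he
    have hk : ∃ k : ℤ, ∀ i j, ∀ n < k, (e i j).coeff n = 0 := by
      choose f hf using fun p : Fin N × Fin N => exists_coeff_lt_eq_zero (e p.1 p.2)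
      obtain ⟨k, hk⟩ := (Set.finite_range f).bddBelow
      exact ⟨k, fun i j n hn => hf (i, j) n (lt_of_lt_of_le hn (hk ⟨(i, j), rfl⟩))⟩
    obtain ⟨k, hk⟩ := hk
    have hall : ∀ m : ℕ, ∀ i j, ∀ n < k + m, (e i j).coeff n = 0 := by
      intro m
      induction m with
      | zero => simpa using hk
      | succ m ih =>
        have hmat : (Matrix.of fun i j => (e i j).coeff (k + m)) *
            (term 1 T 0).map (coeff 0) = 0 := by
          ext i j
          have h1 := congrArg (fun z : LaurentSeries Oper => z.coeff (k + m))
            (congrFun (congrFun he i) j)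
          simp only [Matrix.mul_apply, HahnSeries.coeff_sum, Matrix.zero_apply,
            HahnSeries.coeff_zero] at h1
          rw [Matrix.mul_apply, Matrix.zero_apply, ← h1]
          refine Finset.sum_congr rfl fun l _ => ?_
          have h2 := coeff_mul_add_of_lt (ih i l) (hT l j 0)
          rw [add_zero] at h2
          exact h2.symm
        have hz : (Matrix.of fun i j => (e i j).coeff (k + m)) = 0 := by
          rw [← mul_one (Matrix.of _), ← hx, ← mul_assoc, hmat, zero_mul]
        intro i j n hn
        rcases lt_or_eq_of_le (show n ≤ k + m by push_cast at hn; omega) with h' | h'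
        · exact ih i j n h'
        · rw [h']
          exact congrFun (congrFun hz i) j
    ext i j n
    exact hall (n - k + 1).toNat i j n (by omega)
  -- Among the coefficients of `E` of lowest degree in the times, only `T` at zero times matters.
  suffices ∀ d : ℕ, ∀ α : Time N →₀ ℕ, α.degree < d → coeffMat α E = 0 by
    refine Op.ext_coeffMat fun α => ?_
    rw [this _ α (Nat.lt_succ_self _)]
    rfl
  intro d
  induction d with
  | zero => intro α hα; omega
  | succ d ih =>
    intro α hα
    apply hlevel
    have h1 : coeffMat α (E * T) = 0 := by rw [h]; rfl
    rw [coeffMat_mul, Finset.sum_eq_single_of_mem (α, 0)] at h1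
    · exact h1
    · simp
    · rintro ⟨b, c⟩ hbc hne
      rw [Finset.HasAntidiagonal.mem_antidiagonal] at hbc
      have hc : c ≠ 0 := by
        rintro rfl
        exact hne (by rw [← hbc, add_zero])
      have : c.degree ≠ 0 := by rwa [Ne, Finsupp.degree_eq_zero_iff]
      have hdeg : b.degree + c.degree = α.degree := by rw [← map_add]; exact congrArg _ hbc
      rw [ih b (by omega), zero_mul]

end OpBasics

/-! ### Wave operators and bilinear equations -/

section Bilinear

open MvPowerSeries

variable {N : ℕ}

/-- The diagonal matrix operator `exp (∑_p c_k(p) p)`, `k` being the index of the diagonal entry. -/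
def waveExp (c : Fin N → Time N → LaurentSeries Oper) : Op N :=
  Matrix.diagonal fun k => linExp (c k)

/-- The logarithmic derivative of `waveExp c` with respect to the time `p`. -/
def waveGen (c : Fin N → Time N → LaurentSeries Oper) (p : Time N) : Op N :=
  Matrix.diagonal fun k => C (c k p)

theorem coeffMat_zero_waveExp (c : Fin N → Time N → LaurentSeries Oper) :
    coeffMat 0 (waveExp c) = 1 := by
  ext1 i j
  rw [coeffMat_apply, waveExp, Matrix.diagonal_apply, Matrix.one_apply]
  split_ifs
  · exact coeff_zero_linExp _
  · rfl

section WaveExp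

variable {c : Fin N → Time N → LaurentSeries Oper} (hc : ∀ k p q, Commute (c k p) (c k q))
include hc

theorem dTime_waveExp (p : Time N) : dTime p (waveExp c) = waveGen c p * waveExp c := by
  rw [waveExp, waveGen, Matrix.diagonal_mul_diagonal]
  ext1 i j
  change pDeriv p (Matrix.diagonal _ i j) = _
  rw [Matrix.diagonal_apply, Matrix.diagonal_apply]
  split_ifs
  · exact pDeriv_linExp (hc i) p
  · exact map_zero _

theorem waveExp_mul_neg : waveExp c * waveExp (-c) = 1 := by
  rw [waveExp, waveExp, Matrix.diagonal_mul_diagonal, ← Matrix.diagonal_one]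
  congr 1
  ext1 k
  exact linExp_mul_linExp_neg (hc k)

theorem commute_neg_waveCoeff (k : Fin N) (p q : Time N) : Commute ((-c) k p) ((-c) k q) :=
  (hc k p q).neg_left.neg_right

theorem commute_waveGen_waveExp (p : Time N) : Commute (waveGen c p) (waveExp c) := by
  classical
  rw [Commute, SemiconjBy, waveExp, waveGen, Matrix.diagonal_mul_diagonal,
    Matrix.diagonal_mul_diagonal]
  congr 1
  ext1 k
  refine (commute_linExp (hc k) fun α q => ?_).eq
  rw [coeff_C]
  split_ifs
  · exact hc k p q
  · exact Commute.zero_left _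

theorem dTime_waveExp_neg (p : Time N) :
    dTime p (waveExp (-c)) = -(waveExp (-c) * waveGen c p) := by
  have hneg : waveGen (-c) p = -waveGen c p := by
    rw [waveGen, waveGen, Matrix.diagonal_neg]
    congr 1
    ext1 k
    exact map_neg C (c k p)
  have h := commute_waveGen_waveExp (commute_neg_waveCoeff hc) p
  rw [dTime_waveExp (commute_neg_waveCoeff hc), h.eq, hneg, mul_neg]

end WaveExp

/-- `Λ^j` as a matrix of Laurent series in the marker. -/
def shiftMat (ε : ℝ) (u j : ℤ) : Matrix (Fin N) (Fin N) (LaurentSeries Oper) :=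
  Matrix.diagonal fun _ => HahnSeries.single (u * j) (shiftBy ((j : ℝ) * ε))

theorem coeffMat_mul_shiftOp (ε : ℝ) (u j : ℤ) (F : Op N) (α : Time N →₀ ℕ) :
    coeffMat α (F * shiftOp ε u j) = coeffMat α F * shiftMat ε u j := by
  ext1 a b
  rw [coeffMat_apply, shiftOp, shiftMat, Matrix.mul_diagonal, Matrix.mul_diagonal, coeff_mul_C]
  rfl

/-- The bilinear equations `W(t) Λ^r V(t') = W̄(t) Λ^{-r} V̄(t')`, `r ≥ 0`, coefficientwise in the
two independent sets of times. -/
def Bilinear (ε : ℝ) (W V Wb Vb : Op N) : Prop :=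
  ∀ (r : ℕ) (α β : Time N →₀ ℕ),
    MatrixMatch (coeffMat α W * shiftMat ε (-1) r * coeffMat β V)
      (coeffMat α Wb * shiftMat ε 1 (-r) * coeffMat β Vb)

namespace Bilinear

variable {ε : ℝ} {W V Wb Vb : Op N}

theorem diag (h : Bilinear ε W V Wb Vb) (r : ℕ) :
    OpMatch (W * shiftOp ε (-1) r * V) (Wb * shiftOp ε 1 (-r) * Vb) := by
  classical
  refine opMatch_iff.2 fun α => ?_
  rw [coeffMat_mul, coeffMat_mul]
  refine .sum _ fun p _ => ?_
  rw [coeffMat_mul_shiftOp, coeffMat_mul_shiftOp]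
  exact h r p.1 p.2

theorem dTime_left (h : Bilinear ε W V Wb Vb) (p : Time N) :
    Bilinear ε (dTime p W) V (dTime p Wb) Vb := by
  intro r α β
  rw [coeffMat_dTime, coeffMat_dTime, Matrix.smul_mul, Matrix.smul_mul, Matrix.smul_mul,
    Matrix.smul_mul]
  exact (h r _ β).smul _

theorem mul_left (h : Bilinear ε W V Wb Vb) {A B : Op N} (hAB : OpMatch A B) :
    Bilinear ε (A * W) V (B * Wb) Vb := by
  classical
  intro r α β
  rw [coeffMat_mul, coeffMat_mul, Finset.sum_mul, Finset.sum_mul, Finset.sum_mul,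
    Finset.sum_mul]
  refine .sum _ fun p _ => ?_
  simp only [mul_assoc]
  refine (opMatch_iff.1 hAB p.1).mul ?_
  simp only [← mul_assoc]
  exact h r _ _

theorem mul_right (h : Bilinear ε W V Wb Vb) {A B : Op N} (hAB : OpMatch A B) :
    Bilinear ε W (V * A) Wb (Vb * B) := by
  classical
  intro r α β
  rw [coeffMat_mul, coeffMat_mul, Finset.mul_sum, Finset.mul_sum]
  refine .sum _ fun p _ => ?_
  simp only [← mul_assoc]
  exact (h r _ _).mul (opMatch_iff.1 hAB p.2)

end Bilinear

theorem exists_eq_add_single {σ : Type} {α : σ →₀ ℕ} (h : α ≠ 0) :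
    ∃ (i : σ) (β : σ →₀ ℕ), α = β + Finsupp.single i 1 := by
  obtain ⟨i, hi⟩ := DFunLike.ne_iff.1 h
  refine ⟨i, α - Finsupp.single i 1, (tsub_add_cancel_of_le ?_).symm⟩
  rw [Finsupp.single_le_iff]
  exact Nat.one_le_iff_ne_zero.2 hi

/-- Solutions of two linear systems in the times with matching coefficients match as soon as
their values at zero times do. -/
theorem matrixMatch_of_system_left {W Wb : Op N} {A B : Time N → Op N}
    (hAB : ∀ p, OpMatch (A p) (B p)) (hW : ∀ p, dTime p W = A p * W)
    (hWb : ∀ p, dTime p Wb = B p * Wb) (y z : Matrix (Fin N) (Fin N) (LaurentSeries Oper))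
    (h0 : MatrixMatch (coeffMat 0 W * y) (coeffMat 0 Wb * z)) (α : Time N →₀ ℕ) :
    MatrixMatch (coeffMat α W * y) (coeffMat α Wb * z) := by
  classical
  suffices ∀ d : ℕ, ∀ α : Time N →₀ ℕ, α.degree ≤ d →
      MatrixMatch (coeffMat α W * y) (coeffMat α Wb * z) from this _ α le_rfl
  intro d
  induction d with
  | zero =>
    intro α hα
    rw [Nat.le_zero, Finsupp.degree_eq_zero_iff] at hα
    rwa [hα]
  | succ d ih =>
    intro α hα
    rcases eq_or_ne α 0 with rfl | hne
    · exact h0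
    obtain ⟨p, β, rfl⟩ := exists_eq_add_single hne
    rw [map_add, Finsupp.degree_single] at hα
    refine .of_smul (natCast_add_one_ne_zero (β p)) ?_
    rw [← Matrix.smul_mul, ← Matrix.smul_mul, ← coeffMat_dTime, ← coeffMat_dTime, hW, hWb,
      coeffMat_mul, coeffMat_mul, Finset.sum_mul, Finset.sum_mul]
    refine .sum _ fun q hq => ?_
    rw [Finset.HasAntidiagonal.mem_antidiagonal] at hq
    rw [mul_assoc, mul_assoc]
    refine (opMatch_iff.1 (hAB p) q.1).mul (ih q.2 ?_)
    have : q.1.degree + q.2.degree = β.degree := by rw [← map_add, hq]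
    omega

/-- The version of `matrixMatch_of_system_left` for the adjoint systems. -/
theorem matrixMatch_of_system_right {V Vb : Op N} {A B : Time N → Op N}
    (hAB : ∀ p, OpMatch (A p) (B p)) (hV : ∀ p, dTime p V = -(V * A p))
    (hVb : ∀ p, dTime p Vb = -(Vb * B p)) (y z : Matrix (Fin N) (Fin N) (LaurentSeries Oper))
    (h0 : MatrixMatch (y * coeffMat 0 V) (z * coeffMat 0 Vb)) (α : Time N →₀ ℕ) :
    MatrixMatch (y * coeffMat α V) (z * coeffMat α Vb) := by
  classical
  suffices ∀ d : ℕ, ∀ α : Time N →₀ ℕ, α.degree ≤ d →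
      MatrixMatch (y * coeffMat α V) (z * coeffMat α Vb) from this _ α le_rfl
  intro d
  induction d with
  | zero =>
    intro α hα
    rw [Nat.le_zero, Finsupp.degree_eq_zero_iff] at hα
    rwa [hα]
  | succ d ih =>
    intro α hα
    rcases eq_or_ne α 0 with rfl | hne
    · exact h0
    obtain ⟨p, β, rfl⟩ := exists_eq_add_single hne
    rw [map_add, Finsupp.degree_single] at hα
    refine .of_smul (natCast_add_one_ne_zero (β p)) ?_
    rw [← Matrix.mul_smul, ← Matrix.mul_smul, ← coeffMat_dTime, ← coeffMat_dTime, hV, hVb,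
      ← mul_neg, ← mul_neg, coeffMat_mul, coeffMat_mul, Finset.mul_sum, Finset.mul_sum]
    refine .sum _ fun q hq => ?_
    rw [Finset.HasAntidiagonal.mem_antidiagonal] at hq
    rw [← mul_assoc, ← mul_assoc]
    refine (ih q.1 ?_).mul (opMatch_iff.1 (hAB p).neg q.2)
    have : q.1.degree + q.2.degree = β.degree := by rw [← map_add, hq]
    omega

/-- The bilinear equations propagate from zero times along a linear system satisfied by the wave
operators and the adjoint system satisfied by their inverses. -/
theorem bilinear_of_system {ε : ℝ} {W V Wb Vb : Op N} {A B : Time N → Op N}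
    (hAB : ∀ p, OpMatch (A p) (B p)) (hW : ∀ p, dTime p W = A p * W)
    (hWb : ∀ p, dTime p Wb = B p * Wb) (hV : ∀ p, dTime p V = -(V * A p))
    (hVb : ∀ p, dTime p Vb = -(Vb * B p))
    (h0 : ∀ r : ℕ, MatrixMatch (coeffMat 0 W * shiftMat ε (-1) r * coeffMat 0 V)
      (coeffMat 0 Wb * shiftMat ε 1 (-r) * coeffMat 0 Vb)) : Bilinear ε W V Wb Vb := by
  intro r α β
  refine matrixMatch_of_system_right hAB hV hVb _ _ ?_ β
  rw [mul_assoc, mul_assoc]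
  refine matrixMatch_of_system_left hAB hW hWb _ _ ?_ α
  rw [← mul_assoc, ← mul_assoc]
  exact h0 r

/-- Ring identity for the derivative of `S E` with `E' = G E`; it and the next two are stated in an
abstract ring, where associativity is cheap to normalize. -/
theorem wave_algebra {R : Type} [Ring R] {S T : R} (hTS : T * S = 1) (D G E : R) :
    D * E + S * (G * E) = (D * T + S * G * T) * (S * E) := by
  have h : T * (S * E) = E := by rw [← mul_assoc, hTS, one_mul]
  rw [add_mul, mul_assoc D, mul_assoc (S * G), h, mul_assoc S]

/-- Ring identity for the derivative of `E T` with `E' = -E G` and `(S T)' = 0`. -/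
theorem wave_inv_algebra {R : Type} [Ring R] {S T D D' : R} (hTS : T * S = 1)
    (h : D * T + S * D' = 0) (E G : R) :
    -(E * G) * T + E * D' = -(E * T * (D * T + S * G * T)) := by
  have hD : D' = -(T * (D * T)) := by
    rw [eq_neg_of_add_eq_zero_left h, mul_neg, neg_neg, ← mul_assoc, hTS, one_mul]
  have hG : E * T * (S * G * T) = E * G * T := by
    rw [← mul_assoc, ← mul_assoc, mul_assoc E T S, hTS, mul_one]
  rw [hD, mul_add, hG, neg_mul, mul_neg, neg_add_rev, mul_assoc E T]

/-- Ring identity for the product of `(S E)'` with `E⁻¹ T`. -/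
theorem wave_mul_inv_algebra {R : Type} [Ring R] {E E' : R} (hE : E * E' = 1) (D S G T : R) :
    (D * E + S * (G * E)) * (E' * T) = D * T + S * G * T := by
  have h : E * (E' * T) = T := by rw [← mul_assoc, hE, one_mul]
  rw [add_mul, mul_assoc D, h, mul_assoc S, mul_assoc G, h, mul_assoc]

section Wave

variable {c : Fin N → Time N → LaurentSeries Oper} (hc : ∀ k p q, Commute (c k p) (c k q))
  {S T : Op N}
include hc

/-- The linear equation of a wave operator `S exp Ξ`. -/
theorem dTime_wave (hTS : T * S = 1) (p : Time N) :
    dTime p (S * waveExp c) = (dTime p S * T + S * waveGen c p * T) * (S * waveExp c) := by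
  rw [dTime_mul, dTime_waveExp hc]
  exact wave_algebra hTS _ _ _

/-- The adjoint equation, for `exp (-Ξ) S⁻¹`. -/
theorem dTime_wave_inv (hST : S * T = 1) (hTS : T * S = 1) (p : Time N) :
    dTime p (waveExp (-c) * T) =
      -(waveExp (-c) * T * (dTime p S * T + S * waveGen c p * T)) := by
  have h1 : dTime p S * T + S * dTime p T = 0 := by rw [← dTime_mul, hST, dTime_one]
  rw [dTime_mul, dTime_waveExp_neg hc]
  exact wave_inv_algebra hTS h1 _ _

theorem dTime_wave_mul_wave_inv (p : Time N) :
    dTime p (S * waveExp c) * (waveExp (-c) * T) = dTime p S * T + S * waveGen c p * T := by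
  rw [dTime_mul, dTime_waveExp hc]
  exact wave_mul_inv_algebra (waveExp_mul_neg hc) _ _ _ _

end Wave

/-- The bilinear equations of wave operators follow from the Lax equation at zero times and from
the evolution equations. -/
theorem bilinear_of_flows {ε : ℝ} {c cb : Fin N → Time N → LaurentSeries Oper}
    (hc : ∀ k p q, Commute (c k p) (c k q)) (hcb : ∀ k p q, Commute (cb k p) (cb k q))
    {S T Sb Tb : Op N} (hST : S * T = 1) (hTS : T * S = 1) (hSTb : Sb * Tb = 1)
    (hTSb : Tb * Sb = 1)
    (hlax : ∀ r : ℕ, OpMatch (S * shiftOp ε (-1) r * T) (Sb * shiftOp ε 1 (-r) * Tb))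
    (hflow : ∀ p, OpMatch (dTime p S * T + S * waveGen c p * T)
      (dTime p Sb * Tb + Sb * waveGen cb p * Tb)) :
    Bilinear ε (S * waveExp c) (waveExp (-c) * T) (Sb * waveExp cb) (waveExp (-cb) * Tb) := by
  refine bilinear_of_system hflow (dTime_wave hc hTS) (dTime_wave hcb hTSb)
    (dTime_wave_inv hc hST hTS) (dTime_wave_inv hcb hSTb hTSb) fun r => ?_
  simp only [coeffMat_zero_mul, coeffMat_zero_waveExp, mul_one, one_mul]
  rw [← coeffMat_mul_shiftOp, ← coeffMat_mul_shiftOp, ← coeffMat_zero_mul, ← coeffMat_zero_mul]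
  exact opMatch_iff.1 (hlax r) 0

theorem shiftBy_mul_shiftBy (a b : ℝ) : shiftBy a * shiftBy b = shiftBy (a + b) := by
  refine LinearMap.ext fun f => Subtype.ext (funext fun p => ?_)
  change (f : ℝ × ℝ → ℂ) (p.1 + a + b, p.2) = (f : ℝ × ℝ → ℂ) (p.1 + (a + b), p.2)
  rw [add_assoc]

theorem shiftBy_zero : shiftBy 0 = 1 := by
  refine LinearMap.ext fun f => Subtype.ext (funext fun p => ?_)
  change (f : ℝ × ℝ → ℂ) (p.1 + 0, p.2) = (f : ℝ × ℝ → ℂ) p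
  rw [add_zero]

theorem shiftOp_zero (ε : ℝ) (u : ℤ) : shiftOp ε u 0 = (1 : Op N) := by
  rw [shiftOp, Int.cast_zero, zero_mul, shiftBy_zero, mul_zero, ← Matrix.diagonal_one]
  rfl

/-- The evolution equations are the derivative of the bilinear equation with `r = 0` at `t = t'`. -/
theorem flows_of_bilinear {ε : ℝ} {c cb : Fin N → Time N → LaurentSeries Oper}
    (hc : ∀ k p q, Commute (c k p) (c k q)) (hcb : ∀ k p q, Commute (cb k p) (cb k q))
    {S T Sb Tb : Op N}
    (h : Bilinear ε (S * waveExp c) (waveExp (-c) * T) (Sb * waveExp cb) (waveExp (-cb) * Tb))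
    (p : Time N) : OpMatch (dTime p S * T + S * waveGen c p * T)
      (dTime p Sb * Tb + Sb * waveGen cb p * Tb) := by
  have := (h.dTime_left p).diag 0
  rw [Nat.cast_zero, neg_zero, shiftOp_zero, shiftOp_zero, mul_one, mul_one,
    dTime_wave_mul_wave_inv hc, dTime_wave_mul_wave_inv hcb] at this
  exact this

/-- At `t = t'` the exponentials cancel in the bilinear equations. -/
theorem lax_of_bilinear {ε : ℝ} {c cb : Fin N → Time N → LaurentSeries Oper}
    (hc : ∀ k p q, Commute (c k p) (c k q)) (hcb : ∀ k p q, Commute (cb k p) (cb k q))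
    (hs : ∀ j, Commute (shiftOp ε (-1) j) (waveExp c))
    (hsb : ∀ j, Commute (shiftOp ε 1 j) (waveExp cb)) {S T Sb Tb : Op N}
    (h : Bilinear ε (S * waveExp c) (waveExp (-c) * T) (Sb * waveExp cb) (waveExp (-cb) * Tb))
    (r : ℕ) : OpMatch (S * shiftOp ε (-1) r * T) (Sb * shiftOp ε 1 (-r) * Tb) := by
  have key : ∀ {c : Fin N → Time N → LaurentSeries Oper}
      (_ : ∀ k p q, Commute (c k p) (c k q)) {X S T : Op N} (_ : Commute X (waveExp c)),
      S * waveExp c * X * (waveExp (-c) * T) = S * X * T := by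
    intro c hc X S T hX
    rw [mul_assoc S, ← hX.eq, ← mul_assoc S, ← mul_assoc, mul_assoc (S * X), waveExp_mul_neg hc,
      mul_one]
  have := h.diag r
  rwa [key hc (hs r), key hcb (hsb (-r))] at this

/-! ### Positive and negative parts -/

theorem coeff_ofTerms (c : ℕ → TMat N Oper) (i j : Fin N) (α : Time N →₀ ℕ) (n : ℤ) :
    (coeff α (ofTerms c i j)).coeff n = if n < 0 then 0 else coeff α (c n.natAbs i j) := by
  change (HahnSeries.ofPowerSeries ℤ Oper (PowerSeries.mk _)).coeff n = _
  rw [PowerSeries.coeff_coe, PowerSeries.coeff_mk]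

theorem orderGE_ofTerms (c : ℕ → TMat N Oper) : OrderGE 0 (ofTerms c) := fun i j α n hn => by
  rw [coeff_ofTerms, if_pos hn]

theorem coeff_negPart (A : ℤ → TMat N Oper) (i j : Fin N) (α : Time N →₀ ℕ) (n : ℤ) :
    (coeff α (negPart A i j)).coeff n = if n ≤ 0 then 0 else coeff α (A (-n) i j) := by
  rw [negPart, coeff_ofTerms]
  rcases lt_trichotomy n 0 with h | rfl | h
  · rw [if_pos h, if_pos h.le]
  · simp only [lt_self_iff_false, if_false, Int.natAbs_zero, if_true, le_refl]
    rfl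
  · rw [if_neg (by omega), if_neg (by omega), if_neg (by omega), Int.natAbs_of_nonneg h.le]

theorem coeff_posPart (A : ℤ → TMat N Oper) (i j : Fin N) (α : Time N →₀ ℕ) (n : ℤ) :
    (coeff α (posPart A i j)).coeff n = if n < 0 then 0 else coeff α (A n i j) := by
  rw [posPart, coeff_ofTerms]
  split_ifs with h
  · rfl
  · rw [Int.natAbs_of_nonneg (by omega)]

theorem coeff_term_sub (X Y : Op N) (i j : Fin N) (α : Time N →₀ ℕ) (m : ℤ) :
    coeff α ((term (-1) X - term 1 Y) m i j) =
      (coeff α (X i j)).coeff (-m) - (coeff α (Y i j)).coeff m := by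
  change (coeff α (X i j)).coeff (-1 * m) - (coeff α (Y i j)).coeff (1 * m) = _
  rw [neg_one_mul, one_mul]

/-- The splitting `A = X - Y` into an operator bounded from above and one bounded from below gives
an operator `X - A_- = Y + A_+` bounded on both sides. -/
theorem opMatch_parts (X Y : Op N) :
    OpMatch (-negPart (term (-1) X - term 1 Y) + X) (posPart (term (-1) X - term 1 Y) + Y) := by
  refine opMatch_iff.2 fun α i j m => ?_
  change -(coeff α (negPart _ i j)).coeff (-m) + (coeff α (X i j)).coeff (-m) =
    (coeff α (posPart _ i j)).coeff m + (coeff α (Y i j)).coeff m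
  rw [coeff_negPart, coeff_posPart, neg_neg, coeff_term_sub]
  by_cases h : m < 0
  · rw [if_neg (by omega), if_pos h]; abel
  · rw [if_pos (by omega), if_neg h]; abel

/-- Conversely, `G` and `H` with `G + X = H + Y` are read off from the negative and the nonnegative
powers of `Λ`, which involve only `G` and only `H`, respectively. -/
theorem eq_parts_of_opMatch {G H X Y : Op N} (hG : OrderGE 1 G) (hH : OrderGE 0 H)
    (h : OpMatch (G + X) (H + Y)) :
    G = -negPart (term (-1) X - term 1 Y) ∧ H = posPart (term (-1) X - term 1 Y) := by
  have key : ∀ i j α m, (coeff α (G i j)).coeff (-m) + (coeff α (X i j)).coeff (-m) =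
      (coeff α (H i j)).coeff m + (coeff α (Y i j)).coeff m := fun i j α m => h.coeff_eq i j α m
  constructor
  · ext i j α n
    change _ = -(coeff α (negPart _ i j)).coeff n
    rw [coeff_negPart]
    split_ifs with hn
    · rw [neg_zero]
      exact hG i j α n (by omega)
    · have h1 := key i j α (-n)
      rw [neg_neg, hH i j α (-n) (by omega), zero_add] at h1
      rw [coeff_term_sub, neg_neg, ← h1]
      abel
  · ext i j α n
    rw [coeff_posPart]
    split_ifs with hn
    · exact hH i j α n hn
    · have h1 := key i j α n
      rw [hG i j α (-n) (by omega), zero_add] at h1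
      rw [coeff_term_sub, h1]
      abel

end Bilinear

/-! ### The exponents of the hierarchy -/

section Exponents

open MvPowerSeries

variable {N : ℕ}

theorem commute_shiftBy_dirDeriv (a : ℝ) (v : ℝ × ℝ) :
    Commute (shiftBy a) (Oper.of (dirDeriv v)) := by
  refine LinearMap.ext fun f => Subtype.ext (funext fun p => ?_)
  change fderiv ℝ (f : ℝ × ℝ → ℂ) (p.1 + a, p.2) v =
    fderiv ℝ (fun q : ℝ × ℝ => (f : ℝ × ℝ → ℂ) (q.1 + a, q.2)) p v
  have h : (fun q : ℝ × ℝ => (f : ℝ × ℝ → ℂ) (q.1 + a, q.2)) =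
      fun q => (f : ℝ × ℝ → ℂ) (q + (a, 0)) := by
    funext q
    exact congrArg (f : ℝ × ℝ → ℂ) (Prod.ext rfl (add_zero q.2).symm)
  have hp : (p.1 + a, p.2) = p + (a, 0) := by ext <;> simp
  rw [h, fderiv_comp_add_right, hp]

theorem commute_shiftBy_dX (a : ℝ) : Commute (shiftBy a) dX := commute_shiftBy_dirDeriv a _

theorem commute_shiftBy_shiftBy (a b : ℝ) : Commute (shiftBy a) (shiftBy b) := by
  rw [Commute, SemiconjBy, shiftBy_mul_shiftBy, shiftBy_mul_shiftBy, add_comm]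

/-- The index `j` of the times `t_{jk}`, `t̄_{jk}`, `s_j`. -/
def Time.index : Time N → ℕ
  | .t j _ => j
  | .tbar j _ => j
  | .s j => j

/-- The operator coefficient of a time `p` in the exponent of the `k`-th column of the wave
operator of a side; it stands with `Λ^j` on side `a` and with `Λ^{-j}` on side `b`, where `j` is
the index of `p`. -/
def waveOper (ε : ℝ) (d : Side) (k : Fin N) : Time N → Oper := fun p => match d, p with
  | .a, .t _ k' => if k' = k then (ε : ℂ)⁻¹ • (1 : Oper) else 0
  | .b, .tbar _ k' => if k' = k then (-(ε : ℂ)⁻¹) • (1 : Oper) else 0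
  | d, .s j => ((ε : ℂ)⁻¹ * ((j : ℕ).factorial : ℂ)⁻¹) •
      ((ε : ℂ) • dX + ((d.locExp : ℂ) * ((harmonic j : ℚ) : ℂ)) • (1 : Oper))
  | _, _ => 0

theorem commute_waveOper {x : Oper} (hx : Commute x dX) (ε : ℝ) (d : Side) (k : Fin N)
    (p : Time N) : Commute x (waveOper ε d k p) := by
  have h1 : ∀ z : ℂ, Commute x (z • (1 : Oper)) := fun z => (Commute.one_right x).smul_right z
  cases d <;> cases p <;> simp only [waveOper]
  any_goals split_ifs
  any_goals first
    | exact Commute.zero_right x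
    | exact h1 _
    | exact ((hx.smul_right _).add_right (h1 _)).smul_right _

theorem commute_waveOper_waveOper (ε : ℝ) (d : Side) (k : Fin N) (p q : Time N) :
    Commute (waveOper ε d k p) (waveOper ε d k q) :=
  commute_waveOper (commute_waveOper (Commute.refl dX) ε d k p).symm ε d k q

/-- The symbol of the exponent of the wave operator: `Λ` is replaced by the marker alone. -/
def symCoeff (ε : ℝ) (d : Side) (k : Fin N) (p : Time N) : LaurentSeries Oper :=
  HahnSeries.single (-(p.index : ℤ)) (waveOper ε d k p)

/-- The coefficients of the exponent of the wave operator. -/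
def opCoeff (ε : ℝ) (d : Side) (k : Fin N) (p : Time N) : LaurentSeries Oper :=
  HahnSeries.single (-(p.index : ℤ))
    (waveOper ε d k p * shiftBy (((d.locExp * -(p.index : ℤ) : ℤ) : ℝ) * ε))

theorem commute_single {m n : ℤ} {x y : Oper} (h : Commute x y) :
    Commute (HahnSeries.single m x : LaurentSeries Oper) (HahnSeries.single n y) := by
  rw [Commute, SemiconjBy, HahnSeries.single_mul_single, HahnSeries.single_mul_single, h.eq,
    add_comm]

theorem commute_symCoeff (ε : ℝ) (d : Side) (k : Fin N) (p q : Time N) :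
    Commute (symCoeff ε d k p) (symCoeff ε d k q) :=
  commute_single (commute_waveOper_waveOper ε d k p q)

theorem commute_opCoeff (ε : ℝ) (d : Side) (k : Fin N) (p q : Time N) :
    Commute (opCoeff ε d k p) (opCoeff ε d k q) := by
  have h : ∀ a p, Commute (shiftBy a) (waveOper ε d k p) := fun a p =>
    commute_waveOper (commute_shiftBy_dX a) ε d k p
  exact commute_single (((commute_waveOper_waveOper ε d k p q).mul_right
    (h _ p).symm).mul_left ((h _ q).mul_right (commute_shiftBy_shiftBy _ _)))

theorem commute_shiftOp_waveExp (ε : ℝ) (u : ℤ) (d : Side) (j : ℤ) :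
    Commute (shiftOp ε u j : Op N) (waveExp (opCoeff ε d)) := by
  rw [Commute, SemiconjBy, shiftOp, waveExp, Matrix.diagonal_mul_diagonal,
    Matrix.diagonal_mul_diagonal]
  congr 1
  ext1 k
  refine C_mul_linExp (commute_opCoeff ε d k) (commute_opCoeff ε d k) fun p => ?_
  exact (commute_single ((commute_waveOper (commute_shiftBy_dX _) ε d k p).mul_right
    (commute_shiftBy_shiftBy _ _))).eq

theorem shiftOp_mul_shiftOp (ε : ℝ) (u i j : ℤ) :
    (shiftOp ε u i * shiftOp ε u j : Op N) = shiftOp ε u (i + j) := by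
  rw [shiftOp, shiftOp, shiftOp, Matrix.diagonal_mul_diagonal]
  congr 1
  ext1 k
  rw [← map_mul, HahnSeries.single_mul_single, shiftBy_mul_shiftBy]
  push_cast
  rw [mul_add, add_mul]

/-- Powers of a dressed shift, in particular of the Lax operator. -/
theorem conj_shiftOp_pow (ε : ℝ) (u i : ℤ) {S T : Op N} (hST : S * T = 1) (hTS : T * S = 1)
    (n : ℕ) : (S * shiftOp ε u i * T) ^ n = S * shiftOp ε u (n * i) * T := by
  induction n with
  | zero => rw [pow_zero, Nat.cast_zero, zero_mul, shiftOp_zero, mul_one, hST]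
  | succ n ih =>
    have h : T * (S * (shiftOp ε u i * T)) = shiftOp ε u i * T := by
      rw [← mul_assoc, hTS, one_mul]
    rw [pow_succ, ih, Nat.cast_succ, add_mul, one_mul, ← shiftOp_mul_shiftOp]
    simp only [mul_assoc]
    rw [h]

theorem term_smul (u : ℤ) (z : ℂ) (F : Op N) : term u (z • F) = z • term u F := rfl

theorem term_neg (u : ℤ) (F : Op N) : term u (-F) = -term u F := rfl

theorem term_zero (u : ℤ) : term u (0 : Op N) = 0 := rfl

theorem smul_C_single (z : ℂ) (n : ℤ) (A : Oper) :
    z • (C (HahnSeries.single n A) : OpSeries N) = C (HahnSeries.single n (z • A)) := by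
  classical
  ext α m
  rw [coeff_complex_smul, coeff_C, coeff_C]
  split_ifs
  · rw [HahnSeries.coeff_smul, HahnSeries.coeff_single, HahnSeries.coeff_single]
    split_ifs
    · rfl
    · exact smul_zero z
  · rw [smul_zero]

theorem waveGen_a_t (ε : ℝ) (hε : ε ≠ 0) (j : ℕ) (k : Fin N) :
    (ε : ℂ) • waveGen (opCoeff ε .a) (.t j k) = unitE k * shiftOp ε (-1) j := by
  have hε' : (ε : ℂ) ≠ 0 := Complex.ofReal_ne_zero.2 hε
  ext a b : 2
  rw [shiftOp, Matrix.mul_diagonal, unitE, Matrix.single_apply, Matrix.smul_apply, waveGen,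
    Matrix.diagonal_apply]
  by_cases hab : a = b
  · subst hab
    by_cases hk : k = a
    · subst hk
      simp only [if_true, and_self, one_mul, opCoeff, waveOper, Time.index, Side.locExp]
      rw [smul_C_single, smul_mul_assoc, smul_smul, mul_inv_cancel₀ hε', one_smul,
        one_mul]
      simp
    · simp [hk, opCoeff, waveOper]
  · rw [if_neg hab, if_neg (fun h => hab (h.1.symm.trans h.2)), smul_zero, zero_mul]

theorem waveGen_b_tbar (ε : ℝ) (hε : ε ≠ 0) (j : ℕ) (k : Fin N) :
    (ε : ℂ) • waveGen (opCoeff ε .b) (.tbar j k) = -(unitE k * shiftOp ε 1 (-j)) := by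
  have hε' : (ε : ℂ) ≠ 0 := Complex.ofReal_ne_zero.2 hε
  ext a b : 2
  rw [Matrix.neg_apply, shiftOp, Matrix.mul_diagonal, unitE, Matrix.single_apply,
    Matrix.smul_apply, waveGen, Matrix.diagonal_apply]
  by_cases hab : a = b
  · subst hab
    by_cases hk : k = a
    · subst hk
      simp only [if_true, and_self, one_mul, opCoeff, waveOper, Time.index, Side.locExp]
      rw [smul_C_single, smul_mul_assoc, smul_smul, mul_neg, mul_inv_cancel₀ hε',
        one_mul, ← neg_one_smul ℂ (C _ : OpSeries N), smul_C_single]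
    · simp [hk, opCoeff, waveOper]
  · rw [if_neg hab, if_neg (fun h => hab (h.1.symm.trans h.2)), smul_zero, zero_mul, neg_zero]

theorem waveGen_b_t (ε : ℝ) (j : ℕ) (k : Fin N) : waveGen (opCoeff ε .b) (.t j k) = 0 := by
  rw [waveGen, ← Matrix.diagonal_zero]
  congr 1
  ext1 l
  simp [opCoeff, waveOper]

theorem waveGen_a_tbar (ε : ℝ) (j : ℕ) (k : Fin N) : waveGen (opCoeff ε .a) (.tbar j k) = 0 := by
  rw [waveGen, ← Matrix.diagonal_zero]
  congr 1
  ext1 l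
  simp [opCoeff, waveOper]

theorem smul_scalarOp (z : ℂ) (A : Oper) : z • (scalarOp A : Op N) = scalarOp (z • A) := by
  rw [scalarOp, scalarOp, ← Matrix.diagonal_smul]
  congr 1
  ext1 k
  exact smul_C_single z 0 A

theorem smul_one_eq_scalarOp (z : ℂ) : z • (1 : Op N) = scalarOp (z • 1) := by
  have h1 : (1 : Op N) = scalarOp 1 := by
    rw [scalarOp, ← Matrix.diagonal_one]
    rfl
  rw [h1, smul_scalarOp]

theorem scalarOp_add (A B : Oper) : (scalarOp (A + B) : Op N) = scalarOp A + scalarOp B := by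
  rw [scalarOp, scalarOp, scalarOp, Matrix.diagonal_add]
  congr 1
  ext1 k
  rw [HahnSeries.single_add, map_add]

theorem waveGen_s (ε : ℝ) (hε : ε ≠ 0) (d : Side) (j : ℕ+) :
    (ε : ℂ) • waveGen (opCoeff ε d) (.s j) = (((j : ℕ).factorial : ℂ)⁻¹) •
      ((shiftOp ε d.locExp (-d.locExp * j) : Op N) *
        ((ε : ℂ) • scalarOp dX +
          ((d.locExp : ℂ) * ((harmonic j : ℚ) : ℂ)) • (1 : Op N))) := by
  have hε' : (ε : ℂ) ≠ 0 := Complex.ofReal_ne_zero.2 hε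
  rw [smul_one_eq_scalarOp, smul_scalarOp, ← scalarOp_add, shiftOp, scalarOp,
    Matrix.diagonal_mul_diagonal, waveGen, ← Matrix.diagonal_smul, ← Matrix.diagonal_smul]
  congr 1
  ext1 k
  set A := (ε : ℂ) • dX + ((d.locExp : ℂ) * ((harmonic j : ℚ) : ℂ)) • (1 : Oper) with hA
  have hw : waveOper ε d k (.s j) = ((ε : ℂ)⁻¹ * ((j : ℕ).factorial : ℂ)⁻¹) • A := by
    cases d <;> rfl
  have hcomm : Commute A (shiftBy (((-d.locExp * j : ℤ) : ℝ) * ε)) :=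
    ((commute_shiftBy_dX _).symm.smul_left _).add_left ((Commute.one_left _).smul_left _)
  have hu : d.locExp * (-d.locExp * j) = -(j : ℤ) := by cases d <;> simp [Side.locExp]
  have hu' : d.locExp * -(j : ℤ) = -d.locExp * j := by ring
  rw [Pi.smul_apply, opCoeff, hw, ← map_mul, HahnSeries.single_mul_single, add_zero, hu, ← hcomm.eq]
  rw [Pi.smul_apply, smul_C_single, smul_C_single, Time.index, hu', smul_mul_assoc, smul_smul, ← mul_assoc, mul_inv_cancel₀ hε', one_mul]

/-- The operator `A_p` that generates the flow of the formal time `p`. -/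
def flowGen (ε : ℝ) (S T Sb Tb : Op N) : Time N → ℤ → TMat N Oper
  | .t j k => opB ε S T j k
  | .tbar j k => opBbar ε Sb Tb j k
  | .s j => opD ε S T Sb Tb j

/-- The generator `D_j` with the dressing operators pulled out of the products. -/
theorem opD_eq (ε : ℝ) {S T Sb Tb : Op N} (hST : S * T = 1) (hTS : T * S = 1)
    (hSTb : Sb * Tb = 1) (hTSb : Tb * Sb = 1) (j : ℕ) :
    opD ε S T Sb Tb j = ((j.factorial : ℂ)⁻¹) •
      (term (-1) (S * (shiftOp ε (-1) j *
          ((ε : ℂ) • scalarOp dX - ((harmonic j : ℚ) : ℂ) • (1 : Op N))) * T) -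
        term 1 (Sb * (shiftOp ε 1 (-j) *
          ((ε : ℂ) • scalarOp dX + ((harmonic j : ℚ) : ℂ) • (1 : Op N))) * Tb)) := by
  have key : ∀ {S T : Op N} (_ : S * T = 1) (_ : T * S = 1) (X D : Op N) (z : ℂ),
      S * X * T * (S * D * T + z • (1 : Op N)) = S * (X * (D + z • (1 : Op N))) * T := by
    intro S T hST hTS X D z
    have h1 : S * D * T + z • (1 : Op N) = S * (D + z • (1 : Op N)) * T := by
      rw [mul_add, add_mul, mul_smul_comm, mul_one, smul_mul_assoc, hST]
    rw [h1]
    calc S * X * T * (S * (D + z • (1 : Op N)) * T)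
        = S * X * (T * S) * (D + z • (1 : Op N)) * T := by simp only [mul_assoc]
      _ = _ := by rw [hTS, mul_one]; simp only [mul_assoc]
  have ha := key hST hTS (shiftOp ε (-1) j) ((ε : ℂ) • scalarOp dX)
    (-((harmonic j : ℚ) : ℂ))
  have hb := key hSTb hTSb (shiftOp ε 1 (-j)) ((ε : ℂ) • scalarOp dX) ((harmonic j : ℚ) : ℂ)
  have hD : opD ε S T Sb Tb j = fun m => ((j.factorial : ℂ)⁻¹) •
    (term (-1) ((S * shiftOp ε (-1) 1 * T) ^ j *
        (logPlus ε S T - ((harmonic j : ℚ) : ℂ) • (1 : Op N))) m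
      + term 1 ((Sb * shiftOp ε 1 (-1) * Tb) ^ j *
        (logMinus ε Sb Tb - ((harmonic j : ℚ) : ℂ) • (1 : Op N))) m) := rfl
  rw [hD, conj_shiftOp_pow ε (-1) 1 hST hTS, conj_shiftOp_pow ε 1 (-1) hSTb hTSb, logPlus,
    logMinus, ← neg_add', mul_neg, term_neg, mul_one, mul_neg_one, hb, sub_eq_add_neg (S * _ * T),
    ← neg_smul, ha, neg_smul, ← sub_eq_add_neg]
  ext m : 1
  rw [Pi.smul_apply, Pi.sub_apply, sub_eq_add_neg]
  rfl

/-- Every generator of the hierarchy is the difference of the two dressed generators of the wave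
operators. -/
theorem flowGen_eq (ε : ℝ) (hε : ε ≠ 0) {S T Sb Tb : Op N} (hST : S * T = 1) (hTS : T * S = 1)
    (hSTb : Sb * Tb = 1) (hTSb : Tb * Sb = 1) (p : Time N) :
    flowGen ε S T Sb Tb p = term (-1) ((ε : ℂ) • (S * waveGen (opCoeff ε .a) p * T)) -
      term 1 ((ε : ℂ) • (Sb * waveGen (opCoeff ε .b) p * Tb)) := by
  have hsm : ∀ X Y Z : Op N, (ε : ℂ) • (X * Y * Z) = X * ((ε : ℂ) • Y) * Z := fun X Y Z => by
    rw [mul_smul_comm, smul_mul_assoc]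
  rw [hsm, hsm]
  cases p with
  | t j k =>
    rw [waveGen_a_t ε hε, waveGen_b_t, smul_zero, mul_zero, zero_mul, term_zero, sub_zero,
      ← mul_assoc]
    rfl
  | tbar j k =>
    rw [waveGen_b_tbar ε hε, waveGen_a_tbar, smul_zero, mul_zero, zero_mul, term_zero, zero_sub,
      mul_neg, neg_mul, term_neg, neg_neg, ← mul_assoc]
    rfl
  | s j =>
    rw [waveGen_s ε hε, waveGen_s ε hε]
    change opD ε S T Sb Tb j = _
    rw [opD_eq ε hST hTS hSTb hTSb]
    simp only [mul_smul_comm, smul_mul_assoc, term_smul, Side.locExp, ← smul_sub]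
    simp only [neg_neg, one_mul, Int.cast_neg, Int.cast_one, neg_mul, neg_smul, sub_eq_add_neg]

theorem OrderGE.smul {k : ℤ} {F : Op N} (h : OrderGE k F) (z : ℂ) : OrderGE k (z • F) :=
  fun i j α n hn => by
    change z • (coeff α (F i j)).coeff n = 0
    rw [h i j α n hn, smul_zero]

theorem OrderGE.sub {k : ℤ} {F G : Op N} (h : OrderGE k F) (h' : OrderGE k G) :
    OrderGE k (F - G) := fun i j α n hn => by
  change (coeff α (F i j)).coeff n - (coeff α (G i j)).coeff n = 0
  rw [h i j α n hn, h' i j α n hn, sub_zero]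

theorem OrderGE.dTime {k : ℤ} {F : Op N} (h : OrderGE k F) (p : Time N) :
    OrderGE k (dTime p F) := fun i j α n hn => by
  change ((α p : ℂ) + 1) • (coeff (α + Finsupp.single p 1) (F i j)).coeff n = 0
  rw [h i j _ n hn, smul_zero]

theorem orderGE_scalarOp (A : Oper) : OrderGE 0 (scalarOp A : Op N) := by
  classical
  intro i j α n hn
  rw [scalarOp, Matrix.diagonal_apply]
  split_ifs
  · rw [coeff_C]
    split_ifs
    · exact HahnSeries.coeff_single_of_ne (by omega)
    · rfl
  · rfl

theorem opMatch_scalarOp (A : Oper) : OpMatch (scalarOp A : Op N) (scalarOp A) := by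
  classical
  refine opMatch_iff.2 fun α i j => ?_
  rw [coeffMat_apply, scalarOp, Matrix.diagonal_apply]
  split_ifs
  · rw [coeff_C]
    split_ifs
    · exact .single_zero A
    · exact .zero
  · rw [map_zero]; exact .zero

/-- The wave operators of dressing operators satisfy the bilinear equations. -/
theorem IsDressing.bilinear {ε : ℝ} (hε : ε ≠ 0) {S T Sb Tb : Op N}
    (h : IsDressing ε S T Sb Tb) :
    Bilinear ε (S * waveExp (opCoeff ε .a)) (waveExp (-opCoeff ε .a) * T)
      (Sb * waveExp (opCoeff ε .b)) (waveExp (-opCoeff ε .b) * Tb) := by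
  have hε' : (ε : ℂ) ≠ 0 := Complex.ofReal_ne_zero.2 hε
  refine bilinear_of_flows (commute_opCoeff ε .a) (commute_opCoeff ε .b) h.mul_inv h.inv_mul
    h.bar_mul_inv h.bar_inv_mul (fun r => ?_) fun p => ?_
  · have hlax : OpMatch (S * shiftOp ε (-1) 1 * T) (Sb * shiftOp ε 1 (-1) * Tb) := h.lax
    have := hlax.pow r
    rwa [conj_shiftOp_pow ε _ _ h.mul_inv h.inv_mul,
      conj_shiftOp_pow ε _ _ h.bar_mul_inv h.bar_inv_mul, mul_one, mul_neg_one] at this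
  · have hA : (ε : ℂ) • dTime p S = -(negPart (flowGen ε S T Sb Tb p) * S) := by
      cases p with
      | t j k => exact h.flow_t j k
      | tbar j k => exact h.flow_tbar j k
      | s j => exact h.flow_s j
    have hAb : (ε : ℂ) • dTime p Sb = posPart (flowGen ε S T Sb Tb p) * Sb := by
      cases p with
      | t j k => exact h.flow_t_bar j k
      | tbar j k => exact h.flow_tbar_bar j k
      | s j => exact h.flow_s_bar j
    have h1 : (ε : ℂ) • (dTime p S * T) = -negPart (flowGen ε S T Sb Tb p) := by
      rw [← smul_mul_assoc, hA, ← neg_mul, mul_assoc, h.mul_inv, mul_one]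
    have h2 : (ε : ℂ) • (dTime p Sb * Tb) = posPart (flowGen ε S T Sb Tb p) := by
      rw [← smul_mul_assoc, hAb, mul_assoc, h.bar_mul_inv, mul_one]
    have h3 := opMatch_parts ((ε : ℂ) • (S * waveGen (opCoeff ε .a) p * T))
      ((ε : ℂ) • (Sb * waveGen (opCoeff ε .b) p * Tb))
    rw [← flowGen_eq ε hε h.mul_inv h.inv_mul h.bar_mul_inv h.bar_inv_mul, ← h1, ← h2,
      ← smul_add, ← smul_add] at h3
    have h4 := h3.smul (ε : ℂ)⁻¹
    rwa [inv_smul_smul₀ hε', inv_smul_smul₀ hε'] at h4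

/-- The flow of `s₀` on operators whose coefficients depend on `s₀ + x` only. -/
theorem flow_s0_of_dTimeS0 {ε : ℝ} {S T Sb Tb : Op N} (hST : S * T = 1) (hTS : T * S = 1)
    (hSTb : Sb * Tb = 1) (hTSb : Tb * Sb = 1) (hS : OrderGE 1 (S - 1)) (hT : OrderGE 0 T)
    (hSb : OrderGE 0 Sb) (hTb : OrderGE 0 Tb)
    (h0 : dTimeS0 S = scalarOp dX * S - S * scalarOp dX)
    (h0b : dTimeS0 Sb = scalarOp dX * Sb - Sb * scalarOp dX) :
    (ε : ℂ) • dTimeS0 S = -(negPart (opD ε S T Sb Tb 0) * S) ∧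
      (ε : ℂ) • dTimeS0 Sb = posPart (opD ε S T Sb Tb 0) * Sb := by
  set D : Op N := scalarOp dX with hD
  have hDord : OrderGE 0 D := orderGE_scalarOp dX
  have hG : OrderGE 1 ((ε : ℂ) • (dTimeS0 S * T)) := by
    have h1 : dTimeS0 S = D * (S - 1) - (S - 1) * D := by
      rw [h0, mul_sub, sub_mul, mul_one, one_mul, sub_sub_sub_cancel_right]
    have h2 : OrderGE (0 + 1) (D * (S - 1)) := hDord.mul hS
    have h3 : OrderGE (1 + 0) ((S - 1) * D) := hS.mul hDord
    have h4 : OrderGE 1 (dTimeS0 S) := by rw [h1]; exact h2.sub h3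
    have h5 : OrderGE (1 + 0) (dTimeS0 S * T) := h4.mul hT
    exact h5.smul _
  have hH : OrderGE 0 ((ε : ℂ) • (dTimeS0 Sb * Tb)) := by
    have h1 : OrderGE (0 + 0) (D * Sb) := hDord.mul hSb
    have h2 : OrderGE (0 + 0) (Sb * D) := hSb.mul hDord
    have h4 : OrderGE 0 (dTimeS0 Sb) := by rw [h0b]; exact h1.sub h2
    have h5 : OrderGE (0 + 0) (dTimeS0 Sb * Tb) := h4.mul hTb
    exact h5.smul _
  have key : ∀ {S T : Op N}, S * T = 1 → dTimeS0 S = D * S - S * D →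
      (ε : ℂ) • (dTimeS0 S * T) + S * ((ε : ℂ) • D) * T = (ε : ℂ) • D := by
    intro S T hST h
    rw [h, mul_smul_comm, smul_mul_assoc, ← smul_add, sub_mul, sub_add_cancel, mul_assoc, hST,
      mul_one]
  have hm : OpMatch ((ε : ℂ) • (dTimeS0 S * T) + S * ((ε : ℂ) • D) * T)
      ((ε : ℂ) • (dTimeS0 Sb * Tb) + Sb * ((ε : ℂ) • D) * Tb) := by
    rw [key hST h0, key hSTb h0b]
    exact (opMatch_scalarOp dX).smul _
  have hA : opD ε S T Sb Tb 0 = term (-1) (S * ((ε : ℂ) • D) * T) -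
      term 1 (Sb * ((ε : ℂ) • D) * Tb) := by
    rw [opD_eq ε hST hTS hSTb hTSb]
    simp only [Nat.factorial_zero, Nat.cast_one, inv_one, one_smul, Nat.cast_zero, neg_zero,
      shiftOp_zero, one_mul, harmonic_zero, Rat.cast_zero, zero_smul, sub_zero, add_zero, hD]
  obtain ⟨h1, h2⟩ := eq_parts_of_opMatch hG hH hm
  rw [← hA] at h1 h2
  constructor
  · rw [← neg_mul, ← h1, smul_mul_assoc, mul_assoc, hTS, mul_one]
  · rw [← h2, smul_mul_assoc, mul_assoc, hTSb, mul_one]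

/-- Operators of the right triangular shape whose wave operators satisfy the bilinear equations are
dressing operators. -/
theorem isDressing_of_bilinear {ε : ℝ} (hε : ε ≠ 0) {S T Sb Tb : Op N} (hST : S * T = 1)
    (hTS : T * S = 1) (hSTb : Sb * Tb = 1) (hTSb : Tb * Sb = 1) (hS : OrderGE 1 (S - 1))
    (hT : OrderGE 0 T) (hSb : OrderGE 0 Sb) (hTb : OrderGE 0 Tb)
    (h0 : dTimeS0 S = scalarOp dX * S - S * scalarOp dX)
    (h0b : dTimeS0 Sb = scalarOp dX * Sb - Sb * scalarOp dX)
    (hB : Bilinear ε (S * waveExp (opCoeff ε .a)) (waveExp (-opCoeff ε .a) * T)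
      (Sb * waveExp (opCoeff ε .b)) (waveExp (-opCoeff ε .b) * Tb)) :
    IsDressing ε S T Sb Tb := by
  have hlax := lax_of_bilinear (commute_opCoeff ε .a) (commute_opCoeff ε .b)
    (commute_shiftOp_waveExp ε (-1) .a) (commute_shiftOp_waveExp ε 1 .b) hB 1
  have hflow : ∀ p, (ε : ℂ) • dTime p S = -(negPart (flowGen ε S T Sb Tb p) * S) ∧
      (ε : ℂ) • dTime p Sb = posPart (flowGen ε S T Sb Tb p) * Sb := by
    intro p
    have hm := (flows_of_bilinear (commute_opCoeff ε .a) (commute_opCoeff ε .b) hB p).smul (ε : ℂ)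
    rw [smul_add, smul_add] at hm
    have hG : OrderGE (1 + 0) ((ε : ℂ) • (dTime p S * T)) := by
      have hd : dTime p S = dTime p (S - 1) := by
        have : dTime p (S - 1) = dTime p S - dTime p 1 := by
          ext1 a b
          exact map_sub (pDeriv p) _ _
        rw [this, dTime_one, sub_zero]
      rw [hd]
      exact ((hS.dTime p).mul hT).smul _
    have hH : OrderGE (0 + 0) ((ε : ℂ) • (dTime p Sb * Tb)) := ((hSb.dTime p).mul hTb).smul _
    obtain ⟨h1, h2⟩ := eq_parts_of_opMatch hG hH hm
    rw [← flowGen_eq ε hε hST hTS hSTb hTSb] at h1 h2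
    constructor
    · rw [← neg_mul, ← h1, smul_mul_assoc, mul_assoc, hTS, mul_one]
    · rw [← h2, smul_mul_assoc, mul_assoc, hTSb, mul_one]
  have hs0 := flow_s0_of_dTimeS0 (ε := ε) hST hTS hSTb hTSb hS hT hSb hTb h0 h0b
  exact
    { mul_inv := hST
      inv_mul := hTS
      bar_mul_inv := hSTb
      bar_inv_mul := hTSb
      lax := by simpa only [Nat.cast_one] using (show term _ _ = term _ _ from hlax)
      flow_t := fun j k => (hflow (.t j k)).1
      flow_t_bar := fun j k => (hflow (.t j k)).2
      flow_tbar := fun j k => (hflow (.tbar j k)).1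
      flow_tbar_bar := fun j k => (hflow (.tbar j k)).2
      flow_s := fun j => (hflow (.s j)).1
      flow_s_bar := fun j => (hflow (.s j)).2
      flow_s0 := hs0.1
      flow_s0_bar := hs0.2 }

end Exponents

/-! ### From symbols to operators -/

section Twist

open MvPowerSeries

/-- The operator `∑ F_n Λ^{u n}` with left symbol `F`. -/
def rtwist (ε : ℝ) (u : ℤ) (F : LaurentSeries Oper) : LaurentSeries Oper where
  coeff n := F.coeff n * shiftBy (((u * n : ℤ) : ℝ) * ε)
  isPWO_support' := F.isPWO_support.mono fun n hn h => hn (by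
    change F.coeff n * _ = 0
    rw [h, zero_mul])

/-- The operator `∑ Λ^{u n} F_n` with right symbol `F`. -/
def ltwist (ε : ℝ) (u : ℤ) (F : LaurentSeries Oper) : LaurentSeries Oper where
  coeff n := shiftBy (((u * n : ℤ) : ℝ) * ε) * F.coeff n
  isPWO_support' := F.isPWO_support.mono fun n hn h => hn (by
    change _ * F.coeff n = 0
    rw [h, mul_zero])

theorem coeff_rtwist (ε : ℝ) (u : ℤ) (F : LaurentSeries Oper) (n : ℤ) :
    (rtwist ε u F).coeff n = F.coeff n * shiftBy (((u * n : ℤ) : ℝ) * ε) := rfl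

theorem coeff_ltwist (ε : ℝ) (u : ℤ) (F : LaurentSeries Oper) (n : ℤ) :
    (ltwist ε u F).coeff n = shiftBy (((u * n : ℤ) : ℝ) * ε) * F.coeff n := rfl

theorem rtwist_smul (ε : ℝ) (u : ℤ) (z : ℂ) (F : LaurentSeries Oper) :
    rtwist ε u (z • F) = z • rtwist ε u F := by
  ext n
  rw [coeff_rtwist, HahnSeries.coeff_smul, HahnSeries.coeff_smul, coeff_rtwist, smul_mul_assoc]

theorem rtwist_sum {ι : Type} (s : Finset ι) (ε : ℝ) (u : ℤ) (f : ι → LaurentSeries Oper) :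
    rtwist ε u (∑ i ∈ s, f i) = ∑ i ∈ s, rtwist ε u (f i) := by
  ext n
  rw [coeff_rtwist, HahnSeries.coeff_sum, HahnSeries.coeff_sum, Finset.sum_mul]
  rfl

theorem ltwist_sum {ι : Type} (s : Finset ι) (ε : ℝ) (u : ℤ) (f : ι → LaurentSeries Oper) :
    ltwist ε u (∑ i ∈ s, f i) = ∑ i ∈ s, ltwist ε u (f i) := by
  ext n
  rw [coeff_ltwist, HahnSeries.coeff_sum, HahnSeries.coeff_sum, Finset.mul_sum]
  rfl

theorem shiftBy_index_add (ε : ℝ) (u m n : ℤ) :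
    shiftBy (((u * (m + n) : ℤ) : ℝ) * ε) =
      shiftBy (((u * m : ℤ) : ℝ) * ε) * shiftBy (((u * n : ℤ) : ℝ) * ε) := by
  rw [shiftBy_mul_shiftBy]
  push_cast
  ring_nf

theorem rtwist_mul (ε : ℝ) (u : ℤ) (F : LaurentSeries Oper) {G : LaurentSeries Oper}
    (hG : ∀ a n, Commute (shiftBy a) (G.coeff n)) :
    rtwist ε u (F * G) = rtwist ε u F * rtwist ε u G := by
  ext n
  rw [coeff_rtwist, coeff_mul_eq_finsum, coeff_mul_eq_finsum,
    finsum_mul' _ _ (finite_support_coeff_mul_coeff F G n)]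
  refine finsum_congr fun m => ?_
  have h := shiftBy_index_add ε u m (n - m)
  rw [add_sub_cancel] at h
  rw [coeff_rtwist, coeff_rtwist, h, mul_assoc, ← mul_assoc (G.coeff _), ← (hG _ _).eq]
  simp only [mul_assoc]

theorem ltwist_mul (ε : ℝ) (u : ℤ) {F : LaurentSeries Oper} (G : LaurentSeries Oper)
    (hF : ∀ a n, Commute (shiftBy a) (F.coeff n)) :
    ltwist ε u (F * G) = ltwist ε u F * ltwist ε u G := by
  ext n
  rw [coeff_ltwist, coeff_mul_eq_finsum, coeff_mul_eq_finsum,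
    mul_finsum' _ _ (finite_support_coeff_mul_coeff F G n)]
  refine finsum_congr fun m => ?_
  have h := shiftBy_index_add ε u m (n - m)
  rw [add_sub_cancel] at h
  rw [coeff_ltwist, coeff_ltwist, h, mul_assoc, ← mul_assoc _ (F.coeff _), (hF _ _).eq]
  simp only [mul_assoc]

theorem ltwist_eq_rtwist (ε : ℝ) (u : ℤ) {F : LaurentSeries Oper}
    (hF : ∀ a n, Commute (shiftBy a) (F.coeff n)) : ltwist ε u F = rtwist ε u F := by
  ext n
  exact (hF _ n).eq

/-- Passing from a product of symbols to the product of the operators: the middle shift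
`Λ^{-l}` moves the argument of the right factor. -/
theorem coeff_mul_shift_mul (ε : ℝ) {u : ℤ} (hu : u * u = 1) (l r : ℤ)
    (F G : LaurentSeries Oper) :
    (F * HahnSeries.single 0 (shiftBy (-((l : ℝ) * ε))) * G).coeff (r - u * l) =
      (rtwist ε u F * HahnSeries.single (-r) (shiftBy (((-u * r : ℤ) : ℝ) * ε)) *
        ltwist ε u G).coeff (-u * l) := by
  rw [coeff_mul_eq_finsum, coeff_mul_eq_finsum, ← finsum_comp_equiv (Equiv.addRight r)]
  refine finsum_congr fun n => ?_
  have h1 : r - u * l - (n + r) = -u * l - n := by ring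
  have h2 : ((u * (n + r) : ℤ) : ℝ) * ε + ((-u * r : ℤ) : ℝ) * ε +
      ((u * (-u * l - n) : ℤ) : ℝ) * ε = -((l : ℝ) * ε) := by
    have : u * (n + r) + -u * r + u * (-u * l - n) = -l := by
      linear_combination (-l) * hu
    rw [← add_mul, ← add_mul, ← Int.cast_add, ← Int.cast_add, this]
    push_cast
    ring
  rw [HahnSeries.coeff_mul_single_zero, Equiv.coe_addRight, HahnSeries.coeff_mul_single,
    sub_neg_eq_add, coeff_rtwist, coeff_ltwist, h1, ← h2, ← shiftBy_mul_shiftBy,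
    ← shiftBy_mul_shiftBy]
  simp only [mul_assoc]

theorem commute_coeff_of_commute_single {x : Oper} {F : LaurentSeries Oper}
    (h : Commute (HahnSeries.single 0 x) F) (n : ℤ) : Commute x (F.coeff n) := by
  have := congrArg (fun z : LaurentSeries Oper => z.coeff n) h.eq
  rwa [HahnSeries.coeff_single_zero_mul, HahnSeries.coeff_mul_single_zero] at this

section LinExp

variable {σ : Type} {c c' : σ → LaurentSeries Oper} (hc : ∀ i j, Commute (c i) (c j))
  (hs : ∀ a i, Commute (HahnSeries.single 0 (shiftBy a)) (c i))
include hc hs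

theorem commute_shiftBy_coeff_linExp (a : ℝ) (α : σ →₀ ℕ) (n : ℤ) :
    Commute (shiftBy a) ((coeff α (linExp c)).coeff n) :=
  commute_coeff_of_commute_single (commute_coeff_linExp hc (hs a) α) n

/-- An exponential whose coefficients commute with `Λ` is quantized termwise in the exponent. -/
theorem rtwist_coeff_linExp (hc' : ∀ i j, Commute (c' i) (c' j)) {ε : ℝ} {u : ℤ}
    (hcc' : ∀ i, rtwist ε u (c i) = c' i) (α : σ →₀ ℕ) :
    rtwist ε u (coeff α (linExp c)) = coeff α (linExp c') := by
  induction α using finsupp_induction_single_one with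
  | h0 =>
    rw [coeff_zero_linExp, coeff_zero_linExp]
    ext n
    rw [coeff_rtwist, HahnSeries.coeff_one]
    split_ifs with h
    · rw [h, mul_zero, Int.cast_zero, zero_mul, shiftBy_zero, one_mul]
    · rw [zero_mul]
  | hs α i ih =>
    apply natCast_add_one_smul_cancel (α i)
    rw [← rtwist_smul, coeff_linExp_add_single hc, coeff_linExp_add_single hc',
      (commute_coeff_linExp hc (hc i) α).eq, (commute_coeff_linExp hc' (hc' i) α).eq,
      rtwist_mul _ _ _ fun a n => commute_coeff_of_commute_single (hs a i) n, ih, hcc']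

end LinExp

end Twist

/-! ### Multiplication operators -/

section Multiplication

theorem mulOp_mul (f g : Fun2) : mulOp (f * g) = mulOp f * mulOp g := by
  refine LinearMap.ext fun h => ?_
  change f * g * h = f * (g * h)
  exact mul_assoc f g h

/-- Multiplication operators form a ring. -/
def mulOpHom : Fun2 →+* Oper where
  toFun := mulOp
  map_one' := LinearMap.ext fun h => one_mul h
  map_mul' := mulOp_mul
  map_zero' := LinearMap.ext fun h => zero_mul h
  map_add' f g := LinearMap.ext fun h => add_mul f g h

theorem mulOp_injective : Function.Injective mulOp := fun f g h => by
  have h1 : f * 1 = g * 1 := DFunLike.congr_fun (F := Module.End ℂ Fun2) h 1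
  simpa using h1

theorem commute_mulOp (f g : Fun2) : Commute (mulOp f) (mulOp g) := by
  rw [Commute, SemiconjBy, ← mulOp_mul, mul_comm, mulOp_mul]

theorem dirDeriv_mulOp (v : ℝ × ℝ) (f : Fun2) :
    Oper.of (dirDeriv v) * mulOp f = mulOp f * Oper.of (dirDeriv v) + mulOp (dirDeriv v f) := by
  refine LinearMap.ext fun g => Subtype.ext (funext fun p => ?_)
  have hf := (contDiff_of_smooth f).differentiable (by simp) p
  have hg := (contDiff_of_smooth g).differentiable (by simp) p
  change fderiv ℝ ((f : ℝ × ℝ → ℂ) * (g : ℝ × ℝ → ℂ)) p v =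
    (f : ℝ × ℝ → ℂ) p * fderiv ℝ (g : ℝ × ℝ → ℂ) p v +
      fderiv ℝ (f : ℝ × ℝ → ℂ) p v * (g : ℝ × ℝ → ℂ) p
  rw [fderiv_mul hf hg]
  simp only [add_apply, smul_apply, smul_eq_mul]
  ring

theorem dirDeriv_expFun (c : ℂ) (a : ℝ) : dirDeriv (1, 0) (expFun c a) = c • expFun c a := by
  refine Subtype.ext (funext fun p => ?_)
  change fderiv ℝ (fun p : ℝ × ℝ => Complex.exp (c * ((p.2 + p.1 + a : ℝ) : ℂ))) p (1, 0) =
    c * Complex.exp (c * ((p.2 + p.1 + a : ℝ) : ℂ))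
  have hlin : HasFDerivAt (fun p : ℝ × ℝ => p.2 + p.1 + a)
      (ContinuousLinearMap.snd ℝ ℝ ℝ + ContinuousLinearMap.fst ℝ ℝ ℝ) p :=
    (hasFDerivAt_snd.add hasFDerivAt_fst).add_const a
  have h := ((Complex.ofRealCLM.hasFDerivAt.comp p hlin).const_mul c).cexp
  have h' : HasFDerivAt (fun p : ℝ × ℝ => Complex.exp (c * ((p.2 + p.1 + a : ℝ) : ℂ))) _ p := h
  rw [h'.fderiv]
  simp [mul_comm]

/-- Conjugation by `exp (c (s₀ + x))` shifts `∂` by `-c`. -/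
theorem mulOp_expFun_mul_dX (c : ℂ) (a : ℝ) :
    mulOp (expFun c a) * dX = (dX - c • 1) * mulOp (expFun c a) := by
  have h : dX * mulOp (expFun c a) = mulOp (expFun c a) * dX + c • mulOp (expFun c a) := by
    have := dirDeriv_mulOp (1, 0) (expFun c a)
    rw [dirDeriv_expFun] at this
    rw [dX, this]
    congr 1
    exact LinearMap.ext fun g => smul_mul_assoc c (expFun c a) g
  rw [sub_mul, smul_mul_assoc, one_mul, h, add_sub_cancel_right]

theorem dirDeriv_pull (a : ℝ) (f : Fun1) :
    dirDeriv (1, 0) (pull a f) = dirDeriv (0, 1) (pull a f) := by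
  refine Subtype.ext (funext fun p => ?_)
  have hlin : HasFDerivAt (fun p : ℝ × ℝ => p.2 + p.1 + a)
      (ContinuousLinearMap.snd ℝ ℝ ℝ + ContinuousLinearMap.fst ℝ ℝ ℝ) p :=
    (hasFDerivAt_snd.add hasFDerivAt_fst).add_const a
  have hf := ((contDiff_of_smooth f).differentiable (by simp) (p.2 + p.1 + a)).hasFDerivAt
  have h' : HasFDerivAt (fun p : ℝ × ℝ => (f : ℝ → ℂ) (p.2 + p.1 + a)) _ p := hf.comp p hlin
  change fderiv ℝ (fun p : ℝ × ℝ => (f : ℝ → ℂ) (p.2 + p.1 + a)) p (1, 0) =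
    fderiv ℝ (fun p : ℝ × ℝ => (f : ℝ → ℂ) (p.2 + p.1 + a)) p (0, 1)
  rw [h'.fderiv]
  simp

/-- Functions of `s₀ + x` commute with `∂_x - ∂_{s₀}`. -/
theorem commute_mulOp_pull (a : ℝ) (f : Fun1) : Commute (mulOp (pull a f)) (dX - dS0) := by
  rw [Commute, SemiconjBy, mul_sub, sub_mul, dX, dS0, dirDeriv_mulOp, dirDeriv_mulOp,
    dirDeriv_pull, add_sub_add_right_eq_sub]

theorem mulOp_pull_add (a b : ℝ) (f : Fun1) :
    mulOp (pull (b + a) f) = shiftBy b * mulOp (pull a f) * shiftBy (-b) := by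
  refine LinearMap.ext fun g => Subtype.ext (funext fun p => ?_)
  change (f : ℝ → ℂ) (p.2 + p.1 + (b + a)) * (g : ℝ × ℝ → ℂ) p =
    (f : ℝ → ℂ) (p.2 + (p.1 + b) + a) * (g : ℝ × ℝ → ℂ) (p.1 + b + -b, p.2)
  rw [add_neg_cancel_right]
  ring_nf

theorem mulOp_expFun_mul_expFun (c : ℂ) (a : ℝ) :
    mulOp (expFun c 0) * mulOp (expFun (-c) (-a)) = Complex.exp (c * a) • (1 : Oper) := by
  rw [← mulOp_mul]
  refine LinearMap.ext fun g => Subtype.ext (funext fun p => ?_)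
  change Complex.exp (c * ((p.2 + p.1 + 0 : ℝ) : ℂ)) *
    Complex.exp (-c * ((p.2 + p.1 + -a : ℝ) : ℂ)) * (g : ℝ × ℝ → ℂ) p =
    Complex.exp (c * a) * (g : ℝ × ℝ → ℂ) p
  rw [← Complex.exp_add]
  congr 2
  push_cast
  ring

end Multiplication

/-! ### Vertex operators as symbols of wave operators -/

section Vertex

open MvPowerSeries

variable {N : ℕ}

theorem Side.locExp_mul_self (d : Side) : d.locExp * d.locExp = 1 := by cases d <;> rfl

/-- A family of Laurent coefficients for the times, the time `p` of index `j` carrying the marker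
to the power `-j`. -/
def timeFamily (x : Time N → Oper) (p : Time N) : LaurentSeries Oper :=
  HahnSeries.single (-(p.index : ℤ)) (x p)

theorem timeFamily_add (x y : Time N → Oper) :
    timeFamily (x + y) = timeFamily x + timeFamily y :=
  funext fun _ => HahnSeries.single_add _ _ _

theorem timeFamily_smul (z : ℂ) (x : Time N → Oper) :
    timeFamily (z • x) = z • timeFamily x := by
  ext p n
  change (HahnSeries.single _ (z • x p)).coeff n = z • (HahnSeries.single _ (x p)).coeff n
  rw [HahnSeries.coeff_single, HahnSeries.coeff_single]
  split_ifs
  · rfl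
  · exact (smul_zero z).symm

theorem timeFamily_neg (x : Time N → Oper) : timeFamily (-x) = -timeFamily x := by
  rw [← neg_one_smul ℂ x, timeFamily_smul, neg_one_smul]

theorem commute_timeFamily {x y : Time N → Oper} (h : ∀ p q, Commute (x p) (y q)) (p q : Time N) :
    Commute (timeFamily x p) (timeFamily y q) := commute_single (h p q)

/-- The scalar coefficients of the exponents of the vertex operators. -/
def vertexCoeff (ε : ℝ) (d : Side) (ℓ : ℂ) (k : Fin N) : Time N → ℂ := fun p => match d, p with
  | .a, .t _ k' => if k' = k then (ε : ℂ)⁻¹ else 0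
  | .b, .tbar _ k' => if k' = k then (ε : ℂ)⁻¹ else 0
  | d, .s j => (ε : ℂ)⁻¹ * ((j : ℕ).factorial : ℂ)⁻¹ * (d.logInv ℓ - ((harmonic j : ℚ) : ℂ))
  | _, _ => 0

/-- The coefficients of the exponents of the operators `Γ^δ`, with `∂ + z` in place of `∂`. -/
def deltaOper (ε : ℝ) (z : ℂ) : Time N → Oper
  | .s j => ((ε : ℂ)⁻¹ * ((j : ℕ).factorial : ℂ)⁻¹) • ((ε : ℂ) • (dX + z • 1))
  | _ => 0

theorem exponent_eq (ε : ℝ) (d : Side) (ℓ : ℂ) (k : Fin N) :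
    exponent ε d ℓ k = linForm (timeFamily fun p => vertexCoeff ε d ℓ k p • (1 : Oper)) := by
  rw [exponent]
  congr 1
  funext p
  cases d <;> cases p <;> simp only [timeFamily, vertexCoeff, Time.index, zero_smul, map_zero]
  all_goals
    split_ifs
    · rfl
    · rw [zero_smul, map_zero]

theorem deltaExponent_eq (ε : ℝ) :
    (deltaExponent ε : OpSeries N) = linForm (timeFamily (deltaOper ε 0)) := by
  rw [deltaExponent]
  congr 1
  funext p
  cases p <;> simp only [timeFamily, deltaOper, Time.index, map_zero, zero_smul, add_zero]

theorem commute_deltaOper {x : Oper} (hx : Commute x dX) (ε : ℝ) (z : ℂ) (p : Time N) :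
    Commute x (deltaOper ε z p) := by
  cases p
  · exact Commute.zero_right x
  · exact Commute.zero_right x
  · exact ((hx.add_right ((Commute.one_right x).smul_right z)).smul_right _).smul_right _

/-- The logarithm in the exponent of a vertex operator is absorbed by a shift of `∂`. -/
theorem vertexCoeff_add_deltaOper {ε : ℝ} (hε : ε ≠ 0) (d : Side) (ℓ : ℂ) (k : Fin N)
    (p : Time N) : (-(d.locExp : ℂ) * vertexCoeff ε d ℓ k p) • (1 : Oper) +
      deltaOper ε (-((ε : ℂ)⁻¹ * ℓ)) p = waveOper ε d k p := by
  have hε' : (ε : ℂ) ≠ 0 := Complex.ofReal_ne_zero.2 hε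
  cases d <;> cases p <;>
    simp only [vertexCoeff, deltaOper, waveOper, Side.locExp, Side.logInv, mul_zero, zero_smul,
      add_zero, Int.cast_neg, Int.cast_one, neg_neg, one_mul, neg_mul]
  · split_ifs
    · rfl
    · rw [zero_smul]
  · rw [smul_add, smul_add, smul_add, smul_smul, smul_smul, smul_smul, smul_smul,
      add_left_comm, ← add_smul]
    congr 2
    field_simp
    ring
  · split_ifs
    · rfl
    · rw [neg_zero, zero_smul]
  · rw [smul_add, smul_add, smul_add, smul_smul, smul_smul, smul_smul, smul_smul,
      add_left_comm, ← add_smul]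
    congr 2
    field_simp
    ring

theorem coeff_mulPull (a : ℝ) (F : PowerSeries (Tau N)) (α : Time N →₀ ℕ) (n : ℤ) :
    (coeff α (mulPull a F)).coeff n =
      if n < 0 then 0 else mulOp (pull a (coeff α (PowerSeries.coeff n.natAbs F))) := by
  change (HahnSeries.ofPowerSeries ℤ Oper (PowerSeries.mk _)).coeff n = _
  rw [PowerSeries.coeff_coe, PowerSeries.coeff_mk]

/-- As the functions depend on `s₀ + x` only, a shift of `s₀` is conjugation by a shift of `x`. -/
theorem mulPull_add (a b : ℝ) (F : PowerSeries (Tau N)) :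
    mulPull (b + a) F = C (HahnSeries.single 0 (shiftBy b)) * mulPull a F *
      C (HahnSeries.single 0 (shiftBy (-b))) := by
  ext α n
  rw [coeff_mul_C, coeff_C_mul, HahnSeries.coeff_mul_single_zero,
    HahnSeries.coeff_single_zero_mul, coeff_mulPull, coeff_mulPull]
  split_ifs
  · rw [mul_zero, zero_mul]
  · exact mulOp_pull_add a b _

theorem commute_C_mulOp_mulPull (f : Fun2) (a : ℝ) (F : PowerSeries (Tau N)) :
    Commute (C (HahnSeries.single 0 (mulOp f))) (mulPull a F) := by
  ext α n
  rw [coeff_mul_C, coeff_C_mul, HahnSeries.coeff_mul_single_zero,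
    HahnSeries.coeff_single_zero_mul, coeff_mulPull]
  split_ifs
  · rw [mul_zero, zero_mul]
  · exact (commute_mulOp f _).eq

theorem commute_smul_one_timeFamily (y : Time N → ℂ) (F : LaurentSeries Oper) (p : Time N) :
    Commute F (timeFamily (fun p => y p • (1 : Oper)) p) := by
  ext n
  rw [timeFamily, HahnSeries.coeff_mul_single, HahnSeries.coeff_single_mul, smul_mul_assoc,
    one_mul, mul_smul_comm, mul_one]

theorem commute_deltaOper_deltaOper (ε : ℝ) (z : ℂ) (p q : Time N) :
    Commute (deltaOper ε z p) (deltaOper ε z q) :=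
  commute_deltaOper (commute_deltaOper (Commute.refl dX) ε z p).symm ε z q

theorem commute_smul_deltaOper (ε : ℝ) (z y : ℂ) (p q : Time N) :
    Commute ((y • deltaOper ε z : Time N → Oper) p) ((y • deltaOper ε z : Time N → Oper) q) :=
  ((commute_deltaOper_deltaOper ε z p q).smul_right y).smul_left y

/-- The exponential of the hierarchy is the product of the exponential of the vertex operator and of
the shifted exponential of `Γ^δ`; `z = 1` serves for the wave operator, `z = -1` for its inverse. -/
theorem linExp_waveOper {ε : ℝ} (hε : ε ≠ 0) (d : Side) (ℓ : ℂ) (k : Fin N) (z : ℂ) :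
    linExp (timeFamily fun p => (z * (-(d.locExp : ℂ) * vertexCoeff ε d ℓ k p)) • (1 : Oper)) *
      linExp (timeFamily (z • deltaOper ε (-((ε : ℂ)⁻¹ * ℓ)))) =
    linExp (timeFamily (z • waveOper ε d k)) := by
  have h := commute_smul_one_timeFamily
    fun p => z * (-(d.locExp : ℂ) * vertexCoeff ε d ℓ k p)
  have hfam : timeFamily (z • waveOper ε d k) =
      timeFamily (fun p => (z * (-(d.locExp : ℂ) * vertexCoeff ε d ℓ k p)) • (1 : Oper)) +
        timeFamily (z • deltaOper ε (-((ε : ℂ)⁻¹ * ℓ))) := by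
    rw [← timeFamily_add]
    congr 1
    funext p
    rw [Pi.add_apply, Pi.smul_apply, Pi.smul_apply, ← vertexCoeff_add_deltaOper hε d ℓ k p,
      smul_add, smul_smul]
  rw [hfam]
  exact (linExp_add (fun p q => h _ q)
    (fun p q => commute_timeFamily (commute_smul_deltaOper ε _ z) p q)
    (fun p q => (h _ p).symm)).symm

theorem mulOp_expFun_deltaOper (ε : ℝ) (c z : ℂ) (a : ℝ) (p : Time N) :
    mulOp (expFun c a) * deltaOper ε z p = deltaOper ε (z - c) p * mulOp (expFun c a) := by
  cases p
  · exact (mul_zero _).trans (zero_mul _).symm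
  · exact (mul_zero _).trans (zero_mul _).symm
  · simp only [deltaOper]
    rw [mul_smul_comm, mul_smul_comm, smul_mul_assoc, smul_mul_assoc, mul_add, add_mul,
      mulOp_expFun_mul_dX, sub_smul, mul_smul_comm, mul_one, sub_mul, sub_eq_add_neg,
      sub_eq_add_neg, add_mul, smul_mul_assoc, one_mul, neg_mul, smul_mul_assoc, one_mul,
      add_assoc, add_comm (-_), smul_mul_assoc c, one_mul]

theorem C_mulOp_expFun_mul_linExp (ε : ℝ) (c z y : ℂ) (a : ℝ) :
    C (HahnSeries.single 0 (mulOp (expFun c a))) *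
        linExp (timeFamily (y • deltaOper ε z : Time N → Oper)) =
      linExp (timeFamily (y • deltaOper ε (z - c))) *
        C (HahnSeries.single 0 (mulOp (expFun c a))) := by
  refine C_mul_linExp (commute_timeFamily (commute_smul_deltaOper ε _ y))
    (commute_timeFamily (commute_smul_deltaOper ε _ y)) fun p => ?_
  rw [timeFamily, timeFamily, HahnSeries.single_mul_single, HahnSeries.single_mul_single,
    Pi.smul_apply, Pi.smul_apply, mul_smul_comm, smul_mul_assoc, mulOp_expFun_deltaOper,
    zero_add, add_zero]

theorem commute_linExp_scalar (y : Time N → ℂ) (F : OpSeries N) :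
    Commute F (linExp (timeFamily fun p => y p • (1 : Oper))) :=
  commute_linExp (fun _ q => commute_smul_one_timeFamily y _ q)
    fun _ p => commute_smul_one_timeFamily y _ p

theorem expSeries_smul_exponent (ε : ℝ) (d : Side) (ℓ : ℂ) (k : Fin N) (z : ℂ) :
    expSeries (z • exponent ε d ℓ k) =
      linExp (timeFamily fun p => (z * vertexCoeff ε d ℓ k p) • (1 : Oper)) := by
  rw [exponent_eq, ← linForm_smul, ← timeFamily_smul, linExp]
  congr 3
  funext p
  rw [Pi.smul_apply, smul_smul]

theorem vertex_first_algebra {R : Type} [Ring R] {e l₁ l₂ l₂' m : R} (h₁ : Commute e l₁)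
    (h₂ : Commute e m) (h₃ : Commute m l₁) (h₄ : e * l₂ = l₂' * e) :
    e * l₁ * m * l₂ = m * (l₁ * l₂') * e := by
  rw [h₁.eq, mul_assoc l₁, h₂.eq, ← mul_assoc, ← h₃.eq, mul_assoc, mul_assoc, mul_assoc, h₄]
  simp only [mul_assoc]

theorem vertex_second_algebra {R : Type} [Ring R] {e l₁ l₂ l₂' : R} (h₁ : Commute l₁ l₂')
    (h₂ : e * l₂' = l₂ * e) (m : R) : l₂ * (e * l₁ * m) = e * (l₁ * l₂' * m) := by
  rw [h₁.eq, ← mul_assoc, ← mul_assoc, ← h₂]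
  simp only [mul_assoc]

/-- The first tensor factor of the vertex operators is the symbol of a wave operator times
`λ^{(s₀ + x)/ε}`. -/
theorem vertexFirst_apply {ε : ℝ} (hε : ε ≠ 0) {d : Side} {η : ℝ} (hη : (η : ℂ) = -(d.locExp : ℂ))
    (ℓ : ℂ) (M : Matrix (Fin N) (Fin N) (Tau N)) (i k : Fin N) :
    vertexFirst ε d η ℓ M i k = mulPull (-(η * (ε / 2))) (shiftCol ε d (-η) M i k) *
      linExp (symCoeff ε d k) * C (HahnSeries.single 0 (mulOp (expFun ((ε : ℂ)⁻¹ * ℓ) 0))) := by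
  have hexp : (η : ℂ) * (ε : ℂ)⁻¹ * d.logInv ℓ = (ε : ℂ)⁻¹ * ℓ := by
    rw [hη]
    cases d <;> simp [Side.logInv, Side.locExp]
  have hE := linExp_waveOper hε d ℓ k 1
  simp only [one_mul, one_smul] at hE
  have hconj := C_mulOp_expFun_mul_linExp (N := N) ε ((ε : ℂ)⁻¹ * ℓ) 0 1 0
  rw [one_smul, one_smul, zero_sub] at hconj
  change mulSeries (expFun _ 0) * expSeries ((η : ℂ) • exponent ε d ℓ k) *
    mulPull (0 - η * (ε / 2)) (shiftCol ε d (-η) M i k) * expSeries (deltaExponent ε) = _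
  rw [hexp, expSeries_smul_exponent, deltaExponent_eq, hη, zero_sub]
  change _ = _ * linExp (timeFamily (waveOper ε d k)) * _
  rw [← hE]
  exact vertex_first_algebra (commute_linExp_scalar _ _) (commute_C_mulOp_mulPull _ _ _)
    (commute_linExp_scalar _ _) hconj

/-- The second tensor factor of the vertex operators is `λ^{-(s₀' + x)/ε}` times the symbol of the
inverse of a wave operator. -/
theorem vertexSecond_apply {ε : ℝ} (hε : ε ≠ 0) {d : Side} {η : ℝ} (hη : (η : ℂ) = (d.locExp : ℂ))
    (ℓ : ℂ) (a : ℝ) (M : Matrix (Fin N) (Fin N) (Tau N)) (k j : Fin N) :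
    vertexSecond ε d η ℓ a M k j =
      C (HahnSeries.single 0 (mulOp (expFun (-((ε : ℂ)⁻¹ * ℓ)) a))) *
        (linExp (-symCoeff ε d k) * mulPull (a - η * (ε / 2)) (shiftRow ε d (-η) M k j)) := by
  have hexp : (η : ℂ) * (ε : ℂ)⁻¹ * d.logInv ℓ = -((ε : ℂ)⁻¹ * ℓ) := by
    rw [hη]
    cases d <;> simp [Side.logInv, Side.locExp]
  have hE := linExp_waveOper hε d ℓ k (-1)
  simp only [neg_mul, one_mul, neg_neg, neg_smul, one_smul] at hE
  have hconj := C_mulOp_expFun_mul_linExp (N := N) ε (-((ε : ℂ)⁻¹ * ℓ)) (-((ε : ℂ)⁻¹ * ℓ)) (-1) a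
  rw [sub_self, neg_one_smul, neg_one_smul] at hconj
  change expSeries (-deltaExponent ε) * (mulSeries (expFun _ a) *
    expSeries ((η : ℂ) • exponent ε d ℓ k) *
    mulPull (a - η * (ε / 2)) (shiftRow ε d (-η) M k j)) = _
  have hsym : linExp (-symCoeff ε d k) = linExp (timeFamily (-waveOper ε d k)) := by
    rw [timeFamily_neg]
    rfl
  rw [hexp, expSeries_smul_exponent, deltaExponent_eq, ← linForm_neg, ← timeFamily_neg, hη, hsym,
    ← hE]
  exact vertex_second_algebra (commute_linExp_scalar _ _).symm hconj _

end Vertex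

/-! ### The Hirota equations as bilinear equations of wave operators -/

section Hirota

open MvPowerSeries

variable {N : ℕ}

/-- The coefficients, at `s₀ + x + a`, of a matrix of power series in the local parameter. -/
def numer (a : ℝ) (P : Matrix (Fin N) (Fin N) (PowerSeries (Tau N))) : ℕ → TMat N Fun2 :=
  fun n i k => pullT a (PowerSeries.coeff n (P i k))

/-- The symbol of the wave operator with numerators `P`. -/
def symLeft (ε : ℝ) (d : Side) (a : ℝ) (P : Matrix (Fin N) (Fin N) (PowerSeries (Tau N))) : Op N :=
  fun i k => mulPull a (P i k) * linExp (symCoeff ε d k)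

/-- The symbol of the inverse wave operator with numerators `Q`. -/
def symRight (ε : ℝ) (d : Side) (a : ℝ) (Q : Matrix (Fin N) (Fin N) (PowerSeries (Tau N))) :
    Op N :=
  fun k j => linExp (-symCoeff ε d k) * mulPull a (Q k j)

theorem coeff_leftOp (ε : ℝ) (u : ℤ) (w : ℕ → TMat N Fun2) (i j : Fin N) (α : Time N →₀ ℕ)
    (n : ℤ) : (coeff α (leftOp ε u w i j)).coeff n = if n < 0 then 0 else
      mulOp (coeff α (w n.natAbs i j)) * shiftBy (((u * n.natAbs : ℤ) : ℝ) * ε) :=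
  coeff_ofTerms _ i j α n

theorem coeff_rightOp (ε : ℝ) (u : ℤ) (w : ℕ → TMat N Fun2) (i j : Fin N) (α : Time N →₀ ℕ)
    (n : ℤ) : (coeff α (rightOp ε u w i j)).coeff n = if n < 0 then 0 else
      shiftBy (((u * n.natAbs : ℤ) : ℝ) * ε) * mulOp (coeff α (w n.natAbs i j)) :=
  coeff_ofTerms _ i j α n

theorem rtwist_mulPull (ε : ℝ) (u : ℤ) (a : ℝ)
    (P : Matrix (Fin N) (Fin N) (PowerSeries (Tau N))) (i k : Fin N) (α : Time N →₀ ℕ) :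
    rtwist ε u (coeff α (mulPull a (P i k))) = coeff α (leftOp ε u (numer a P) i k) := by
  ext n
  rw [coeff_rtwist, coeff_mulPull, coeff_leftOp]
  split_ifs with h
  · rw [zero_mul]
  · rw [Int.natAbs_of_nonneg (by omega)]
    rfl

theorem ltwist_mulPull (ε : ℝ) (u : ℤ) (a : ℝ)
    (P : Matrix (Fin N) (Fin N) (PowerSeries (Tau N))) (i k : Fin N) (α : Time N →₀ ℕ) :
    ltwist ε u (coeff α (mulPull a (P i k))) = coeff α (rightOp ε u (numer a P) i k) := by
  ext n
  rw [coeff_ltwist, coeff_mulPull, coeff_rightOp]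
  split_ifs with h
  · rw [mul_zero]
  · rw [Int.natAbs_of_nonneg (by omega)]
    rfl

theorem commute_single_shiftBy_symCoeff (ε : ℝ) (d : Side) (k : Fin N) (a : ℝ) (p : Time N) :
    Commute (HahnSeries.single 0 (shiftBy a)) (symCoeff ε d k p) :=
  commute_single (commute_waveOper (commute_shiftBy_dX a) ε d k p)

theorem rtwist_symCoeff (ε : ℝ) (d : Side) (k : Fin N) (p : Time N) :
    rtwist ε d.locExp (symCoeff ε d k p) = opCoeff ε d k p := by
  ext n
  rw [coeff_rtwist, symCoeff, opCoeff, HahnSeries.coeff_single, HahnSeries.coeff_single]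
  split_ifs with h
  · rw [h]
  · rw [zero_mul]

theorem rtwist_neg (ε : ℝ) (u : ℤ) (F : LaurentSeries Oper) :
    rtwist ε u (-F) = -rtwist ε u F := by
  rw [← neg_one_smul ℂ F, rtwist_smul, neg_one_smul]

theorem rtwist_coeff_symLeft (ε : ℝ) (d : Side) (a : ℝ)
    (P : Matrix (Fin N) (Fin N) (PowerSeries (Tau N))) (i k : Fin N) (α : Time N →₀ ℕ) :
    rtwist ε d.locExp (coeff α (symLeft ε d a P i k)) =
      coeff α ((leftOp ε d.locExp (numer a P) * waveExp (opCoeff ε d) : Op N) i k) := by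
  classical
  rw [waveExp, Matrix.mul_diagonal, symLeft, coeff_mul, coeff_mul, rtwist_sum]
  refine Finset.sum_congr rfl fun p _ => ?_
  rw [rtwist_mul _ _ _ (commute_shiftBy_coeff_linExp (commute_symCoeff ε d k)
      (commute_single_shiftBy_symCoeff ε d k) · p.2),
    rtwist_coeff_linExp (commute_symCoeff ε d k) (commute_single_shiftBy_symCoeff ε d k)
      (commute_opCoeff ε d k) (rtwist_symCoeff ε d k), rtwist_mulPull]

theorem ltwist_coeff_symRight (ε : ℝ) (d : Side) (a : ℝ)
    (Q : Matrix (Fin N) (Fin N) (PowerSeries (Tau N))) (k j : Fin N) (β : Time N →₀ ℕ) :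
    ltwist ε d.locExp (coeff β (symRight ε d a Q k j)) =
      coeff β ((waveExp (-opCoeff ε d) * rightOp ε d.locExp (numer a Q) : Op N) k j) := by
  classical
  have hc : ∀ p q : Time N, Commute ((-symCoeff ε d k) p) ((-symCoeff ε d k) q) :=
    fun p q => (commute_symCoeff ε d k p q).neg_left.neg_right
  have hs : ∀ a (p : Time N), Commute (HahnSeries.single 0 (shiftBy a)) ((-symCoeff ε d k) p) :=
    fun a p => (commute_single_shiftBy_symCoeff ε d k a p).neg_right
  have hc' : ∀ p q : Time N, Commute ((-opCoeff ε d) k p) ((-opCoeff ε d) k q) :=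
    fun p q => (commute_opCoeff ε d k p q).neg_left.neg_right
  rw [waveExp, Matrix.diagonal_mul, symRight, coeff_mul, coeff_mul, ltwist_sum]
  refine Finset.sum_congr rfl fun p _ => ?_
  rw [ltwist_mul _ _ _ (commute_shiftBy_coeff_linExp hc hs · p.1),
    ltwist_eq_rtwist _ _ (commute_shiftBy_coeff_linExp hc hs · p.1),
    rtwist_coeff_linExp hc hs hc', ltwist_mulPull]
  intro p
  rw [Pi.neg_apply, rtwist_neg, rtwist_symCoeff]
  rfl

/-- The part of the coefficient of `λ^n` in the tensor product of the two vertex operators at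
`s₀ - s₀' = lε` that does not depend on `log λ`. -/
def symTensor (ε : ℝ) (d : Side) (L R : Op N) (l n : ℤ) : Bi N := fun α β i j =>
  (∑ k, coeff α (L i k) * HahnSeries.single 0 (shiftBy (-((l : ℝ) * ε))) *
    coeff β (R k j)).coeff (d.locExp * n) * shiftBy ((l : ℝ) * ε)

/-- All the dependence on `log λ` is the factor `e^{l log λ}` that comes from
`λ^{(s₀ + x)/ε} λ^{-(s₀' + x)/ε}`. -/
theorem tensorCoeff_vertex {ε : ℝ} (hε : ε ≠ 0) {d : Side} {η η' : ℝ}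
    (hη : (η : ℂ) = -(d.locExp : ℂ)) (hη' : (η' : ℂ) = (d.locExp : ℂ)) (ℓ : ℂ) (l n : ℤ)
    (M M' : Matrix (Fin N) (Fin N) (Tau N)) :
    tensorCoeff d (vertexFirst ε d η ℓ M) (vertexSecond ε d η' ℓ (-(l * ε)) M') n =
      Complex.exp ((l : ℂ) * ℓ) • symTensor ε d
        (symLeft ε d (-(η * (ε / 2))) (shiftCol ε d (-η) M))
        (symRight ε d (-(η' * (ε / 2))) (shiftRow ε d (-η') M')) l n := by
  have hε' : (ε : ℂ) ≠ 0 := Complex.ofReal_ne_zero.2 hε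
  funext α β
  ext1 i j
  change ((Matrix.map (vertexFirst ε d η ℓ M) (coeff α) *
    Matrix.map (vertexSecond ε d η' ℓ (-(l * ε)) M') (coeff β) :
      Matrix (Fin N) (Fin N) (LaurentSeries Oper)) i j).coeff (d.locExp * n) =
    Complex.exp ((l : ℂ) * ℓ) • ((∑ k, coeff α (symLeft ε d _ _ i k) * _ *
      coeff β (symRight ε d _ _ k j)).coeff (d.locExp * n) * shiftBy ((l : ℝ) * ε))
  rw [Matrix.mul_apply, HahnSeries.coeff_sum, HahnSeries.coeff_sum, Finset.sum_mul,
    Finset.smul_sum]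
  refine Finset.sum_congr rfl fun k _ => ?_
  rw [Matrix.map_apply, Matrix.map_apply, vertexFirst_apply hε hη, vertexSecond_apply hε hη',
    sub_eq_add_neg, mulPull_add, coeff_mul_C, coeff_C_mul]
  have hcomm : Commute (C (HahnSeries.single 0 (shiftBy (-((l : ℝ) * ε)))))
      (linExp (-symCoeff ε d k)) := by
    refine commute_linExp (fun p q => (commute_symCoeff ε d k p q).neg_left.neg_right)
      fun α p => ?_
    classical
    rw [coeff_C]
    split_ifs
    · exact (commute_single_shiftBy_symCoeff ε d k _ p).neg_right
    · exact Commute.zero_left _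
  have hR : linExp (-symCoeff ε d k) * (C (HahnSeries.single 0 (shiftBy (-((l : ℝ) * ε)))) *
      mulPull (-(η' * (ε / 2))) (shiftRow ε d (-η') M' k j) *
        C (HahnSeries.single 0 (shiftBy (-(-((l : ℝ) * ε)))))) =
      C (HahnSeries.single 0 (shiftBy (-((l : ℝ) * ε)))) *
        symRight ε d (-(η' * (ε / 2))) (shiftRow ε d (-η') M') k j *
        C (HahnSeries.single 0 (shiftBy (-(-((l : ℝ) * ε))))) := by
    rw [← mul_assoc, ← mul_assoc, ← hcomm.eq, mul_assoc (C _)]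
    rfl
  rw [hR, coeff_mul_C, coeff_C_mul, neg_neg]
  change (coeff α (symLeft ε d (-(η * (ε / 2))) (shiftCol ε d (-η) M) i k) * _ * _).coeff _ = _
  set X := coeff α (symLeft ε d (-(η * (ε / 2))) (shiftCol ε d (-η) M) i k)
  set Y := coeff β (symRight ε d (-(η' * (ε / 2))) (shiftRow ε d (-η') M') k j)
  have hexp : (HahnSeries.single 0 (mulOp (expFun ((ε : ℂ)⁻¹ * ℓ) 0)) : LaurentSeries Oper) *
      HahnSeries.single 0 (mulOp (expFun (-((ε : ℂ)⁻¹ * ℓ)) (-((l : ℝ) * ε)))) =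
      Complex.exp ((l : ℂ) * ℓ) • 1 := by
    rw [HahnSeries.single_mul_single, mulOp_expFun_mul_expFun, add_zero]
    have : (ε : ℂ)⁻¹ * ℓ * (((l : ℝ) * ε : ℝ) : ℂ) = (l : ℂ) * ℓ := by
      push_cast
      field_simp
    rw [this]
    ext m
    rw [HahnSeries.coeff_smul, HahnSeries.coeff_one, HahnSeries.coeff_single]
    split_ifs
    · rfl
    · exact (smul_zero _).symm
  rw [mul_assoc X, ← mul_assoc (HahnSeries.single 0 _), hexp, smul_mul_assoc, one_mul,
    mul_smul_comm, HahnSeries.coeff_smul, ← mul_assoc, ← mul_assoc,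
    HahnSeries.coeff_mul_single_zero]

/-- A series `λ^l ∑ Ψ_n λ^n` is single-valued, and its residue is the coefficient `Ψ_{-1-l}`. -/
theorem isLaurentExpansion_iff {M : Type} [AddCommGroup M] [Module ℂ M] (Ψ : ℤ → M) (l : ℤ) :
    (∃ c : ℤ → M, IsLaurentExpansion (fun ℓ n => Complex.exp ((l : ℂ) * ℓ) • Ψ n) c ∧
      c (-1) = 0) ↔ Ψ (-1 - l) = 0 := by
  constructor
  · rintro ⟨c, ⟨m, hm⟩, hc⟩
    by_cases hml : m = l
    · subst hml
      have h := hm 0 (-1 - m)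
      simp only [mul_zero, Complex.exp_zero, one_smul, sub_add_cancel] at h
      rw [h, hc]
    · -- Two different exponents of `e^{log λ}` can agree for all `log λ` on the zero series only.
      have h0 := hm 0 (-1 - l)
      have h1 := hm 1 (-1 - l)
      simp only [mul_zero, Complex.exp_zero, one_smul, mul_one] at h0 h1
      rw [← h0, ← sub_eq_zero, ← sub_smul] at h1
      refine (smul_eq_zero.1 h1).resolve_left fun h => hml ?_
      have h2 : Real.exp l = Real.exp m := by
        have h3 := sub_eq_zero.1 h
        exact Complex.ofReal_injective (by push_cast; exact h3)
      exact_mod_cast (Real.exp_injective h2).symm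
  · intro h
    refine ⟨fun n => Ψ (n - l), ⟨l, fun ℓ n => ?_⟩, h⟩
    simp only [add_sub_cancel_right]

/-- The residue of the product of symbols is the term at `Λ^{-l}` of the product of operators. -/
theorem symTensor_apply (ε : ℝ) (d : Side) (a b : ℝ)
    (P Q : Matrix (Fin N) (Fin N) (PowerSeries (Tau N))) {l r n : ℤ}
    (hn : d.locExp * n = r - d.locExp * l) (α β : Time N →₀ ℕ) (i j : Fin N) :
    symTensor ε d (symLeft ε d a P) (symRight ε d b Q) l n α β i j =
      ((coeffMat α (leftOp ε d.locExp (numer a P) * waveExp (opCoeff ε d)) *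
        shiftMat ε d.locExp (-d.locExp * r) *
        coeffMat β (waveExp (-opCoeff ε d) * rightOp ε d.locExp (numer b Q)) :
          Matrix (Fin N) (Fin N) (LaurentSeries Oper)) i j).coeff
          (-d.locExp * l) * shiftBy ((l : ℝ) * ε) := by
  rw [symTensor, hn, Matrix.mul_apply, HahnSeries.coeff_sum, HahnSeries.coeff_sum]
  congr 1
  refine Finset.sum_congr rfl fun k _ => ?_
  have hu : d.locExp * (-d.locExp * r) = -r := by
    linear_combination (-r) * d.locExp_mul_self
  rw [coeff_mul_shift_mul ε d.locExp_mul_self, shiftMat, Matrix.mul_diagonal,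
    rtwist_coeff_symLeft, ltwist_coeff_symRight, hu]
  rfl

/-- The Hirota quadratic equations are the bilinear equations of the wave operators made from the
numerators of the symbols. -/
theorem hirotaQuadratic_iff {ε : ℝ} (hε : ε ≠ 0)
    (τM τMs τbM τbMs : Matrix (Fin N) (Fin N) (Tau N)) :
    HirotaQuadratic ε τM τMs τbM τbMs ↔ Bilinear ε
      (leftOp ε (-1) (numer (-(ε / 2)) (shiftCol ε .a (-1) τM)) * waveExp (opCoeff ε .a))
      (waveExp (-opCoeff ε .a) * rightOp ε (-1) (numer (ε / 2) (shiftRow ε .a 1 τMs)))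
      (leftOp ε 1 (numer (ε / 2) (shiftCol ε .b 1 τbM)) * waveExp (opCoeff ε .b))
      (waveExp (-opCoeff ε .b) * rightOp ε 1 (numer (-(ε / 2)) (shiftRow ε .b (-1) τbMs))) := by
  have hstep : ∀ (l : ℤ) (r : ℕ), hirotaExpr ε τM τMs τbM τbMs l r = fun ℓ n =>
      Complex.exp ((l : ℂ) * ℓ) • (symTensor ε .a
        (symLeft ε .a (-(ε / 2)) (shiftCol ε .a (-1) τM))
        (symRight ε .a (ε / 2) (shiftRow ε .a 1 τMs)) l (n - (r - 1)) -
      symTensor ε .b (symLeft ε .b (ε / 2) (shiftCol ε .b 1 τbM))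
        (symRight ε .b (-(ε / 2)) (shiftRow ε .b (-1) τbMs)) l (n - (-r - 1))) := by
    intro l r
    funext ℓ n
    rw [hirotaExpr, tensorCoeff_vertex hε (by simp [Side.locExp]) (by simp [Side.locExp]),
      tensorCoeff_vertex hε (by simp [Side.locExp]) (by simp [Side.locExp]), ← smul_sub]
    simp only [Complex.ofReal_one, Complex.ofReal_neg, neg_neg, one_mul, neg_mul]
  have hcancel : ∀ (a : ℝ) (x y : Oper), x * shiftBy a = y * shiftBy a ↔ x = y := by
    intro a x y
    refine ⟨fun h => ?_, fun h => by rw [h]⟩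
    have := congrArg (· * shiftBy (-a)) h
    simpa only [mul_assoc, shiftBy_mul_shiftBy, add_neg_cancel, shiftBy_zero, mul_one] using this
  unfold HirotaQuadratic
  simp only [hstep]
  constructor
  · intro h r α β i j m
    have h1 := (isLaurentExpansion_iff _ (-m)).1 (h (-m) r)
    have h2 := congrFun (congrFun (congrFun (congrFun (sub_eq_zero.1 h1) α) β) i) j
    rw [symTensor_apply (r := r) _ _ _ _ _ _ (by simp only [Side.locExp]; ring),
      symTensor_apply (r := r) _ _ _ _ _ _ (by simp only [Side.locExp]; ring)] at h2
    have h3 := (hcancel _ _ _).1 h2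
    simpa only [Side.locExp, neg_neg, one_mul, neg_mul] using h3
  · intro h l r
    refine (isLaurentExpansion_iff _ l).2 (sub_eq_zero.2 ?_)
    funext α β
    ext1 i j
    rw [symTensor_apply (r := r) _ _ _ _ _ _ (by simp only [Side.locExp]; ring),
      symTensor_apply (r := r) _ _ _ _ _ _ (by simp only [Side.locExp]; ring)]
    refine (hcancel _ _ _).2 ?_
    have h3 := h r α β i j (-l)
    simpa only [Side.locExp, neg_neg, one_mul, neg_mul] using h3

end Hirota

/-! ### Division by the tau-function -/

section Quotient

open MvPowerSeries

variable {N : ℕ}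

/-- The ring homomorphism behind `pull`. -/
def pullHom (a : ℝ) : Fun1 →+* Fun2 where
  toFun := pull a
  map_one' := rfl
  map_mul' _ _ := rfl
  map_zero' := rfl
  map_add' _ _ := rfl

theorem pullT_zero (a : ℝ) : pullT a (0 : Tau N) = 0 := rfl

/-- Multiplication by a function of all variables, as a scalar matrix operator. -/
def diagMul : Coef N →+* Op N :=
  (Matrix.scalar (Fin N)).comp (MvPowerSeries.map (HahnSeries.C.comp mulOpHom))

theorem coeff_diagMul_mul [DecidableEq (Time N)] (f : Coef N) (F : Op N) (i j : Fin N)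
    (α : Time N →₀ ℕ) (n : ℤ) : (coeff α ((diagMul f * F : Op N) i j)).coeff n =
      ∑ p ∈ Finset.HasAntidiagonal.antidiagonal α,
        mulOp (coeff p.1 f) * (coeff p.2 (F i j)).coeff n := by
  change (coeff α ((Matrix.diagonal (fun _ => MvPowerSeries.map (HahnSeries.C.comp mulOpHom) f) *
    F : Op N) i j)).coeff n = _
  rw [Matrix.diagonal_mul, coeff_mul, HahnSeries.coeff_sum]
  refine Finset.sum_congr rfl fun p _ => ?_
  rw [coeff_map]
  exact HahnSeries.coeff_single_zero_mul

theorem coeff_mul_diagMul [DecidableEq (Time N)] (f : Coef N) (F : Op N) (i j : Fin N)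
    (α : Time N →₀ ℕ) (n : ℤ) : (coeff α ((F * diagMul f : Op N) i j)).coeff n =
      ∑ p ∈ Finset.HasAntidiagonal.antidiagonal α,
        (coeff p.1 (F i j)).coeff n * mulOp (coeff p.2 f) := by
  change (coeff α ((F * Matrix.diagonal
    (fun _ => MvPowerSeries.map (HahnSeries.C.comp mulOpHom) f) : Op N) i j)).coeff n = _
  rw [Matrix.mul_diagonal, coeff_mul, HahnSeries.coeff_sum]
  refine Finset.sum_congr rfl fun p _ => ?_
  rw [coeff_map]
  exact HahnSeries.coeff_mul_single_zero

theorem mulOp_coeff_mul [DecidableEq (Time N)] (f g : Coef N) (α : Time N →₀ ℕ) :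
    mulOp (coeff α (f * g)) = ∑ p ∈ Finset.HasAntidiagonal.antidiagonal α,
      mulOp (coeff p.1 f) * mulOp (coeff p.2 g) := by
  rw [coeff_mul]
  change mulOpHom _ = _
  rw [map_sum]
  exact Finset.sum_congr rfl fun p _ => map_mul mulOpHom _ _

theorem leftOp_eq_diagMul_mul (ε : ℝ) (u : ℤ) {w num : ℕ → TMat N Fun2} {f : Coef N}
    (h : ∀ n i j, w n i j * f = num n i j) : leftOp ε u num = diagMul f * leftOp ε u w := by
  classical
  ext i j α n
  rw [coeff_diagMul_mul, coeff_leftOp]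
  simp only [coeff_leftOp]
  split_ifs
  · simp
  · rw [← h, mul_comm, mulOp_coeff_mul, Finset.sum_mul]
    simp only [mul_assoc]

theorem rightOp_eq_mul_diagMul (ε : ℝ) (u : ℤ) {v num : ℕ → TMat N Fun2} {f : Coef N}
    (h : ∀ n i j, v n i j * f = num n i j) : rightOp ε u num = rightOp ε u v * diagMul f := by
  classical
  ext i j α n
  rw [coeff_mul_diagMul, coeff_rightOp]
  simp only [coeff_rightOp]
  split_ifs
  · simp
  · rw [← h, mulOp_coeff_mul, Finset.mul_sum]
    simp only [mul_assoc]

theorem opMatch_diagMul (f : Coef N) : OpMatch (diagMul f : Op N) (diagMul f) := by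
  refine opMatch_iff.2 fun α i j => ?_
  change LaurentMatch (coeff α ((Matrix.diagonal
    (fun _ => MvPowerSeries.map (HahnSeries.C.comp mulOpHom) f) : Op N) i j))
      (coeff α ((Matrix.diagonal
    (fun _ => MvPowerSeries.map (HahnSeries.C.comp mulOpHom) f) : Op N) i j))
  rw [Matrix.diagonal_apply]
  split_ifs
  · rw [coeff_map]
    exact .single_zero _
  · rw [map_zero]
    exact .zero

theorem commute_scalarOp {A : Oper} {F : Op N}
    (h : ∀ i j α n, Commute A ((coeff α (F i j)).coeff n)) : Commute (scalarOp A) F := by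
  ext i j α n
  rw [scalarOp, Matrix.diagonal_mul, Matrix.mul_diagonal, coeff_C_mul, coeff_mul_C,
    HahnSeries.coeff_single_zero_mul, HahnSeries.coeff_mul_single_zero]
  exact (h i j α n).eq

theorem commute_scalarOp_leftOp_numer (ε : ℝ) (u : ℤ) (a : ℝ)
    (P : Matrix (Fin N) (Fin N) (PowerSeries (Tau N))) :
    Commute (scalarOp (dX - dS0)) (leftOp ε u (numer a P)) := by
  refine commute_scalarOp fun i j α n => ?_
  rw [coeff_leftOp]
  split_ifs
  · exact Commute.zero_right _
  · exact (commute_mulOp_pull a _).symm.mul_right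
      ((commute_shiftBy_dX _).sub_right (commute_shiftBy_dirDeriv _ _)).symm

theorem commute_scalarOp_diagMul_pullT (a : ℝ) (f : Tau N) :
    Commute (scalarOp (dX - dS0)) (diagMul (pullT a f) : Op N) := by
  refine commute_scalarOp fun i j α n => ?_
  change Commute _ ((coeff α ((Matrix.diagonal
    (fun _ => MvPowerSeries.map (HahnSeries.C.comp mulOpHom) (pullT a f)) : Op N) i j)).coeff n)
  rw [Matrix.diagonal_apply]
  split_ifs
  · rw [coeff_map]
    change Commute _ ((HahnSeries.single 0 (mulOp (pull a (coeff α f)))).coeff n)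
    rw [HahnSeries.coeff_single]
    split_ifs
    · exact (commute_mulOp_pull a _).symm
    · exact Commute.zero_right _
  · rw [map_zero]
    exact Commute.zero_right _

/-- An operator whose coefficients are quotients of functions of `s₀ + x` has the same derivative
with respect to `s₀` and to `x`. -/
theorem dTimeS0_leftOp {ε : ℝ} {u : ℤ} {a b : ℝ} {w : ℕ → TMat N Fun2} {τ : Tau N}
    {P : Matrix (Fin N) (Fin N) (PowerSeries (Tau N))} (hu : IsUnit (pullT b τ))
    (h : ∀ n i j, w n i j * pullT b τ = numer a P n i j) :
    dTimeS0 (leftOp ε u w) =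
      scalarOp dX * leftOp ε u w - leftOp ε u w * scalarOp dX := by
  obtain ⟨t, ht⟩ := hu.map (diagMul : Coef N →+* Op N)
  have h1 := commute_scalarOp_leftOp_numer ε u a P
  rw [leftOp_eq_diagMul_mul ε u h, ← ht] at h1
  have h2 := commute_scalarOp_diagMul_pullT b τ
  rw [← ht] at h2
  have h3 := h2.units_inv_right.mul_right h1
  rw [Units.inv_mul_cancel_left] at h3
  have h4 : (scalarOp (dX - dS0) : Op N) = scalarOp dX - scalarOp dS0 := by
    rw [eq_sub_iff_add_eq, ← scalarOp_add, sub_add_cancel]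
  have h5 := h3.eq
  rw [h4, sub_mul, mul_sub, sub_eq_sub_iff_sub_eq_sub] at h5
  exact h5.symm

theorem term_leftOp_zero_apply (ε : ℝ) (u : ℤ) (w : ℕ → TMat N Fun2) (i j : Fin N)
    (α : Time N →₀ ℕ) :
    coeff α (term 1 (leftOp ε u w) 0 i j) = mulOp (coeff α (w 0 i j)) := by
  change (coeff α (leftOp ε u w i j)).coeff (1 * 0) = _
  rw [mul_zero, coeff_leftOp, if_neg (lt_irrefl _)]
  simp [shiftBy_zero]

theorem term_rightOp_zero_apply (ε : ℝ) (u : ℤ) (w : ℕ → TMat N Fun2) (i j : Fin N)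
    (α : Time N →₀ ℕ) :
    coeff α (term 1 (rightOp ε u w) 0 i j) = mulOp (coeff α (w 0 i j)) := by
  change (coeff α (rightOp ε u w i j)).coeff (1 * 0) = _
  rw [mul_zero, coeff_rightOp, if_neg (lt_irrefl _)]
  simp [shiftBy_zero]

theorem mulOp_coeff_one_apply (i j : Fin N) (α : Time N →₀ ℕ) :
    mulOp (coeff α ((1 : TMat N Fun2) i j)) = coeff α ((1 : TMat N Oper) i j) := by
  classical
  rw [Matrix.one_apply, Matrix.one_apply]
  split_ifs
  · rw [coeff_one, coeff_one]
    split_ifs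
    · exact map_one mulOpHom
    · exact map_zero mulOpHom
  · exact map_zero mulOpHom

theorem term_leftOp_zero_of_eq_one (ε : ℝ) (u : ℤ) {w : ℕ → TMat N Fun2} (hw : w 0 = 1) :
    term 1 (leftOp ε u w) 0 = 1 := by
  ext i j α : 3
  rw [term_leftOp_zero_apply, hw, mulOp_coeff_one_apply]

theorem term_rightOp_zero_of_eq_one (ε : ℝ) (u : ℤ) {w : ℕ → TMat N Fun2} (hw : w 0 = 1) :
    term 1 (rightOp ε u w) 0 = 1 := by
  ext i j α : 3
  rw [term_rightOp_zero_apply, hw, mulOp_coeff_one_apply]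

theorem orderGE_leftOp (ε : ℝ) (u : ℤ) (w : ℕ → TMat N Fun2) : OrderGE 0 (leftOp ε u w) :=
  orderGE_ofTerms _

theorem orderGE_rightOp (ε : ℝ) (u : ℤ) (w : ℕ → TMat N Fun2) : OrderGE 0 (rightOp ε u w) :=
  orderGE_ofTerms _

/-- A right inverse of a triangular operator is a left inverse: the leading coefficients are square
matrices over a commutative ring. -/
theorem rightOp_mul_leftOp {ε : ℝ} {u : ℤ} {w v : ℕ → TMat N Fun2}
    (h : leftOp ε u w * rightOp ε u v = 1) : rightOp ε u v * leftOp ε u w = 1 := by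
  set S := leftOp ε u w with hS
  set T := rightOp ε u v with hT
  have hlead : (term 1 S 0).map (constantCoeff (R := Oper)) *
      (term 1 T 0).map (constantCoeff (R := Oper)) = 1 := by
    rw [← Matrix.map_mul, ← term_zero_mul (orderGE_leftOp ε u w) (orderGE_rightOp ε u v), h,
      term_zero_one]
    exact Matrix.map_one _ (map_zero _) (map_one _)
  set a := (w 0).map (constantCoeff (R := Fun2)) with ha
  set b := (v 0).map (constantCoeff (R := Fun2)) with hb
  have hSa : (term 1 S 0).map (constantCoeff (R := Oper)) = a.map mulOpHom := by
    ext1 i j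
    exact term_leftOp_zero_apply ε u w i j 0
  have hTb : (term 1 T 0).map (constantCoeff (R := Oper)) = b.map mulOpHom := by
    ext1 i j
    exact term_rightOp_zero_apply ε u v i j 0
  have hab : a * b = 1 := by
    rw [hSa, hTb, ← Matrix.map_mul] at hlead
    have h1 : (1 : Matrix (Fin N) (Fin N) Fun2).map mulOpHom = 1 :=
      Matrix.map_one _ (map_zero _) (map_one _)
    exact Matrix.map_injective mulOp_injective (hlead.trans h1.symm)
  have hba : (term 1 T 0).map (coeff 0) * a.map mulOpHom = 1 := by
    change (term 1 T 0).map (constantCoeff (R := Oper)) * _ = 1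
    rw [hTb, ← Matrix.map_mul, mul_eq_one_comm.1 hab]
    exact Matrix.map_one _ (map_zero _) (map_one _)
  refine sub_eq_zero.1 (eq_zero_of_mul_eq_zero (orderGE_rightOp ε u v) _ hba ?_)
  rw [sub_mul, mul_assoc, h, mul_one, one_mul, sub_self]

theorem orderGE_leftOp_sub_one {ε : ℝ} {u : ℤ} {w : ℕ → TMat N Fun2} (hw : w 0 = 1) :
    OrderGE 1 (leftOp ε u w - 1) := by
  intro i j α n hn
  rcases lt_or_eq_of_le (Int.lt_add_one_iff.1 (show n < 0 + 1 from hn)) with h | rfl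
  · exact (orderGE_leftOp ε u w).sub orderGE_one i j α n h
  · have h1 := (term_leftOp_zero_of_eq_one ε u hw).trans (term_zero_one 1).symm
    have h2 := congrArg (coeff α) (congrFun (congrFun h1 i) j)
    exact sub_eq_zero.2 h2

theorem coeff_zero_miwa (ε : ℝ) (d : Side) (η : ℂ) (k : Fin N) (f : Tau N) :
    PowerSeries.coeff 0 (miwa ε d η k f) = f := by
  rw [miwa, PowerSeries.coeff_mk]
  have h : PowerSeries.coeff 0 (expSeries (η • bracket ε d k)) = 1 := by
    rw [PowerSeries.coeff, Finsupp.single_zero]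
    exact coeff_zero_expSeries _
  rw [h]
  rfl

theorem coeff_zero_weight_mul_miwa (ε : ℝ) (η : ℂ) (k i j : Fin N) (f : Tau N) :
    PowerSeries.coeff 0 (weight .a i j * miwa ε .a η k f) = if i = j then f else 0 := by
  rw [weight]
  split_ifs
  · rw [one_mul, coeff_zero_miwa]
  · rw [PowerSeries.coeff_zero_X_mul]

/-- The leading coefficient of a quotient whose numerator has the leading coefficient `τ · 1` is
the identity matrix. -/
theorem quotient_zero_eq_one {M : Matrix (Fin N) (Fin N) (Tau N)} {τ : Tau N}
    (hM : ∀ i, M i i = τ) {a : ℝ} {P : Matrix (Fin N) (Fin N) (PowerSeries (Tau N))}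
    (hP : ∀ i j, PowerSeries.coeff 0 (P i j) = if i = j then M i j else 0) {y : Coef N}
    (hy : pullT a τ * y = 1) : (Matrix.of fun i j => numer a P 0 i j * y) = 1 := by
  ext1 i j
  change pullT a (PowerSeries.coeff 0 (P i j)) * y = _
  rw [hP, Matrix.one_apply]
  split_ifs with h
  · subst h
    rw [hM, hy]
  · rw [pullT_zero, zero_mul]

end Quotient

end EMTH

end

theorem mainTheorem1 (N : ℕ) (ε : ℝ) (hε : ε ≠ 0) (τ : EMTH.Tau N) (hτ : IsUnit τ)
    (τM τMs τbM τbMs : Matrix (Fin N) (Fin N) (EMTH.Tau N))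
    (hM : ∀ i, τM i i = τ) (hMs : ∀ i, τMs i i = τ) :
    EMTH.IsMatrixTau ε τ τM τMs τbM τbMs ↔ EMTH.HirotaQuadratic ε τM τMs τbM τbMs := by
  rw [EMTH.hirotaQuadratic_iff hε]
  constructor
  · rintro ⟨w, v, wb, vb, -, hdress, hw, hv, hwb, hvb⟩
    rw [EMTH.leftOp_eq_diagMul_mul (num := EMTH.numer _ _) ε (-1) hw,
      EMTH.rightOp_eq_mul_diagMul (num := EMTH.numer _ _) ε (-1) hv,
      EMTH.leftOp_eq_diagMul_mul (num := EMTH.numer _ _) ε 1 hwb,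
      EMTH.rightOp_eq_mul_diagMul (num := EMTH.numer _ _) ε 1 hvb]
    have h := ((hdress.bilinear hε).mul_left
      (EMTH.opMatch_diagMul (EMTH.pullT (-(ε / 2)) τ))).mul_right
      (EMTH.opMatch_diagMul (EMTH.pullT (ε / 2) τ))
    simpa only [mul_assoc] using h
  · intro h
    have hu₁ : IsUnit (EMTH.pullT (-(ε / 2)) τ) :=
      hτ.map (MvPowerSeries.map (EMTH.pullHom (-(ε / 2))))
    have hu₂ : IsUnit (EMTH.pullT (ε / 2) τ) := hτ.map (MvPowerSeries.map (EMTH.pullHom (ε / 2)))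
    -- The symbols are forced by the quotient formulas: divide by `τ` at the two shifted arguments.
    obtain ⟨y₁, hy₁⟩ := hu₁.exists_right_inv
    obtain ⟨y₂, hy₂⟩ := hu₂.exists_right_inv
    have hq : ∀ {f y : EMTH.Coef N} (_ : f * y = 1) (num : ℕ → EMTH.TMat N EMTH.Fun2) (n : ℕ)
        (i j : Fin N), (num n i j * y) * f = num n i j := fun {f y} hy num n i j => by
      rw [mul_assoc, mul_comm y, hy, mul_one]
    set Pw := EMTH.numer (-(ε / 2)) (EMTH.shiftCol ε .a (-1) τM) with hPw
    set Pv := EMTH.numer (ε / 2) (EMTH.shiftRow ε .a 1 τMs) with hPv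
    set Pwb := EMTH.numer (ε / 2) (EMTH.shiftCol ε .b 1 τbM) with hPwb
    set Pvb := EMTH.numer (-(ε / 2)) (EMTH.shiftRow ε .b (-1) τbMs) with hPvb
    set w : ℕ → EMTH.TMat N EMTH.Fun2 := fun n i j => Pw n i j * y₁ with hw
    set v : ℕ → EMTH.TMat N EMTH.Fun2 := fun n i j => Pv n i j * y₂ with hv
    set wb : ℕ → EMTH.TMat N EMTH.Fun2 := fun n i j => Pwb n i j * y₁ with hwb
    set vb : ℕ → EMTH.TMat N EMTH.Fun2 := fun n i j => Pvb n i j * y₂ with hvb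
    have hw0 : w 0 = 1 := EMTH.quotient_zero_eq_one hM
      (fun i j => EMTH.coeff_zero_weight_mul_miwa ε (-1) j i j (τM i j)) hy₁
    have hv0 : v 0 = 1 := EMTH.quotient_zero_eq_one hMs
      (fun i j => EMTH.coeff_zero_weight_mul_miwa ε 1 i i j (τMs i j)) hy₂
    have hB : EMTH.Bilinear ε (EMTH.leftOp ε (-1) w * EMTH.waveExp (EMTH.opCoeff ε .a))
        (EMTH.waveExp (-EMTH.opCoeff ε .a) * EMTH.rightOp ε (-1) v)
        (EMTH.leftOp ε 1 wb * EMTH.waveExp (EMTH.opCoeff ε .b))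
        (EMTH.waveExp (-EMTH.opCoeff ε .b) * EMTH.rightOp ε 1 vb) := by
      have h' := (h.mul_left (EMTH.opMatch_diagMul y₁)).mul_right (EMTH.opMatch_diagMul y₂)
      rw [EMTH.leftOp_eq_diagMul_mul ε (-1) (hq hy₁ Pw),
        EMTH.leftOp_eq_diagMul_mul ε 1 (hq hy₁ Pwb),
        EMTH.rightOp_eq_mul_diagMul ε (-1) (hq hy₂ Pv),
        EMTH.rightOp_eq_mul_diagMul ε 1 (hq hy₂ Pvb)] at h'
      simp only [mul_assoc, ← map_mul, hy₂, map_one, mul_one] at h'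
      simp only [← mul_assoc, ← map_mul, mul_comm y₁, hy₁, map_one, one_mul] at h'
      exact h'
    have hmatch := EMTH.lax_of_bilinear (EMTH.commute_opCoeff ε .a) (EMTH.commute_opCoeff ε .b)
      (EMTH.commute_shiftOp_waveExp ε (-1) .a) (EMTH.commute_shiftOp_waveExp ε 1 .b) hB 0
    rw [Nat.cast_zero, neg_zero, EMTH.shiftOp_zero, EMTH.shiftOp_zero, mul_one, mul_one] at hmatch
    obtain ⟨hST, hSTb⟩ := hmatch.eq_one
      ((EMTH.orderGE_leftOp ε (-1) w).mul (EMTH.orderGE_rightOp ε (-1) v))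
      ((EMTH.orderGE_leftOp ε 1 wb).mul (EMTH.orderGE_rightOp ε 1 vb)) (by
        rw [EMTH.term_zero_mul (EMTH.orderGE_leftOp ε (-1) w) (EMTH.orderGE_rightOp ε (-1) v),
          EMTH.term_leftOp_zero_of_eq_one ε (-1) hw0,
          EMTH.term_rightOp_zero_of_eq_one ε (-1) hv0, mul_one])
    refine ⟨w, v, wb, vb, hw0, ?_, hq hy₁ Pw, hq hy₂ Pv, hq hy₁ Pwb, hq hy₂ Pvb⟩
    exact EMTH.isDressing_of_bilinear hε hST (EMTH.rightOp_mul_leftOp hST) hSTb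
      (EMTH.rightOp_mul_leftOp hSTb) (EMTH.orderGE_leftOp_sub_one hw0)
      (EMTH.orderGE_rightOp ε (-1) v) (EMTH.orderGE_leftOp ε 1 wb) (EMTH.orderGE_rightOp ε 1 vb)
      (EMTH.dTimeS0_leftOp hu₁ (hq hy₁ Pw)) (EMTH.dTimeS0_leftOp hu₁ (hq hy₁ Pwb)) hB
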